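/- **Setting.** Consider $\min_{x\in\mathbb R^d}\phi(x)=\frac1n\sum_{i=1}^n f_i(x)+r(x)$ with $f_i(x)=\mathbb E_{\xi_i\sim\mathcal D_i}[F_i(x,\xi_i)]$, over $n$ workers that are the nodes of a connected graph $\mathcal G$. Assume: 1. $r:\mathbb R^d\to(-\infty,+\infty]$ is proper, closed and convex; each $f_i$ is differentiable at every point of $\mathrm{dom}(r)$ with $\|\nabla f_i(x)-\nabla f_i(y)\|\le L\|x-y\|$ for $x,y\in\mathrm{dom}(r)$, where $L>0$; and $\phi$ is bounded below. 2. $W\in\mathbb R^{n\times n}$ is doubly stochastic (with nonnegative entries), $W_{ij}=0$ whenever $i\ne j$ are not adjacent in $\mathcal G$, $\mathrm{Null}(W-I)=\mathrm{span}\{\mathbf 1\}$, and $\rho:=\|W-J\|_2<1$, where $J=\frac1n\mathbf 1\mathbf 1^\top$. 3. The samples $\xi_i^t\sim\mathcal D_i$ ($1\le i\le n$, $t\ge0$) are independent, and there is $\sigma\ge0$ such that for all $i$ and all $x\in\mathrm{dom}(r)$ the stochastic gradients satisfy $\mathbb E[\nabla F_i(x,\xi_i)]=\nabla f_i(x)$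 and $\mathbb E\|\nabla F_i(x,\xi_i)-\nabla f_i(x)\|^2\le\sigma^2$. DProxSGT with step size $\eta$ starts from $x_i^0=x^0\in\mathrm{dom}(r)$, $y_i^{-1}=0$, $\nabla F_i(x_i^{-1},\xi_i^{-1})=0$ for all $i$. In iteration $t=0,1,\dots$ every worker $i$ draws one sample $\xi_i^t$ and the updates are $$y_i^{t-\frac12}=y_i^{t-1}+\nabla F_i(x_i^t,\xi_i^t)-\nabla F_i(x_i^{t-1},\xi_i^{t-1}),\quad y_i^t=\sum_{j}W_{ji}\,y_j^{t-\frac12},$$ $$x_i^{t+\frac12}=\mathrm{prox}_{\eta r}(x_i^t-\eta y_i^t),\quad x_i^{t+1}=\sum_{j}W_{ji}\,x_j^{t+\frac12},$$ where $\mathrm{prox}_{\eta r}(z)=\arg\min_y\{r(y)+\frac1{2\eta}\|y-z\|^2\}$. Let $\phi_\lambda(x)=\min_y\{\phi(y)+\frac1{2\lambda}\|y-x\|^2\}$ be the Moreau envelope, $\phi_\lambda^*=\inf_x\phi_\lambda(x)$ and $\lambda=\min\{\frac1{4L},\frac1{96\rho L}\}$. A random $X=[x_1,\dots,x_n]$ is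 an expected $\epsilon$-stationary point if $\frac1n\mathbb E\big[\sum_{i=1}^n\|\nabla\phi_\lambda(x_i)\|^2+L^2\|X(I-J)\|_F^2\big]\le\epsilon^2$ (with $\phi_\lambda$ differentiable and the expectation finite). Let $\nabla\mathbf F^0$ be the matrix with columns $\nabla F_i(x^0,\xi_i^0)$. For $\epsilon>0$ put $$\eta=\min\Big\{\tfrac1{4L},\tfrac{(1-\rho^2)^4}{96\rho L},\tfrac{\lambda(1-\rho^2)^3\epsilon^2}{9232\,\sigma^2}\Big\},\qquad T_\epsilon=\Big\lceil\frac{16(\phi_\lambda(x^0)-\phi_\lambda^*)}{\eta\epsilon^2}+\frac{1536\,\eta\,\mathbb E\|\nabla\mathbf F^0(I-J)\|_F^2}{n\lambda(1-\rho^2)^3\epsilon^2}\Big\rceil .$$ In the definitions of $\lambda$ and $\eta$, terms whose denominator is zero (because $\rho=0$ or $\sigma=0$) are read as $+\infty$. **Corollary (iteration complexity).** (a) For every $\epsilon>0$ and every integer $T\ge1$ with $T\ge T_\epsilon$: if $\tau$ is uniformly distributed on $\{0,1,\dots,T-1\}$ and independent of all the samples, then the iterate $X^\tau=[x_1^\tau,\dots,x_n^\tau]$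 of DProxSGT with the above $\eta$ is an expected $\epsilon$-stationary point. (b) If $\sigma>0$ and $\phi_\lambda(x^0)>\phi_\lambda^*$, then for all sufficiently small $\epsilon>0$ one has $\eta=\frac{\lambda(1-\rho^2)^3\epsilon^2}{9232\sigma^2}$, $T_\epsilon\ge1$, and both $T_\epsilon$ and the number of samples that each worker draws in $T_\epsilon$ iterations are at most $$C\,\frac{\sigma^2(\phi_\lambda(x^0)-\phi_\lambda^*)}{\lambda(1-\rho^2)^3\epsilon^4}$$ with the absolute constant $C=295424=2\cdot16\cdot9232$. That is, DProxSGT finds an expected $\epsilon$-stationary point in $O\big(\frac{\sigma^2(\phi_\lambda(x^0)-\phi_\lambda^*)}{\lambda(1-\rho^2)^3\epsilon^4}\big)$ iterations, with the same number of samples per worker. -/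

import Mathlib

open MeasureTheory ProbabilityTheory Filter Topology
open scoped BigOperators

noncomputable section

namespace DProx

/-- The space `ℝ^d` with the Euclidean norm. -/
abbrev Vec (d : ℕ) := EuclideanSpace ℝ (Fin d)

/-! ### Extended-valued functions, Moreau envelope, proximal mapping -/

/-- The effective domain of an extended-valued function. -/
def effDom {d : ℕ} (r : Vec d → EReal) : Set (Vec d) := {x | r x < ⊤}

/-- Proper closed convex functions `ℝ^d → (-∞, +∞]`. -/
structure IsClosedConvex {d : ℕ} (r : Vec d → EReal) : Prop where
  ne_bot : ∀ x, r x ≠ ⊥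
  nonempty_dom : (effDom r).Nonempty
  closed : LowerSemicontinuous r
  convex : Convex ℝ {p : Vec d × ℝ | r p.1 ≤ (p.2 : EReal)}

/-- The objective `ψ(y) + (1/(2λ)) ‖y - x‖²`, as a function of `y`. -/
def proxObj {d : ℕ} (ψ : Vec d → EReal) (lam : ℝ) (x y : Vec d) : EReal :=
  ψ y + ((1 / (2 * lam) * ‖y - x‖ ^ 2 : ℝ) : EReal)

/-- The Moreau envelope `ψ_λ(x) = min_y { ψ(y) + (1/(2λ)) ‖y - x‖² }`. -/
def moreauEnv {d : ℕ} (ψ : Vec d → EReal) (lam : ℝ) (x : Vec d) : ℝ :=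
  (⨅ y, proxObj ψ lam x y).toReal

/-- The proximal mapping `prox_{λψ}(x) = argmin_y { ψ(y) + (1/(2λ)) ‖y - x‖² }`. -/
def prox {d : ℕ} (ψ : Vec d → EReal) (lam : ℝ) (x : Vec d) : Vec d :=
  Classical.epsilon fun p => ∀ y, proxObj ψ lam x p ≤ proxObj ψ lam x y

/-! ### The composite stochastic problem -/

/-- The data of the problem: the regularizer `r`, the data distributions `D i`, the sample losses
`F i x ξ`, and their stochastic gradients `gradF i x ξ` (tied to `F` in `IsStochGrad`). -/
structure Problem (n d : ℕ) (Ξ : Fin n → Type*) [∀ i, MeasurableSpace (Ξ i)] where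
  r : Vec d → EReal
  D : ∀ i, Measure (Ξ i)
  F : ∀ i, Vec d → Ξ i → ℝ
  gradF : ∀ i, Vec d → Ξ i → Vec d

variable {n d : ℕ} {Ξ : Fin n → Type*} [∀ i, MeasurableSpace (Ξ i)]

/-- The local expected loss `f_i(x) = E_{ξ ∼ D_i} [F_i(x, ξ)]`. -/
def Problem.f (p : Problem n d Ξ) (i : Fin n) (x : Vec d) : ℝ := ∫ z, p.F i x z ∂(p.D i)

/-- `φ = (1/n) ∑ f_i + r`. -/
def Problem.phi (p : Problem n d Ξ) (x : Vec d) : EReal :=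
  ((1 / (n : ℝ) * ∑ i, p.f i x : ℝ) : EReal) + p.r x

/-- Structural assumption on the problem. -/
structure Problem.IsRegular (p : Problem n d Ξ) (L : ℝ) : Prop where
  isProb : ∀ i, IsProbabilityMeasure (p.D i)
  /-- the expectations defining `f_i` make sense around `dom r` -/
  integrable_F : ∀ i, ∀ x ∈ effDom p.r, ∀ᶠ y in 𝓝 x, Integrable (p.F i y) (p.D i)
  /-- (i) -/
  closedConvex : IsClosedConvex p.r
  /-- (ii) each `f_i` is `L`-smooth in `dom r` -/
  L_pos : 0 < L
  differentiable_f : ∀ i, ∀ x ∈ effDom p.r, DifferentiableAt ℝ (p.f i) x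
  smooth : ∀ i, ∀ x ∈ effDom p.r, ∀ y ∈ effDom p.r,
    ‖gradient (p.f i) x - gradient (p.f i) y‖ ≤ L * ‖x - y‖
  /-- (iii) `φ` is lower bounded -/
  bddBelow : ∃ m : ℝ, ∀ x, (m : EReal) ≤ p.phi x

/-- Assumption on the stochastic gradients: they are gradients of the sample losses, unbiased,
with variance at most `σ²`, on `dom r`. -/
structure Problem.IsStochGrad (p : Problem n d Ξ) (σ : ℝ) : Prop where
  measurable : ∀ i, Measurable fun q : Vec d × Ξ i => p.gradF i q.1 q.2
  hasGradient : ∀ i, ∀ x ∈ effDom p.r, ∀ᵐ z ∂(p.D i),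
    HasGradientAt (fun y => p.F i y z) (p.gradF i x z) x
  σ_nonneg : 0 ≤ σ
  integrable : ∀ i, ∀ x ∈ effDom p.r, Integrable (p.gradF i x) (p.D i)
  unbiased : ∀ i, ∀ x ∈ effDom p.r, ∫ z, p.gradF i x z ∂(p.D i) = gradient (p.f i) x
  integrable_sq : ∀ i, ∀ x ∈ effDom p.r,
    Integrable (fun z => ‖p.gradF i x z - gradient (p.f i) x‖ ^ 2) (p.D i)
  variance : ∀ i, ∀ x ∈ effDom p.r,
    ∫ z, ‖p.gradF i x z - gradient (p.f i) x‖ ^ 2 ∂(p.D i) ≤ σ ^ 2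

/-- The random samples: `ξ i t` has law `D i`, and all of them are jointly independent. -/
structure Problem.IsSampling (p : Problem n d Ξ) {Ω : Type*} [MeasurableSpace Ω] (P : Measure Ω)
    (ξ : ∀ i, ℕ → Ω → Ξ i) : Prop where
  measurable : ∀ i t, Measurable (ξ i t)
  law : ∀ i t, P.map (ξ i t) = p.D i
  indep : iIndepFun (fun (q : Fin n × ℕ) (ω : Ω) => ξ q.1 q.2 ω) P

/-! ### Mixing matrices -/

/-- The averaging matrix `J = 1 1ᵀ / n`. -/
def avgMatrix (n : ℕ) : Matrix (Fin n) (Fin n) ℝ := Matrix.of fun _ _ => 1 / (n : ℝ)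

/-- `ρ = ‖W - J‖₂` (spectral norm). -/
def mixRho (W : Matrix (Fin n) (Fin n) ℝ) : ℝ :=
  ‖Matrix.toEuclideanCLM (n := Fin n) (𝕜 := ℝ) (W - avgMatrix n)‖

/-- `W` is a mixing matrix for the graph `G`. -/
structure IsMixing (G : SimpleGraph (Fin n)) (W : Matrix (Fin n) (Fin n) ℝ) : Prop where
  /-- nonnegative entries, rows and columns sum to one -/
  doublyStochastic : W ∈ doublyStochastic ℝ (Fin n)
  support : ∀ i j, i ≠ j → ¬ G.Adj i j → W i j = 0
  null : LinearMap.ker (W - 1).mulVecLin = Submodule.span ℝ {fun _ : Fin n => (1 : ℝ)}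
  rho_lt_one : mixRho W < 1

/-! ### The algorithm -/

/-- The state at the start of iteration `t`: `x^t`, `y^{t-1}`, `∇F(x^{t-1}, ξ^{t-1})`, and the
number of samples that each worker has drawn so far. -/
structure State (n d : ℕ) where
  x : Fin n → Vec d
  y : Fin n → Vec d
  g : Fin n → Vec d
  used : Fin n → ℕ

/-- Initial state: a common starting point, `y^{-1} = 0`, zero previous gradients. -/
def initState (x0 : Vec d) : State n d where
  x := fun _ => x0
  y := fun _ => 0
  g := fun _ => 0
  used := fun _ => 0

/-- One iteration; `ξ i k` is the `k`-th sample that worker `i` draws. Each worker draws one. -/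
def Problem.step (p : Problem n d Ξ) (W : Matrix (Fin n) (Fin n) ℝ) (η : ℝ)
    (ξ : ∀ i, ℕ → Ξ i) (s : State n d) : State n d :=
  let g : Fin n → Vec d := fun i => p.gradF i (s.x i) (ξ i (s.used i))
  let yHalf : Fin n → Vec d := fun i => s.y i + g i - s.g i
  let y : Fin n → Vec d := fun i => ∑ j, W j i • yHalf j
  let xHalf : Fin n → Vec d := fun i => prox p.r η (s.x i - η • y i)
  { x := fun i => ∑ j, W j i • xHalf j
    y := y
    g := g
    used := fun i => s.used i + 1 }

/-- The state after `T` iterations of DProxSGT. -/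
def Problem.run (p : Problem n d Ξ) (W : Matrix (Fin n) (Fin n) ℝ) (η : ℝ) (x0 : Vec d)
    (ξ : ∀ i, ℕ → Ξ i) : ℕ → State n d
  | 0 => initState x0
  | T + 1 => p.step W η ξ (p.run W η x0 ξ T)

/-! ### Stationarity and the constants -/

/-- `‖X_⊥‖² = ∑ ‖x_i - x̄‖²`, the squared Frobenius norm of `X (I - J)`. -/
def consensusSq (X : Fin n → Vec d) : ℝ :=
  ∑ i, ‖X i - (1 / (n : ℝ)) • ∑ j, X j‖ ^ 2

/-- The random point `X` is an expected `ε`-stationary solution, measured with `φ_λ`, where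
`λ ∈ (0, 1/L)`; the gradient of `φ_λ` and the expectation are required to exist. -/
def Problem.IsExpectedStationary (p : Problem n d Ξ) (L lam ε : ℝ)
    {Ω : Type*} [MeasurableSpace Ω] (P : Measure Ω) (X : Ω → Fin n → Vec d) : Prop :=
  0 < lam ∧ lam < 1 / L ∧ Differentiable ℝ (moreauEnv p.phi lam) ∧
  Integrable (fun ω => (∑ i, ‖gradient (moreauEnv p.phi lam) (X ω i)‖ ^ 2)
      + L ^ 2 * consensusSq (X ω)) P ∧
  1 / (n : ℝ) * ∫ ω, ((∑ i, ‖gradient (moreauEnv p.phi lam) (X ω i)‖ ^ 2)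
      + L ^ 2 * consensusSq (X ω)) ∂P ≤ ε ^ 2

/-- `λ = min {1/(4L), 1/(96ρL)}`; for `ρ = 0` the second term is `+∞`. -/
def lamOf (L ρ : ℝ) : ℝ :=
  if ρ = 0 then 1 / (4 * L) else min (1 / (4 * L)) (1 / (96 * ρ * L))

/-- `min {1/(4L), (1-ρ²)⁴/(96ρL)}`; for `ρ = 0` the second term is `+∞`. -/
def etaMax (L ρ : ℝ) : ℝ :=
  if ρ = 0 then 1 / (4 * L) else min (1 / (4 * L)) ((1 - ρ ^ 2) ^ 4 / (96 * ρ * L))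

/-- The step size `η = min {1/(4L), (1-ρ²)⁴/(96ρL), λ(1-ρ²)³ε²/(9232σ²)}`; for `σ = 0` the last
term is `+∞`. -/
def etaOf (L ρ σ ε : ℝ) : ℝ :=
  if σ = 0 then etaMax L ρ
  else min (etaMax L ρ) (lamOf L ρ * (1 - ρ ^ 2) ^ 3 * ε ^ 2 / (9232 * σ ^ 2))

/-- `φ_λ(x⁰) - inf φ_λ`. -/
def Problem.gap (p : Problem n d Ξ) (lam : ℝ) (x0 : Vec d) : ℝ :=
  moreauEnv p.phi lam x0 - ⨅ x, moreauEnv p.phi lam x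

/-- `E ‖∇F⁰ (I - J)‖²`, where `∇F⁰` has the columns `∇F_i(x⁰, ξ_i⁰)`. -/
def Problem.initDispersion (p : Problem n d Ξ) {Ω : Type*} [MeasurableSpace Ω] (P : Measure Ω)
    (ξ : ∀ i, ℕ → Ω → Ξ i) (x0 : Vec d) : ℝ :=
  ∫ ω, consensusSq (fun i => p.gradF i x0 (ξ i 0 ω)) ∂P

/-- `T_ε`, in terms of the gap `Δ`, the initial dispersion `S` and `η, λ, ρ, ε`. -/
def iterBound (n : ℕ) (Δ S η lam ρ ε : ℝ) : ℕ :=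
  ⌈16 * Δ / (η * ε ^ 2) + 1536 * η * S / (n * lam * (1 - ρ ^ 2) ^ 3 * ε ^ 2)⌉₊

/-- `τ` is uniformly distributed on `{0, …, T-1}`. -/
def IsUniformIndex {Ω : Type*} [MeasurableSpace Ω] (P : Measure Ω) (T : ℕ) (τ : Ω → ℕ) : Prop :=
  0 < T ∧ Measurable τ ∧ ∀ t < T, P (τ ⁻¹' {t}) = 1 / (T : ENNReal)

end DProx

end

noncomputable section

namespace DProx

section

/-! ### Composite functions `f + r` with `f` smooth on `dom r` -/

/-! The Lyapunov function is the sum of the envelopes `φ_λ(x_i)`. Because `λL ≤ 1/4`, the proximal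
point `p_i` of `φ` at `x_i` depends Lipschitz continuously on `x_i`, and `∇φ_λ(x_i) = (x_i -
p_i)/λ`; so stationarity is measured by the residual `∑ ‖x_i - p_i‖²`. With `p_i` as competitor, the
envelope falls as soon as the half step lands closer to `p_i` than `x_i` was. Monotonicity of `∂r`
bounds the new distance by the norm of an explicit vector (`IsProxPt.norm_step_sub_le`), namely
`drift` minus `η` times the error of `y_i` as an estimate of the averaged gradient. The drift
shrinks squared distances by `1 - 3η/(4λ)`, up to consensus errors, and mixing costs little since
the envelope is weakly convex (`sumEnv_step_le`).

Gradient tracking keeps the mean of the `y_i` equal to the mean of the stochastic gradients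
(`avg_ys`). The error of `y_i` is therefore `y_i - avg y` plus averaged fresh noise. The first part
sums to zero over the workers and the second has mean zero given the past, so cross terms linear in
`η` disappear up to consensus errors, and only `η²` times the tracking error and the variance
remain.

The consensus error of `x` contracts by `(1+ρ²)/2` and is driven by `η²` times that of `y`
(`consensusSq_step_le`). The tracking error is a predictable part `pre` plus mixed fresh noise,
orthogonal in `L²`. The predictable part contracts too, driven by noise and by `L²‖x^{t+1} - x^t‖²`,
which the residual, both consensus errors and the noise control (`sumSq_step_sub_le`).

Summation over time gives a closed linear system of inequalities. The bounds `ρLη ≤ (1-ρ²)⁴/96` and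
`ρLλ ≤ 1/96` allow the feedback terms to be absorbed (`bound_of_linear_system`,
`RunSetting.sum_stationarity_le`). An independent uniform index turns the sum into an average: the
choice of `η` makes the variance contribute at most `ε²/2`, and `T_ε` does the same for the initial
gap and dispersion. For small `ε` the step size is proportional to `ε²`, so the argument of the
ceiling is `K/ε⁴` plus a constant (`exists_small_eps`). -/

/-- `f` has the `L`-Lipschitz gradient `g` at the points of `D`. -/
structure SmoothOn {d : ℕ} (D : Set (Vec d)) (f : Vec d → ℝ) (g : Vec d → Vec d) (L : ℝ) :
    Prop where
  nonneg : 0 ≤ L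
  grad : ∀ x ∈ D, HasGradientAt f (g x) x
  lip : ∀ x ∈ D, ∀ y ∈ D, ‖g x - g y‖ ≤ L * ‖x - y‖

/-- The extended-valued function `f + r`. -/
def comp {d : ℕ} (f : Vec d → ℝ) (r : Vec d → EReal) (x : Vec d) : EReal := (f x : EReal) + r x

/-- The real-valued proximal objective, meaningful on `dom r`. -/
def realObj {d : ℕ} (f : Vec d → ℝ) (r : Vec d → EReal) (lam : ℝ) (x y : Vec d) : ℝ :=
  f y + (r y).toReal + 1 / (2 * lam) * ‖y - x‖ ^ 2

/-- `p` minimizes the real-valued proximal objective over `dom r`. -/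
def IsProxPt {d : ℕ} (f : Vec d → ℝ) (r : Vec d → EReal) (lam : ℝ) (x p : Vec d) : Prop :=
  p ∈ effDom r ∧ ∀ y ∈ effDom r, realObj f r lam x p ≤ realObj f r lam x y

variable {d : ℕ} {r : Vec d → EReal} {f : Vec d → ℝ} {g : Vec d → Vec d} {L lam : ℝ}

lemma IsClosedConvex.coe_toReal (hr : IsClosedConvex r) {x : Vec d} (hx : x ∈ effDom r) :
    ((r x).toReal : EReal) = r x :=
  EReal.coe_toReal (ne_of_lt hx) (hr.ne_bot x)

lemma IsClosedConvex.convexOn (hr : IsClosedConvex r) :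
    ConvexOn ℝ (effDom r) fun x => (r x).toReal := by
  have key : ∀ x ∈ effDom r, ∀ y ∈ effDom r, ∀ a b : ℝ, 0 ≤ a → 0 ≤ b → a + b = 1 →
      r (a • x + b • y) ≤ ((a * (r x).toReal + b * (r y).toReal : ℝ) : EReal) := by
    intro x hx y hy a b ha hb hab
    have hx' : (x, (r x).toReal) ∈ {p : Vec d × ℝ | r p.1 ≤ (p.2 : EReal)} :=
      (hr.coe_toReal hx).ge
    have hy' : (y, (r y).toReal) ∈ {p : Vec d × ℝ | r p.1 ≤ (p.2 : EReal)} :=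
      (hr.coe_toReal hy).ge
    exact hr.convex hx' hy' ha hb hab
  have hD : Convex ℝ (effDom r) := fun x hx y hy a b ha hb hab =>
    lt_of_le_of_lt (key x hx y hy a b ha hb hab) (EReal.coe_lt_top _)
  refine ⟨hD, fun x hx y hy a b ha hb hab => ?_⟩
  have h := key x hx y hy a b ha hb hab
  rw [← hr.coe_toReal (hD hx hy ha hb hab)] at h
  exact_mod_cast h

/-- The mean value inequality is applied on the segment, where `‖g z - g x‖ ≤ L‖y - x‖`. This uses
gradients at points of `D` only and gives `L` where integration would give `L/2`; only absolute
constants are affected. -/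
lemma SmoothOn.first_order {D : Set (Vec d)} (hf : SmoothOn D f g L) (hD : Convex ℝ D)
    {x y : Vec d} (hx : x ∈ D) (hy : y ∈ D) :
    |f y - f x - inner ℝ (g x) (y - x)| ≤ L * ‖y - x‖ ^ 2 := by
  have hseg : segment ℝ x y ⊆ D := hD.segment_subset hx hy
  have h := Convex.norm_image_sub_le_of_norm_hasFDerivWithin_le' (𝕜 := ℝ)
    (f := f) (s := segment ℝ x y) (x := x) (y := y) (C := L * ‖y - x‖)
    (f' := fun z => InnerProductSpace.toDual ℝ (Vec d) (g z))
    (φ := InnerProductSpace.toDual ℝ (Vec d) (g x))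
    (fun z hz => (hf.grad z (hseg hz)).hasFDerivAt.hasFDerivWithinAt)
    (fun z hz => by
      rw [← map_sub, LinearIsometryEquiv.norm_map]
      refine (hf.lip z (hseg hz) x hx).trans (mul_le_mul_of_nonneg_left ?_ hf.nonneg)
      obtain ⟨a, b, ha, hb, hab, rfl⟩ := hz
      have : a • x + b • y - x = b • (y - x) := by
        rw [← eq_sub_iff_add_eq] at hab; subst hab; module
      rw [this, norm_smul, Real.norm_of_nonneg hb]
      nlinarith [norm_nonneg (y - x)])
    (convex_segment x y) (left_mem_segment ℝ x y) (right_mem_segment ℝ x y)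
  rw [InnerProductSpace.toDual_apply_apply, Real.norm_eq_abs] at h
  linarith

/-- A point of a sublevel set of a coercive quadratic is bounded. -/
lemma bounded_of_quadratic {k κ m c e s : ℝ} (hκ : κ < k) (hk : 0 ≤ k) (he : 0 ≤ e)
    (h : m - κ * s ^ 2 + k * (s - e) ^ 2 ≤ c) :
    s ≤ (2 * k * e + |c - m|) / (k - κ) + 1 := by
  by_contra! hs
  have hpos : 0 < k - κ := sub_pos.2 hκ
  have h0 : 0 ≤ (2 * k * e + |c - m|) / (k - κ) := by positivity
  have h1 : 2 * k * e + |c - m| < (s - 1) * (k - κ) := by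
    rw [← div_lt_iff₀ hpos]; linarith
  have hc := le_abs_self (c - m)
  have ha := abs_nonneg (c - m)
  nlinarith [mul_nonneg hk (sq_nonneg e), mul_nonneg (mul_nonneg hk he) (by linarith : 0 ≤ s)]

/-- Direct method. The concave quadratic minorant is allowed because the lemma also serves `r`
alone, for which boundedness of `φ` yields nothing better; `κ < 1/(2λ)` keeps the proximal objective
coercive. -/
lemma exists_isProxPt (hr : IsClosedConvex r) (hf : SmoothOn (effDom r) f g L)
    (hlam : 0 < lam) {y₀ : Vec d} (hy₀ : y₀ ∈ effDom r) {m κ : ℝ} (hκ : κ < 1 / (2 * lam))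
    (hbd : ∀ y ∈ effDom r, m - κ * ‖y - y₀‖ ^ 2 ≤ f y + (r y).toReal) (x : Vec d) :
    ∃ p, IsProxPt f r lam x p := by
  set c := realObj f r lam x y₀ with hc
  set R := (2 * (1 / (2 * lam)) * ‖y₀ - x‖ + |c - m|) / (1 / (2 * lam) - κ) + 1
  have hk : 0 ≤ 1 / (2 * lam) := by positivity
  have hR : ∀ y ∈ effDom r, realObj f r lam x y ≤ c → ‖y - y₀‖ ≤ R := by
    intro y hy hyc
    refine bounded_of_quadratic (m := m) hκ hk (norm_nonneg _) ?_
    have h1 := hbd y hy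
    have h2 : (‖y - y₀‖ - ‖y₀ - x‖) ^ 2 ≤ ‖y - x‖ ^ 2 := by
      rw [sq_le_sq, abs_of_nonneg (norm_nonneg (y - x))]
      have := abs_norm_sub_norm_le (y - y₀) (x - y₀)
      rwa [sub_sub_sub_cancel_right, norm_sub_rev x y₀] at this
    unfold realObj at hyc
    nlinarith [mul_le_mul_of_nonneg_left h2 hk]
  -- A sublevel point has `r` at most `kk`, since `f` is bounded below on the ball by its
  -- first-order expansion. Cutting with `{r ≤ kk}` gives a compact set inside `dom r`, although
  -- `dom r` need not be closed.
  set kk := c - f y₀ + ‖g y₀‖ * R + L * R ^ 2 with hkk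
  set K := Metric.closedBall y₀ R ∩ {y | r y ≤ (kk : EReal)} with hK
  have hmem : ∀ y ∈ effDom r, realObj f r lam x y ≤ c → y ∈ K := by
    intro y hy hyc
    have hyR := hR y hy hyc
    refine ⟨by rwa [Metric.mem_closedBall, dist_eq_norm], ?_⟩
    change r y ≤ _
    rw [← hr.coe_toReal hy, EReal.coe_le_coe_iff]
    have h1 := (abs_le.1 (hf.first_order hr.convexOn.1 hy₀ hy)).1
    have h2 := (abs_le.1 (abs_real_inner_le_norm (g y₀) (y - y₀))).1
    have h3 : ‖g y₀‖ * ‖y - y₀‖ ≤ ‖g y₀‖ * R := mul_le_mul_of_nonneg_left hyR (norm_nonneg _)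
    have h4 : L * ‖y - y₀‖ ^ 2 ≤ L * R ^ 2 := by
      have := hf.nonneg
      gcongr
    have h5 : 0 ≤ 1 / (2 * lam) * ‖y - x‖ ^ 2 := by positivity
    unfold realObj at hyc
    linarith
  have hKD : K ⊆ effDom r := fun y hy => lt_of_le_of_lt hy.2 (EReal.coe_lt_top _)
  have hKc : IsCompact K :=
    (isCompact_closedBall y₀ R).inter_right (hr.closed.isClosed_preimage _)
  have hlsc : LowerSemicontinuousOn (realObj f r lam x) K := by
    have h1 : ContinuousOn f K := fun y hy =>
      (hf.grad y (hKD hy)).differentiableAt.continuousAt.continuousWithinAt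
    have h2 : LowerSemicontinuousOn (fun y => (r y).toReal) K := by
      intro y hy a ha
      have : (a : EReal) < r y := by
        rw [← hr.coe_toReal (hKD hy)]; exact_mod_cast ha
      filter_upwards [(hr.closed y _ this).filter_mono nhdsWithin_le_nhds,
        self_mem_nhdsWithin] with z hz hzK
      rw [← hr.coe_toReal (hKD hzK)] at hz
      exact_mod_cast hz
    have h3 : ContinuousOn (fun y => 1 / (2 * lam) * ‖y - x‖ ^ 2) K := by fun_prop
    exact (h1.lowerSemicontinuousOn.add h2).add h3.lowerSemicontinuousOn
  obtain ⟨p, hp, hpmin⟩ := LowerSemicontinuousOn.exists_isMinOn ⟨y₀, hmem y₀ hy₀ le_rfl⟩ hKc hlsc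
  refine ⟨p, hKD hp, fun y hy => ?_⟩
  by_cases hyc : realObj f r lam x y ≤ c
  · exact hpmin (hmem y hy hyc)
  · exact (hpmin (hmem y₀ hy₀ le_rfl)).trans (not_le.1 hyc).le

lemma proxObj_comp_of_mem (hr : IsClosedConvex r) {x y : Vec d} (hy : y ∈ effDom r) :
    proxObj (comp f r) lam x y = (realObj f r lam x y : EReal) := by
  simp only [proxObj, comp, realObj]
  conv_lhs => rw [← hr.coe_toReal hy]
  push_cast
  rfl

lemma proxObj_comp_of_notMem {x y : Vec d} (hy : y ∉ effDom r) :
    proxObj (comp f r) lam x y = ⊤ := by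
  have : r y = ⊤ := by simpa [effDom] using hy
  simp only [proxObj, comp, this]
  rw [EReal.coe_add_top, EReal.top_add_coe]

lemma isProxPt_iff (hr : IsClosedConvex r) {x p : Vec d} :
    IsProxPt f r lam x p ↔ ∀ y, proxObj (comp f r) lam x p ≤ proxObj (comp f r) lam x y := by
  constructor
  · rintro ⟨hp, h⟩ y
    by_cases hy : y ∈ effDom r
    · rw [proxObj_comp_of_mem hr hp, proxObj_comp_of_mem hr hy]
      exact_mod_cast h y hy
    · rw [proxObj_comp_of_notMem hy]; exact le_top
  · intro h
    obtain ⟨y₀, hy₀⟩ := hr.nonempty_dom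
    have hp : p ∈ effDom r := by
      by_contra hp
      have := h y₀
      rw [proxObj_comp_of_notMem hp, proxObj_comp_of_mem hr hy₀] at this
      exact absurd this (not_le.2 (EReal.coe_lt_top _))
    refine ⟨hp, fun y hy => ?_⟩
    have := h y
    rw [proxObj_comp_of_mem hr hp, proxObj_comp_of_mem hr hy] at this
    exact_mod_cast this

lemma isProxPt_prox (hr : IsClosedConvex r) {x : Vec d} (h : ∃ p, IsProxPt f r lam x p) :
    IsProxPt f r lam x (prox (comp f r) lam x) :=
  (isProxPt_iff hr).2 (Classical.epsilon_spec (h.imp fun _ hp => (isProxPt_iff hr).1 hp))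

lemma IsProxPt.moreauEnv_eq (hr : IsClosedConvex r) {x p : Vec d} (h : IsProxPt f r lam x p) :
    moreauEnv (comp f r) lam x = realObj f r lam x p := by
  have : ⨅ y, proxObj (comp f r) lam x y = proxObj (comp f r) lam x p :=
    le_antisymm (iInf_le _ _) (le_iInf ((isProxPt_iff hr).1 h))
  rw [moreauEnv, this, proxObj_comp_of_mem hr h.1, EReal.toReal_coe]

/-- The optimality condition of the proximal problem. -/
lemma IsProxPt.variational (hr : IsClosedConvex r) (hf : SmoothOn (effDom r) f g L)
    {x p : Vec d} (h : IsProxPt f r lam x p) {y : Vec d} (hy : y ∈ effDom r) :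
    inner ℝ ((1 / lam) • (x - p) - g p) (y - p) ≤ (r y).toReal - (r p).toReal := by
  have hD := hr.convexOn.1
  set C := L * ‖y - p‖ ^ 2 + |1 / (2 * lam)| * ‖y - p‖ ^ 2 with hC
  -- The minimizer is compared with the point a fraction `s` of the way to `y`. After division by
  -- `s` the second-order terms leave `s * C`, which vanishes as `s → 0`.
  have key : ∀ s : ℝ, 0 < s → s ≤ 1 →
      inner ℝ ((1 / lam) • (x - p) - g p) (y - p) ≤ (r y).toReal - (r p).toReal + s * C := by
    intro s hs hs1
    set w := (1 - s) • p + s • y with hw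
    have hwD : w ∈ effDom r := hD h.1 hy (by linarith) hs.le (by ring)
    have hwp : w - p = s • (y - p) := by rw [hw]; module
    have h1 := h.2 w hwD
    have h2 : (r w).toReal ≤ (1 - s) * (r p).toReal + s * (r y).toReal :=
      hr.convexOn.2 h.1 hy (by linarith) hs.le (by ring)
    have h3 := (abs_le.1 (hf.first_order hD h.1 hwD)).2
    rw [hwp, inner_smul_right, norm_smul, Real.norm_of_nonneg hs.le] at h3
    have h4 : ‖w - x‖ ^ 2 = ‖p - x‖ ^ 2 + 2 * s * inner ℝ (p - x) (y - p) + s ^ 2 * ‖y - p‖ ^ 2 := by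
      have : w - x = (p - x) + s • (y - p) := by rw [← hwp]; abel
      rw [this, norm_add_sq_real, inner_smul_right, norm_smul, Real.norm_of_nonneg hs.le]; ring
    unfold realObj at h1
    rw [h4] at h1
    rw [inner_sub_left, inner_smul_left]
    have h5 : inner ℝ (p - x) (y - p) = - inner ℝ (x - p) (y - p) := by
      rw [← inner_neg_left, neg_sub]
    rw [h5] at h1
    have h6 : s ^ 2 * (1 / (2 * lam) * ‖y - p‖ ^ 2) ≤ s ^ 2 * (|1 / (2 * lam)| * ‖y - p‖ ^ 2) := by
      gcongr; exact le_abs_self _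
    have h7 : 1 / lam = 2 * (1 / (2 * lam)) := by field_simp
    simp only [conj_trivial]
    rw [h7]
    generalize 1 / (2 * lam) = k at *
    refine le_of_mul_le_mul_left ?_ hs
    rw [hC]
    nlinarith
  have hlim : Tendsto (fun s : ℝ => (r y).toReal - (r p).toReal + s * C) (𝓝[>] 0)
      (𝓝 ((r y).toReal - (r p).toReal + 0 * C)) := by
    apply Tendsto.mono_left _ nhdsWithin_le_nhds
    exact (Continuous.tendsto (by fun_prop) 0)
  rw [zero_mul, add_zero] at hlim
  refine ge_of_tendsto hlim ?_
  filter_upwards [Ioc_mem_nhdsGT (zero_lt_one' ℝ)] with s hs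
  exact key s hs.1 hs.2

/-- Monotonicity of the subdifferential of `r`, for two proximal problems. -/
lemma IsProxPt.monotone (hr : IsClosedConvex r) {f₁ f₂ : Vec d → ℝ} {g₁ g₂ : Vec d → Vec d}
    {L₁ L₂ lam₁ lam₂ : ℝ} (hf₁ : SmoothOn (effDom r) f₁ g₁ L₁)
    (hf₂ : SmoothOn (effDom r) f₂ g₂ L₂) {x₁ x₂ p₁ p₂ : Vec d}
    (h₁ : IsProxPt f₁ r lam₁ x₁ p₁) (h₂ : IsProxPt f₂ r lam₂ x₂ p₂) :
    0 ≤ inner ℝ (((1 / lam₁) • (x₁ - p₁) - g₁ p₁) - ((1 / lam₂) • (x₂ - p₂) - g₂ p₂))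
      (p₁ - p₂) := by
  have a := h₁.variational hr hf₁ h₂.1
  have b := h₂.variational hr hf₂ h₁.1
  rw [inner_sub_left]
  rw [← neg_sub p₁ p₂, inner_neg_right] at a
  linarith

lemma smoothOn_zero (D : Set (Vec d)) : SmoothOn D (fun _ => 0) (fun _ => 0) 0 :=
  ⟨le_rfl, fun x _ => hasGradientAt_const x 0, fun x _ y _ => by simp⟩

lemma comp_zero : comp (fun _ => 0) r = r := by
  funext x; simp [comp]

/-- The proximal mapping of a convex function is nonexpansive. -/
lemma IsProxPt.nonexpansive (hr : IsClosedConvex r) (hlam : 0 < lam) {x₁ x₂ p₁ p₂ : Vec d}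
    (h₁ : IsProxPt (fun _ => 0) r lam x₁ p₁) (h₂ : IsProxPt (fun _ => 0) r lam x₂ p₂) :
    ‖p₁ - p₂‖ ≤ ‖x₁ - x₂‖ := by
  have h := h₁.monotone hr (smoothOn_zero _) (smoothOn_zero _) h₂
  have e : ((1 / lam) • (x₁ - p₁) - 0) - ((1 / lam) • (x₂ - p₂) - 0)
      = (1 / lam) • ((x₁ - x₂) - (p₁ - p₂)) := by module
  rw [e, inner_smul_left, inner_sub_left, real_inner_self_eq_norm_sq] at h
  have h' := nonneg_of_mul_nonneg_right (a := 1 / lam) (by simpa using h) (by positivity)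
  have := real_inner_le_norm (x₁ - x₂) (p₁ - p₂)
  by_contra! hlt
  nlinarith [norm_nonneg (x₁ - x₂)]

/-- Comparison of a proximal gradient step with the proximal point of `f + r`. -/
lemma IsProxPt.norm_step_sub_le (hr : IsClosedConvex r) (hf : SmoothOn (effDom r) f g L) {η : ℝ}
    (hη : 0 < η) {x y z p : Vec d} (hz : IsProxPt (fun _ => 0) r η (x - η • y) z)
    (hp : IsProxPt f r lam x p) :
    ‖z - p‖ ≤ ‖(1 - η / lam) • (x - p) - η • (y - g p)‖ := by
  have h := hz.monotone hr (smoothOn_zero _) hf hp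
  set q := (1 - η / lam) • (x - p) - η • (y - g p) with hq
  have e : ((1 / η) • ((x - η • y) - z) - 0) - ((1 / lam) • (x - p) - g p)
      = (1 / η) • (q - (z - p)) := by
    have : η • (((1 / η) • ((x - η • y) - z) - 0) - ((1 / lam) • (x - p) - g p))
        = q - (z - p) := by
      rw [hq, sub_zero, smul_sub, smul_smul, mul_one_div_cancel hη.ne', one_smul, smul_sub η,
        smul_smul, ← mul_div_assoc, mul_one]
      module
    rw [← this, smul_smul, one_div_mul_cancel hη.ne', one_smul]
  rw [e, inner_smul_left, inner_sub_left, real_inner_self_eq_norm_sq] at h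
  have h' := nonneg_of_mul_nonneg_right (a := 1 / η) (by simpa using h) (by positivity)
  have := real_inner_le_norm q (z - p)
  by_contra! hlt
  nlinarith [norm_nonneg q]

/-- Monotonicity of `∂r`, weakened by the Lipschitz constant of `g`. Both Lipschitz estimates of the
proximal map follow: the factor `4/3` is `1/(1 - 1/4)`, and nonexpansiveness of the residual needs
only `λL ≤ 1/2`. -/
lemma IsProxPt.inner_ge (hr : IsClosedConvex r) (hf : SmoothOn (effDom r) f g L)
    (hlam : 0 < lam) {x₁ x₂ p₁ p₂ : Vec d} (h₁ : IsProxPt f r lam x₁ p₁)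
    (h₂ : IsProxPt f r lam x₂ p₂) :
    (1 - lam * L) * ‖p₁ - p₂‖ ^ 2 ≤ inner ℝ (x₁ - x₂) (p₁ - p₂) := by
  have h := h₁.monotone hr hf hf h₂
  have e : ((1 / lam) • (x₁ - p₁) - g p₁) - ((1 / lam) • (x₂ - p₂) - g p₂)
      = (1 / lam) • ((x₁ - x₂) - (p₁ - p₂)) - (g p₁ - g p₂) := by module
  rw [e, inner_sub_left, inner_smul_left, inner_sub_left, real_inner_self_eq_norm_sq] at h
  have h1 := (abs_le.1 (abs_real_inner_le_norm (g p₁ - g p₂) (p₁ - p₂))).1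
  have h2 := mul_le_mul_of_nonneg_right (hf.lip p₁ h₁.1 p₂ h₂.1) (norm_nonneg (p₁ - p₂))
  simp only [conj_trivial] at h
  have h3 : 0 ≤ lam * (1 / lam * (inner ℝ (x₁ - x₂) (p₁ - p₂) - ‖p₁ - p₂‖ ^ 2)
      + L * ‖p₁ - p₂‖ ^ 2) := by
    apply mul_nonneg hlam.le; linarith
  have h4 : lam * (1 / lam) = 1 := mul_one_div_cancel hlam.ne'
  rw [mul_add, ← mul_assoc, h4] at h3
  linarith

lemma IsProxPt.lipschitz (hr : IsClosedConvex r) (hf : SmoothOn (effDom r) f g L)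
    (hlam : 0 < lam) (hL : lam * L ≤ 1 / 4) {x₁ x₂ p₁ p₂ : Vec d} (h₁ : IsProxPt f r lam x₁ p₁)
    (h₂ : IsProxPt f r lam x₂ p₂) : ‖p₁ - p₂‖ ≤ 4 / 3 * ‖x₁ - x₂‖ := by
  have h := h₁.inner_ge hr hf hlam h₂
  have := real_inner_le_norm (x₁ - x₂) (p₁ - p₂)
  by_contra! hlt
  nlinarith [norm_nonneg (x₁ - x₂), norm_nonneg (p₁ - p₂), sq_nonneg ‖p₁ - p₂‖]

lemma IsProxPt.residual_lipschitz (hr : IsClosedConvex r) (hf : SmoothOn (effDom r) f g L)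
    (hlam : 0 < lam) (hL : lam * L ≤ 1 / 4) {x₁ x₂ p₁ p₂ : Vec d} (h₁ : IsProxPt f r lam x₁ p₁)
    (h₂ : IsProxPt f r lam x₂ p₂) : ‖(x₁ - p₁) - (x₂ - p₂)‖ ≤ ‖x₁ - x₂‖ := by
  have h := h₁.inner_ge hr hf hlam h₂
  have e : (x₁ - p₁) - (x₂ - p₂) = (x₁ - x₂) - (p₁ - p₂) := by abel
  refine le_of_sq_le_sq ?_ (norm_nonneg _)
  rw [e, norm_sub_sq_real]
  nlinarith [sq_nonneg ‖p₁ - p₂‖]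

end

section

/-! ### Weighted averages of vectors -/

section Weights

variable {ι E : Type*} [Fintype ι] [NormedAddCommGroup E] [InnerProductSpace ℝ E]

lemma norm_weighted_sum_sq_le {w : ι → ℝ} (hw : ∀ j, 0 ≤ w j) (h1 : ∑ j, w j = 1) (v : ι → E) :
    ‖∑ j, w j • v j‖ ^ 2 ≤ ∑ j, w j * ‖v j‖ ^ 2 := by
  have hc : ConvexOn ℝ Set.univ fun x : E => ‖x‖ ^ 2 :=
    (convexOn_norm convex_univ).pow (fun _ _ => norm_nonneg _) 2
  simpa using hc.map_sum_le (t := Finset.univ) (w := w) (p := v) (fun i _ => hw i) h1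
    (fun _ _ => Set.mem_univ _)

/-- The cross term vanishes at the mean. This lets spreads be measured from any convenient centre.
-/
lemma weighted_variance_le {w : ι → ℝ} (h1 : ∑ j, w j = 1) (v : ι → E) (c : E) :
    ∑ j, w j * ‖v j - ∑ k, w k • v k‖ ^ 2 ≤ ∑ j, w j * ‖v j - c‖ ^ 2 := by
  set m := ∑ k, w k • v k with hm
  have hz : ∑ j, w j * inner ℝ (v j - m) (m - c) = 0 := by
    have : ∑ j, w j • (v j - m) = 0 := by
      simp only [smul_sub, Finset.sum_sub_distrib, ← Finset.sum_smul, h1, one_smul, ← hm, sub_self]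
    calc ∑ j, w j * inner ℝ (v j - m) (m - c) = inner ℝ (∑ j, w j • (v j - m)) (m - c) := by
          rw [sum_inner]; simp only [inner_smul_left, conj_trivial]
      _ = 0 := by rw [this, inner_zero_left]
  have : ∀ j, w j * ‖v j - c‖ ^ 2 = w j * ‖v j - m‖ ^ 2 + 2 * (w j * inner ℝ (v j - m) (m - c))
      + w j * ‖m - c‖ ^ 2 := by
    intro j
    have e : v j - c = (v j - m) + (m - c) := by abel
    rw [e, norm_add_sq_real]; ring
  simp only [this, Finset.sum_add_distrib, ← Finset.mul_sum, hz, ← Finset.sum_mul, h1]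
  nlinarith [sq_nonneg ‖m - c‖]

end Weights

/-! ### The Moreau envelope of a smooth plus convex function -/

variable {d : ℕ} {r : Vec d → EReal} {f : Vec d → ℝ} {g : Vec d → Vec d} {L lam η : ℝ}

/-- Standing assumptions: `f` is smooth on the domain of the closed convex `r`, the parameters are
small, and the proximal points exist. -/
structure ProxSetting (r : Vec d → EReal) (f : Vec d → ℝ) (g : Vec d → Vec d)
    (L lam η : ℝ) : Prop where
  closedConvex : IsClosedConvex r
  smooth : SmoothOn (effDom r) f g L
  lam_pos : 0 < lam
  lam_mul_le : lam * L ≤ 1 / 4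
  eta_pos : 0 < η
  eta_le : η ≤ lam
  proxPt : ∀ x, IsProxPt f r lam x (prox (comp f r) lam x)
  proxPt_r : ∀ x, IsProxPt (fun _ => 0) r η x (prox r η x)

namespace ProxSetting

variable (h : ProxSetting r f g L lam η)
include h

lemma moreauEnv_eq (x : Vec d) :
    moreauEnv (comp f r) lam x = realObj f r lam x (prox (comp f r) lam x) :=
  (h.proxPt x).moreauEnv_eq h.closedConvex

lemma moreauEnv_le (x : Vec d) {y : Vec d} (hy : y ∈ effDom r) :
    moreauEnv (comp f r) lam x ≤ realObj f r lam x y := by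
  rw [h.moreauEnv_eq]; exact (h.proxPt x).2 y hy

/-- The proximal point of `x` is a competitor in the problem at `x'`. -/
lemma moreauEnv_sub_le (x x' : Vec d) :
    moreauEnv (comp f r) lam x' - moreauEnv (comp f r) lam x ≤
      1 / (2 * lam) * (2 * inner ℝ (x - prox (comp f r) lam x) (x' - x) + ‖x' - x‖ ^ 2) := by
  have h1 := h.moreauEnv_le x' (h.proxPt x).1
  rw [h.moreauEnv_eq x]
  set p := prox (comp f r) lam x
  have e1 : ‖p - x'‖ ^ 2 = ‖p - x‖ ^ 2 + 2 * inner ℝ (x - p) (x' - x) + ‖x' - x‖ ^ 2 := by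
    rw [norm_sub_rev p x', norm_sub_rev p x, ← norm_add_sq_real]; congr 2; abel
  simp only [realObj] at h1 ⊢
  rw [e1] at h1
  linarith

lemma residual_lipschitz (x x' : Vec d) :
    ‖(x - prox (comp f r) lam x) - (x' - prox (comp f r) lam x')‖ ≤ ‖x - x'‖ :=
  (h.proxPt x).residual_lipschitz h.closedConvex h.smooth h.lam_pos h.lam_mul_le (h.proxPt x')

lemma prox_lipschitz (x x' : Vec d) :
    ‖prox (comp f r) lam x - prox (comp f r) lam x'‖ ≤ 4 / 3 * ‖x - x'‖ :=
  (h.proxPt x).lipschitz h.closedConvex h.smooth h.lam_pos h.lam_mul_le (h.proxPt x')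

lemma prox_r_nonexpansive (x x' : Vec d) : ‖prox r η x - prox r η x'‖ ≤ ‖x - x'‖ :=
  (h.proxPt_r x).nonexpansive h.closedConvex h.eta_pos (h.proxPt_r x')

/-- `moreauEnv_sub_le` bounds the increment above; with `x` and `x'` exchanged it bounds it below,
with the residual at `x'` instead of `x`. Nonexpansiveness of the residual makes that difference
quadratic, so the remainder is `O(‖x' - x‖²)`. -/
lemma hasGradientAt_moreauEnv (x : Vec d) :
    HasGradientAt (moreauEnv (comp f r) lam) ((1 / lam) • (x - prox (comp f r) lam x)) x := by
  rw [hasGradientAt_iff_isLittleO]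
  have hk : 0 < 1 / (2 * lam) := by have := h.lam_pos; positivity
  have e : 1 / lam = 1 / (2 * lam) * 2 := by have := h.lam_pos; field_simp
  have hO : (fun x' => moreauEnv (comp f r) lam x' - moreauEnv (comp f r) lam x -
      inner ℝ ((1 / lam) • (x - prox (comp f r) lam x)) (x' - x)) =O[𝓝 x]
      fun x' => ‖x' - x‖ ^ 2 := by
    refine Asymptotics.IsBigO.of_bound (3 * (1 / (2 * lam))) (Eventually.of_forall fun x' => ?_)
    have h1 := h.moreauEnv_sub_le x x'
    have h2 := h.moreauEnv_sub_le x' x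
    have h3 := (abs_le.1 (abs_real_inner_le_norm
      ((x' - prox (comp f r) lam x') - (x - prox (comp f r) lam x)) (x' - x))).1
    have h4 := mul_le_mul_of_nonneg_right (h.residual_lipschitz x' x) (norm_nonneg (x' - x))
    rw [← neg_sub x' x, inner_neg_right, norm_neg] at h2
    rw [inner_sub_left] at h3
    rw [Real.norm_of_nonneg (by positivity : 0 ≤ ‖x' - x‖ ^ 2), Real.norm_eq_abs, abs_le,
      inner_smul_left, conj_trivial, e]
    generalize 1 / (2 * lam) = k at *
    constructor <;> nlinarith [sq_nonneg ‖x' - x‖]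
  refine hO.trans_isLittleO ?_
  have := (Asymptotics.isLittleO_pow_id (𝕜 := ℝ) (n := 2) (by norm_num)).comp_tendsto
    (k := fun x' : Vec d => ‖x' - x‖) (l' := 𝓝 x) (by
      have : Continuous fun x' : Vec d => ‖x' - x‖ := by fun_prop
      simpa using this.tendsto x)
  exact Asymptotics.IsLittleO.of_norm_right (by simpa [Function.comp_def] using this.norm_right)

lemma gradient_moreauEnv (x : Vec d) :
    gradient (moreauEnv (comp f r) lam) x = (1 / lam) • (x - prox (comp f r) lam x) :=
  (h.hasGradientAt_moreauEnv x).gradient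

lemma differentiable_moreauEnv : Differentiable ℝ (moreauEnv (comp f r) lam) :=
  fun x => (h.hasGradientAt_moreauEnv x).differentiableAt

/-- The Moreau envelope is weakly convex along weighted averages. -/
lemma moreauEnv_weighted_le {ι : Type*} [Fintype ι] {w : ι → ℝ} (hw : ∀ j, 0 ≤ w j)
    (h1 : ∑ j, w j = 1) (z : ι → Vec d) (c : Vec d) :
    moreauEnv (comp f r) lam (∑ j, w j • z j) ≤
      ∑ j, w j * moreauEnv (comp f r) lam (z j) + 16 / 9 * L * ∑ j, w j * ‖z j - c‖ ^ 2 := by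
  set P := fun x => prox (comp f r) lam x with hP
  -- The averaged proximal points are the competitor at the averaged argument. Convexity handles `r`
  -- and the squared norm; expanding `f` at `m` cancels the linear terms and leaves a variance,
  -- which the `4/3`-Lipschitz bound converts into `16/9` times that of the `z j`.
  set m := ∑ j, w j • P (z j) with hm
  have hD := h.closedConvex.convexOn
  have hmD : m ∈ effDom r := hD.1.sum_mem (fun i _ => hw i) h1 (fun i _ => (h.proxPt (z i)).1)
  have hk : 0 < 1 / (2 * lam) := by have := h.lam_pos; positivity
  have hr : (r m).toReal ≤ ∑ j, w j * (r (P (z j))).toReal := by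
    simpa using hD.map_sum_le (t := Finset.univ) (fun i _ => hw i) h1
      (fun i _ => (h.proxPt (z i)).1)
  have hf : f m ≤ ∑ j, w j * f (P (z j)) + L * ∑ j, w j * ‖P (z j) - m‖ ^ 2 := by
    have hj : ∀ j, w j * f m + inner ℝ (g m) (w j • (P (z j) - m)) ≤
        w j * f (P (z j)) + L * (w j * ‖P (z j) - m‖ ^ 2) := by
      intro j
      have := (abs_le.1 (h.smooth.first_order hD.1 hmD (h.proxPt (z j)).1)).1
      rw [inner_smul_right]
      nlinarith [hw j]
    have hs := Finset.sum_le_sum fun j (_ : j ∈ Finset.univ) => hj j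
    have hz : ∑ j, w j • (P (z j) - m) = 0 := by
      simp only [smul_sub, Finset.sum_sub_distrib, ← Finset.sum_smul, h1, one_smul, ← hm, sub_self]
    rw [Finset.sum_add_distrib, Finset.sum_add_distrib, ← Finset.sum_mul, h1, ← inner_sum, hz,
      inner_zero_right, ← Finset.mul_sum] at hs
    linarith
  have hq : ‖m - ∑ j, w j • z j‖ ^ 2 ≤ ∑ j, w j * ‖P (z j) - z j‖ ^ 2 := by
    have := norm_weighted_sum_sq_le hw h1 fun j => P (z j) - z j
    simpa only [smul_sub, Finset.sum_sub_distrib] using this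
  have hv : ∑ j, w j * ‖P (z j) - m‖ ^ 2 ≤ 16 / 9 * ∑ j, w j * ‖z j - c‖ ^ 2 := by
    refine (weighted_variance_le h1 (fun j => P (z j)) (P c)).trans ?_
    rw [Finset.mul_sum]
    refine Finset.sum_le_sum fun j _ => ?_
    have := h.prox_lipschitz (z j) c
    have h2 : ‖P (z j) - P c‖ ^ 2 ≤ (4 / 3 * ‖z j - c‖) ^ 2 :=
      pow_le_pow_left₀ (norm_nonneg _) this 2
    nlinarith [mul_le_mul_of_nonneg_left h2 (hw j)]
  have hL := h.smooth.nonneg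
  calc moreauEnv (comp f r) lam (∑ j, w j • z j)
      ≤ realObj f r lam (∑ j, w j • z j) m := h.moreauEnv_le _ hmD
    _ ≤ (∑ j, w j * f (P (z j)) + L * (16 / 9 * ∑ j, w j * ‖z j - c‖ ^ 2))
        + ∑ j, w j * (r (P (z j))).toReal
        + 1 / (2 * lam) * ∑ j, w j * ‖P (z j) - z j‖ ^ 2 := by
        unfold realObj
        gcongr
        exact hf.trans (by gcongr)
    _ = _ := by
        have : ∀ j, w j * moreauEnv (comp f r) lam (z j) = w j * f (P (z j))
            + w j * (r (P (z j))).toReal + 1 / (2 * lam) * (w j * ‖P (z j) - z j‖ ^ 2) := by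
          intro j; rw [h.moreauEnv_eq]; unfold realObj; ring
        simp only [this, Finset.sum_add_distrib, ← Finset.mul_sum]
        ring

/-- The drift of one proximal gradient step relative to the proximal point, when the gradient
estimate is `G`. -/
def _root_.DProx.drift (r : Vec d → EReal) (f : Vec d → ℝ) (g : Vec d → Vec d) (lam η : ℝ)
    (G x : Vec d) : Vec d :=
  (1 - η / lam) • (x - prox (comp f r) lam x) - η • (G - g (prox (comp f r) lam x))

lemma eta_mul_le : η * L ≤ η / lam / 4 := by
  have := h.lam_mul_le
  have h1 : η * L = η / lam * (lam * L) := by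
    have := h.lam_pos.ne'; field_simp
  rw [h1]
  have h2 : 0 ≤ η / lam := div_nonneg h.eta_pos.le h.lam_pos.le
  nlinarith

lemma ratio_le_one : η / lam ≤ 1 := (div_le_one h.lam_pos).2 h.eta_le

/-- With `G` shared, the Lipschitz factor is at most `(1 - η/λ) + (4/3)ηL ≤ 1`. It lets the drift at
`x_i` be replaced by the drift at the average point. -/
lemma drift_lipschitz (G x x' : Vec d) :
    ‖drift r f g lam η G x - drift r f g lam η G x'‖ ≤ ‖x - x'‖ := by
  have e : drift r f g lam η G x - drift r f g lam η G x' =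
      (1 - η / lam) • ((x - prox (comp f r) lam x) - (x' - prox (comp f r) lam x'))
        + η • (g (prox (comp f r) lam x) - g (prox (comp f r) lam x')) := by
    unfold drift; module
  have h1 := h.smooth.lip _ (h.proxPt x).1 _ (h.proxPt x').1
  have h2 := h.prox_lipschitz x x'
  have h3 := h.residual_lipschitz x x'
  have h4 := h.eta_mul_le
  have h5 := h.ratio_le_one
  have h6 := h.eta_pos
  have h7 := h.smooth.nonneg
  have h8 : 0 ≤ η / lam := div_nonneg h.eta_pos.le h.lam_pos.le
  rw [e]
  refine (norm_add_le _ _).trans ?_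
  rw [norm_smul, norm_smul, Real.norm_of_nonneg (by linarith), Real.norm_of_nonneg h6.le]
  calc _ ≤ (1 - η / lam) * ‖x - x'‖ + η * (L * (4 / 3 * ‖x - x'‖)) := by
        have : 0 ≤ 1 - η / lam := by linarith
        gcongr
        exact h1.trans (by gcongr)
    _ ≤ ‖x - x'‖ := by nlinarith [norm_nonneg (x - x')]

lemma norm_drift_sq_le {G x : Vec d} (hx : x ∈ effDom r) {B : ℝ} (hB : ‖G - g x‖ ≤ L * B) :
    ‖drift r f g lam η G x‖ ^ 2 ≤
      (1 - 3 / 4 * (η / lam)) * ‖x - prox (comp f r) lam x‖ ^ 2 + 1 / 12 * B ^ 2 := by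
  set θ := η / lam with hθ
  set A := ‖x - prox (comp f r) lam x‖ with hA
  have h4 := h.eta_mul_le
  have h5 := h.ratio_le_one
  have h6 := h.eta_pos
  have h7 := h.smooth.nonneg
  have h8 : 0 ≤ θ := div_nonneg h.eta_pos.le h.lam_pos.le
  have hA0 : 0 ≤ A := norm_nonneg _
  have hη : η = θ * lam := by rw [hθ]; have := h.lam_pos.ne'; field_simp
  have h1 := h.smooth.lip _ hx _ (h.proxPt x).1
  have e : drift r f g lam η G x = ((1 - θ) • (x - prox (comp f r) lam x)
      - η • (g x - g (prox (comp f r) lam x))) - η • (G - g x) := by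
    unfold drift; module
  have h9 : ‖drift r f g lam η G x‖ ≤ (1 - 3 / 4 * θ) * A + η * (L * B) := by
    rw [e]
    refine (norm_sub_le _ _).trans ?_
    rw [norm_smul _ (G - g x), Real.norm_of_nonneg h6.le]
    have h10 : ‖(1 - θ) • (x - prox (comp f r) lam x) - η • (g x - g (prox (comp f r) lam x))‖
        ≤ (1 - 3 / 4 * θ) * A := by
      refine (norm_sub_le _ _).trans ?_
      rw [norm_smul, norm_smul, Real.norm_of_nonneg (by linarith), Real.norm_of_nonneg h6.le]
      nlinarith [mul_le_mul_of_nonneg_left h1 h6.le]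
    nlinarith [mul_le_mul_of_nonneg_left hB h6.le]
  -- This scaling turns the bound into a convex combination of `A` and `b` with weights `1 - 3θ/4`
  -- and `3θ/4`, so convexity of the square costs no extra factor on `A²`.
  set b := 4 / 3 * (lam * L) * B with hb
  have h11 : η * (L * B) = 3 / 4 * θ * b := by rw [hη, hb]; ring
  rw [h11] at h9
  have h12 : ‖drift r f g lam η G x‖ ^ 2 ≤ ((1 - 3 / 4 * θ) * A + 3 / 4 * θ * b) ^ 2 :=
    pow_le_pow_left₀ (norm_nonneg _) h9 2
  have h13 : ((1 - 3 / 4 * θ) * A + 3 / 4 * θ * b) ^ 2 ≤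
      (1 - 3 / 4 * θ) * A ^ 2 + 3 / 4 * θ * b ^ 2 := by
    nlinarith [mul_nonneg (mul_nonneg h8 (by linarith : 0 ≤ 1 - 3 / 4 * θ)) (sq_nonneg (A - b))]
  have h14 : 3 / 4 * θ * b ^ 2 ≤ 1 / 12 * B ^ 2 := by
    have hl : 0 ≤ lam * L := mul_nonneg h.lam_pos.le h7
    have h15 : (lam * L) ^ 2 ≤ (1 / 4) ^ 2 := pow_le_pow_left₀ hl h.lam_mul_le 2
    have h16 : θ * (lam * L) ^ 2 ≤ 1 / 16 := by nlinarith [sq_nonneg (lam * L)]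
    rw [hb]
    nlinarith [sq_nonneg B]
  linarith

end ProxSetting

end

section

/-! ### Mixing -/

variable {n d : ℕ}

/-- The average of the columns. -/
def avg (v : Fin n → Vec d) : Vec d := (1 / (n : ℝ)) • ∑ j, v j

/-- The squared Frobenius norm. -/
def sumSq (v : Fin n → Vec d) : ℝ := ∑ i, ‖v i‖ ^ 2

/-- The columns of `V B`, where `V` has the columns `v j`. -/
def mix (B : Matrix (Fin n) (Fin n) ℝ) (v : Fin n → Vec d) (i : Fin n) : Vec d := ∑ j, B j i • v j

lemma sumSq_nonneg (v : Fin n → Vec d) : 0 ≤ sumSq v := Finset.sum_nonneg fun _ _ => by positivity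

lemma consensusSq_eq (v : Fin n → Vec d) : consensusSq v = ∑ i, ‖v i - avg v‖ ^ 2 := rfl

lemma consensusSq_nonneg (v : Fin n → Vec d) : 0 ≤ consensusSq v :=
  Finset.sum_nonneg fun _ _ => by positivity

lemma sum_sub_avg (v : Fin n → Vec d) : ∑ i, (v i - avg v) = 0 := by
  rcases Nat.eq_zero_or_pos n with rfl | hn
  · simp
  · have : (n : ℝ) ≠ 0 := by positivity
    rw [Finset.sum_sub_distrib, Finset.sum_const, Finset.card_univ, Fintype.card_fin, avg,
      ← Nat.cast_smul_eq_nsmul ℝ, smul_smul, mul_one_div_cancel this, one_smul, sub_self]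

lemma avg_sub (v w : Fin n → Vec d) : avg (fun i => v i - w i) = avg v - avg w := by
  simp [avg, Finset.sum_sub_distrib, smul_sub]

lemma avg_add (v w : Fin n → Vec d) : avg (fun i => v i + w i) = avg v + avg w := by
  simp [avg, Finset.sum_add_distrib, smul_add]

lemma sum_avg_weights (hn : 0 < n) : ∑ _j : Fin n, 1 / (n : ℝ) = 1 := by
  have : (n : ℝ) ≠ 0 := by positivity
  simp [this]

lemma avg_eq_weighted (v : Fin n → Vec d) : avg v = ∑ j, (1 / (n : ℝ)) • v j := by
  rw [avg, Finset.smul_sum]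

lemma norm_avg_sq_le (hn : 0 < n) (v : Fin n → Vec d) : n * ‖avg v‖ ^ 2 ≤ sumSq v := by
  have h := norm_weighted_sum_sq_le (w := fun _ : Fin n => 1 / (n : ℝ)) (fun _ => by positivity)
    (sum_avg_weights hn) v
  rw [← avg_eq_weighted, ← Finset.mul_sum] at h
  have hn' : (0 : ℝ) < n := by positivity
  calc n * ‖avg v‖ ^ 2 ≤ n * (1 / n * ∑ i, ‖v i‖ ^ 2) := by gcongr
    _ = sumSq v := by rw [sumSq]; field_simp

/-- A doubly stochastic matrix contracting by `ρ` on the complement of the consensus space. -/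
structure Mixes (W : Matrix (Fin n) (Fin n) ℝ) (ρ : ℝ) : Prop where
  entry_nonneg : ∀ i j, 0 ≤ W i j
  col_sum : ∀ i, ∑ j, W j i = 1
  row_sum : ∀ j, ∑ i, W j i = 1
  rho_nonneg : 0 ≤ ρ
  rho_lt_one : ρ < 1
  contract : ∀ {d : ℕ} (v : Fin n → Vec d), sumSq (mix (W - avgMatrix n) v) ≤ ρ ^ 2 * sumSq v

/-- Each coordinate of the columns is a vector on which the transpose of `B` acts, and the adjoint
has the same operator norm. -/
lemma sumSq_mix_le_norm (B : Matrix (Fin n) (Fin n) ℝ) (v : Fin n → Vec d) :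
    sumSq (mix B v) ≤ ‖Matrix.toEuclideanCLM (n := Fin n) (𝕜 := ℝ) B‖ ^ 2 * sumSq v := by
  have key : ∀ u : Fin n → ℝ, ∑ i, (∑ j, B j i * u j) ^ 2 ≤
      ‖Matrix.toEuclideanCLM (n := Fin n) (𝕜 := ℝ) B‖ ^ 2 * ∑ i, u i ^ 2 := by
    intro u
    have hs : ‖Matrix.toEuclideanCLM (n := Fin n) (𝕜 := ℝ) (star B)‖ =
        ‖Matrix.toEuclideanCLM (n := Fin n) (𝕜 := ℝ) B‖ := by
      rw [map_star, ContinuousLinearMap.star_eq_adjoint, LinearIsometryEquiv.norm_map]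
    have h := (Matrix.toEuclideanCLM (n := Fin n) (𝕜 := ℝ) (star B)).le_opNorm (WithLp.toLp 2 u)
    have h2 := pow_le_pow_left₀ (norm_nonneg _) h 2
    rw [hs, mul_pow, EuclideanSpace.real_norm_sq_eq, EuclideanSpace.real_norm_sq_eq] at h2
    simpa [Matrix.toEuclideanCLM_toLp, Matrix.mulVec, dotProduct, Matrix.star_apply] using h2
  have e : ∀ w : Fin n → Vec d, sumSq w = ∑ k, ∑ i, (w i k) ^ 2 := by
    intro w
    rw [Finset.sum_comm]
    exact Finset.sum_congr rfl fun i _ => EuclideanSpace.real_norm_sq_eq _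
  rw [e, e, Finset.mul_sum]
  refine Finset.sum_le_sum fun k _ => ?_
  simpa [mix] using key fun j => v j k

lemma IsMixing.mixes {G : SimpleGraph (Fin n)} {W : Matrix (Fin n) (Fin n) ℝ}
    (hW : IsMixing G W) : Mixes W (mixRho W) := by
  have h := mem_doublyStochastic_iff_sum.1 hW.doublyStochastic
  exact ⟨h.1, h.2.2, h.2.1, norm_nonneg _, hW.rho_lt_one, fun v => sumSq_mix_le_norm _ v⟩

/-- Young's inequality with the weights of the consensus recursion. -/
lemma young_contract {E : Type*} [NormedAddCommGroup E] {ρ : ℝ} (h0 : 0 ≤ ρ) (h1 : ρ < 1)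
    (a b : E) :
    ρ ^ 2 * ‖a + b‖ ^ 2 ≤
      (1 + ρ ^ 2) / 2 * ‖a‖ ^ 2 + 2 * ρ ^ 2 / (1 - ρ ^ 2) * ‖b‖ ^ 2 := by
  have hq : 0 < 1 - ρ ^ 2 := by nlinarith
  have h2 : ‖a + b‖ ^ 2 ≤ (‖a‖ + ‖b‖) ^ 2 := pow_le_pow_left₀ (norm_nonneg _) (norm_add_le a b) 2
  set x := ‖a‖
  set y := ‖b‖
  have h3 : ρ ^ 2 * (x + y) ^ 2 ≤ (1 + ρ ^ 2) / 2 * x ^ 2 + 2 * ρ ^ 2 / (1 - ρ ^ 2) * y ^ 2 := by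
    rw [← sub_nonneg]
    -- Young's inequality with parameter `(1-ρ²)/(2ρ²)`, written as a completed square so that `ρ =
    -- 0` is not excluded.
    have e : (1 + ρ ^ 2) / 2 * x ^ 2 + 2 * ρ ^ 2 / (1 - ρ ^ 2) * y ^ 2 - ρ ^ 2 * (x + y) ^ 2 =
        (((1 - ρ ^ 2) * x - 2 * ρ ^ 2 * y) ^ 2 + 2 * ρ ^ 2 * (1 - ρ ^ 2) * y ^ 2)
          / (2 * (1 - ρ ^ 2)) := by
      field_simp; ring
    rw [e]
    positivity
  nlinarith [mul_le_mul_of_nonneg_left h2 (sq_nonneg ρ)]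

namespace Mixes

variable {W : Matrix (Fin n) (Fin n) ℝ} {ρ : ℝ} (hW : Mixes W ρ)
include hW

lemma avg_mix (v : Fin n → Vec d) : avg (mix W v) = avg v := by
  unfold avg mix
  rw [Finset.sum_comm]
  simp only [← Finset.sum_smul, hW.row_sum, one_smul]

/-- `W - J` annihilates constant families, so the centre `c` is free. -/
lemma mix_sub_avg (v : Fin n → Vec d) (c : Vec d) (i : Fin n) :
    mix W v i - avg v = mix (W - avgMatrix n) (fun j => v j - c) i := by
  have hn : 0 < n := i.pos
  have h1 : ∑ j, (W j i - 1 / (n : ℝ)) = 0 := by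
    rw [Finset.sum_sub_distrib, hW.col_sum, sum_avg_weights hn, sub_self]
  simp only [mix, avgMatrix, Matrix.sub_apply, Matrix.of_apply, smul_sub, Finset.sum_sub_distrib,
    ← Finset.sum_smul, h1, zero_smul, sub_zero]
  simp only [sub_smul, Finset.sum_sub_distrib, avg_eq_weighted]

/-- The freedom in `c` matters: half steps are compared with the proximal image of the averaged
input, which differs in general from the average of the half steps. -/
lemma consensusSq_mix_le (v : Fin n → Vec d) (c : Vec d) :
    consensusSq (mix W v) ≤ ρ ^ 2 * ∑ i, ‖v i - c‖ ^ 2 := by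
  rw [consensusSq_eq, hW.avg_mix]
  simp only [hW.mix_sub_avg v c]
  exact hW.contract _

lemma sumSq_mix_le (v : Fin n → Vec d) : sumSq (mix W v) ≤ sumSq v := by
  calc sumSq (mix W v) ≤ ∑ i, ∑ j, W j i * ‖v j‖ ^ 2 := Finset.sum_le_sum fun i _ =>
        norm_weighted_sum_sq_le (fun j => hW.entry_nonneg j i) (hW.col_sum i) v
    _ = sumSq v := by
        rw [Finset.sum_comm]
        simp only [← Finset.sum_mul, hW.row_sum, one_mul, sumSq]

lemma mix_mem {D : Set (Vec d)} (hD : Convex ℝ D) {v : Fin n → Vec d} (hv : ∀ i, v i ∈ D)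
    (i : Fin n) : mix W v i ∈ D :=
  hD.sum_mem (fun j _ => hW.entry_nonneg j i) (hW.col_sum i) fun j _ => hv j

/-- `‖V (I - W)‖² ≤ 4 ‖V_⊥‖²`. -/
lemma sumSq_sub_mix_le (v : Fin n → Vec d) :
    ∑ i, ‖mix W v i - v i‖ ^ 2 ≤ 4 * consensusSq v := by
  have h1 := hW.contract fun j => v j - avg v
  have h2 : ∀ i, ‖mix W v i - v i‖ ^ 2 ≤
      2 * ‖mix (W - avgMatrix n) (fun j => v j - avg v) i‖ ^ 2 + 2 * ‖v i - avg v‖ ^ 2 := by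
    intro i
    rw [← hW.mix_sub_avg]
    have e : mix W v i - v i = (mix W v i - avg v) - (v i - avg v) := by abel
    rw [e]
    have := norm_sub_le (mix W v i - avg v) (v i - avg v)
    nlinarith [sq_nonneg (‖mix W v i - avg v‖ - ‖v i - avg v‖),
      norm_nonneg (mix W v i - avg v - (v i - avg v))]
  refine (Finset.sum_le_sum fun i _ => h2 i).trans ?_
  rw [Finset.sum_add_distrib, ← Finset.mul_sum, ← Finset.mul_sum, ← consensusSq_eq]
  have h3 : sumSq (mix (W - avgMatrix n) fun j => v j - avg v) ≤ consensusSq v := by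
    refine h1.trans ?_
    have hc : sumSq (fun j => v j - avg v) = consensusSq v := rfl
    rw [hc]
    have : ρ ^ 2 ≤ 1 := by nlinarith [hW.rho_nonneg, hW.rho_lt_one]
    nlinarith [consensusSq_nonneg v]
  unfold sumSq at h3
  linarith

end Mixes

/-! ### One iteration, path by path -/

variable {r : Vec d → EReal} {f : Vec d → ℝ} {g : Vec d → Vec d} {L lam η : ℝ}
  {gi : Fin n → Vec d → Vec d}

/-- The average of the local gradients, each at its own point. -/
def avgGrad (gi : Fin n → Vec d → Vec d) (x : Fin n → Vec d) : Vec d := avg fun j => gi j (x j)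

/-- `∑ ‖x_i - prox(x_i)‖²`. -/
def residualSq (r : Vec d → EReal) (f : Vec d → ℝ) (lam : ℝ) (x : Fin n → Vec d) : ℝ :=
  sumSq fun i => x i - prox (comp f r) lam (x i)

/-- The proximal gradient half step. -/
def halfStep (r : Vec d → EReal) (η : ℝ) (x y : Fin n → Vec d) (i : Fin n) : Vec d :=
  prox r η (x i - η • y i)

/-- The sum of the drifts of all workers. -/
def sumDrift (r : Vec d → EReal) (f : Vec d → ℝ) (g : Vec d → Vec d) (lam η : ℝ)
    (gi : Fin n → Vec d → Vec d) (x : Fin n → Vec d) : Vec d :=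
  ∑ i, drift r f g lam η (avgGrad gi x) (x i)

/-- The sum of the Moreau envelopes. -/
def sumEnv (r : Vec d → EReal) (f : Vec d → ℝ) (lam : ℝ) (x : Fin n → Vec d) : ℝ :=
  ∑ i, moreauEnv (comp f r) lam (x i)

/-- `g` is the average of the local gradients `gi`, each `L`-Lipschitz on `D`. -/
structure LocalGrads (D : Set (Vec d)) (g : Vec d → Vec d) (L : ℝ)
    (gi : Fin n → Vec d → Vec d) : Prop where
  avg_eq : ∀ x ∈ D, g x = avg fun i => gi i x
  lip : ∀ i, ∀ x ∈ D, ∀ y ∈ D, ‖gi i x - gi i y‖ ≤ L * ‖x - y‖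

lemma residualSq_nonneg (x : Fin n → Vec d) : 0 ≤ residualSq r f lam x := sumSq_nonneg _

lemma avg_mem (hn : 0 < n) {D : Set (Vec d)} (hD : Convex ℝ D) {v : Fin n → Vec d}
    (hv : ∀ i, v i ∈ D) : avg v ∈ D := by
  rw [avg_eq_weighted]
  exact hD.sum_mem (fun _ _ => by positivity) (sum_avg_weights hn) fun j _ => hv j

/-- The averaged local gradient differs from the gradient at `avg x` by at most `L` times the mean
deviation `β`, and that gradient from the one at `x i` by `L‖x i - avg x‖`. Hence the drift bound
applies with `B = β + ‖x i - avg x‖`. -/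
lemma sum_drift_sq_le (hn : 0 < n) (h : ProxSetting r f g L lam η)
    (hg : LocalGrads (effDom r) g L gi) {x : Fin n → Vec d} (hx : ∀ i, x i ∈ effDom r) :
    ∑ i, ‖drift r f g lam η (avgGrad gi x) (x i)‖ ^ 2 ≤
      (1 - 3 / 4 * (η / lam)) * residualSq r f lam x + 1 / 3 * consensusSq x := by
  have hn' : (0 : ℝ) < n := by positivity
  have hxb := avg_mem hn h.closedConvex.convexOn.1 hx
  have hL := h.smooth.nonneg
  set β := 1 / (n : ℝ) * ∑ j, ‖x j - avg x‖ with hβ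
  have hG : ‖avgGrad gi x - g (avg x)‖ ≤ L * β := by
    rw [hg.avg_eq _ hxb, avgGrad, ← avg_sub, avg_eq_weighted, hβ, Finset.mul_sum, Finset.mul_sum]
    refine (norm_sum_le _ _).trans (Finset.sum_le_sum fun j _ => ?_)
    rw [norm_smul, Real.norm_of_nonneg (by positivity)]
    have := mul_le_mul_of_nonneg_left (hg.lip j _ (hx j) _ hxb) (by positivity : 0 ≤ 1 / (n : ℝ))
    linarith
  have hβ2 : n * β ^ 2 ≤ consensusSq x := by
    have := sq_sum_le_card_mul_sum_sq (s := Finset.univ) (f := fun j => ‖x j - avg x‖)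
    rw [Finset.card_univ, Fintype.card_fin, ← consensusSq_eq] at this
    have e : n * β ^ 2 = 1 / n * (∑ j, ‖x j - avg x‖) ^ 2 := by rw [hβ]; field_simp
    rw [e]
    calc _ ≤ 1 / (n : ℝ) * (n * consensusSq x) := by gcongr
      _ = _ := by field_simp
  have hi : ∀ i, ‖drift r f g lam η (avgGrad gi x) (x i)‖ ^ 2 ≤
      (1 - 3 / 4 * (η / lam)) * ‖x i - prox (comp f r) lam (x i)‖ ^ 2
        + (1 / 6 * β ^ 2 + 1 / 6 * ‖x i - avg x‖ ^ 2) := by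
    intro i
    have hB : ‖avgGrad gi x - g (x i)‖ ≤ L * (β + ‖x i - avg x‖) := by
      have e : avgGrad gi x - g (x i) = (avgGrad gi x - g (avg x)) + (g (avg x) - g (x i)) := by
        abel
      rw [e]
      refine (norm_add_le _ _).trans ?_
      have := h.smooth.lip _ hxb _ (hx i)
      rw [norm_sub_rev (avg x)] at this
      linarith
    refine (h.norm_drift_sq_le (hx i) hB).trans ?_
    nlinarith [sq_nonneg (β - ‖x i - avg x‖)]
  refine (Finset.sum_le_sum fun i _ => hi i).trans ?_
  simp only [Finset.sum_add_distrib, ← Finset.mul_sum, Finset.sum_const, Finset.card_univ,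
    Fintype.card_fin, nsmul_eq_mul]
  rw [← consensusSq_eq]
  change _ * residualSq r f lam x + _ ≤ _
  linarith

/-- The half step brings the points closer to the proximal points, up to consensus errors and
gradient noise. -/
lemma sum_halfStep_sub_le (hn : 0 < n) (h : ProxSetting r f g L lam η)
    (hg : LocalGrads (effDom r) g L gi) {x : Fin n → Vec d} (hx : ∀ i, x i ∈ effDom r)
    (y : Fin n → Vec d) :
    ∑ i, ‖halfStep r η x y i - prox (comp f r) lam (x i)‖ ^ 2 ≤
      (1 - 3 / 4 * (η / lam)) * residualSq r f lam x + 4 / 3 * consensusSq x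
        + 2 * η ^ 2 * consensusSq y + n * η ^ 2 * ‖avg y - avgGrad gi x‖ ^ 2
        - 2 * η * inner ℝ (sumDrift r f g lam η gi x) (avg y - avgGrad gi x) := by
  set ν := avg y - avgGrad gi x with hν
  set c := fun u => drift r f g lam η (avgGrad gi x) u with hc
  -- `w` collects what pairs with `y i - avg y` and does not depend on `i`; these terms vanish in
  -- the sum. Replacing the drift at `x i` by the drift at `avg x` costs at most `‖x i - avg x‖`.
  set w := (2 * η ^ 2) • ν - (2 * η) • c (avg x) with hw
  have hi : ∀ i, ‖halfStep r η x y i - prox (comp f r) lam (x i)‖ ^ 2 ≤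
      ‖c (x i)‖ ^ 2 - 2 * η * inner ℝ (c (x i)) ν + ‖x i - avg x‖ ^ 2
        + 2 * η ^ 2 * ‖y i - avg y‖ ^ 2 + η ^ 2 * ‖ν‖ ^ 2 + inner ℝ w (y i - avg y) := by
    intro i
    have h1 := IsProxPt.norm_step_sub_le h.closedConvex h.smooth h.eta_pos
      (h.proxPt_r (x i - η • y i)) (h.proxPt (x i))
    have e : (1 - η / lam) • (x i - prox (comp f r) lam (x i))
        - η • (y i - g (prox (comp f r) lam (x i))) = c (x i) - η • (ν + (y i - avg y)) := by
      simp only [hc, drift, hν]; module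
    rw [e] at h1
    clear_value ν
    refine (pow_le_pow_left₀ (norm_nonneg _) h1 2).trans ?_
    have hwi : inner ℝ w (y i - avg y) = 2 * η ^ 2 * inner ℝ ν (y i - avg y)
        - 2 * η * inner ℝ (c (avg x)) (y i - avg y) := by
      rw [hw, inner_sub_left, inner_smul_left, inner_smul_left]; rfl
    rw [norm_sub_sq_real, norm_smul, mul_pow, Real.norm_eq_abs, sq_abs, norm_add_sq_real,
      inner_smul_right, inner_add_right, hwi]
    have h2 := (abs_le.1 (abs_real_inner_le_norm (c (x i) - c (avg x)) (y i - avg y))).1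
    have h3 : ‖c (x i) - c (avg x)‖ ≤ ‖x i - avg x‖ := h.drift_lipschitz _ _ _
    have h4 := mul_le_mul_of_nonneg_right h3 (norm_nonneg (y i - avg y))
    rw [inner_sub_left] at h2
    nlinarith [h.eta_pos, sq_nonneg (‖x i - avg x‖ - η * ‖y i - avg y‖)]
  refine (Finset.sum_le_sum fun i _ => hi i).trans ?_
  have hw0 : ∑ i, inner ℝ w (y i - avg y) = 0 := by
    rw [← inner_sum, sum_sub_avg, inner_zero_right]
  simp only [Finset.sum_add_distrib, Finset.sum_sub_distrib, ← Finset.mul_sum, ← sum_inner,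
    hw0, Finset.sum_const, Finset.card_univ, Fintype.card_fin, nsmul_eq_mul, ← consensusSq_eq]
  have := sum_drift_sq_le hn h hg hx
  simp only [sumDrift]
  linarith

/-- A single common reference point for all workers controls the spread of the half steps, both for
consensus and for the weak convexity error. -/
lemma norm_halfStep_sub_sq_le (h : ProxSetting r f g L lam η) (x y : Fin n → Vec d) (i : Fin n) :
    ‖halfStep r η x y i - prox r η (avg x - η • avg y)‖ ^ 2 ≤
      ‖(x i - avg x) + (-η) • (y i - avg y)‖ ^ 2 := by
  refine pow_le_pow_left₀ (norm_nonneg _) ((h.prox_r_nonexpansive _ _).trans (le_of_eq ?_)) 2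
  congr 1; module

lemma consensusSq_step_le (h : ProxSetting r f g L lam η) {W : Matrix (Fin n) (Fin n) ℝ} {ρ : ℝ}
    (hW : Mixes W ρ) (x y : Fin n → Vec d) :
    consensusSq (mix W (halfStep r η x y)) ≤ (1 + ρ ^ 2) / 2 * consensusSq x
      + 2 * ρ ^ 2 * η ^ 2 / (1 - ρ ^ 2) * consensusSq y := by
  refine (hW.consensusSq_mix_le _ (prox r η (avg x - η • avg y))).trans ?_
  rw [consensusSq_eq, consensusSq_eq, Finset.mul_sum, Finset.mul_sum, Finset.mul_sum,
    ← Finset.sum_add_distrib]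
  refine Finset.sum_le_sum fun i _ => ?_
  refine (mul_le_mul_of_nonneg_left (norm_halfStep_sub_sq_le h x y i) (sq_nonneg ρ)).trans ?_
  refine (young_contract hW.rho_nonneg hW.rho_lt_one _ _).trans (le_of_eq ?_)
  rw [norm_smul, mul_pow, Real.norm_eq_abs, sq_abs]; ring

/-- The descent inequality. Mixing costs weak convexity times the spread of the half steps; the half
step gains `1/(2λ)` times the decrease of the squared distance to the old proximal points. The inner
product with the averaged noise is kept exactly, since it will integrate to zero. -/
lemma sumEnv_step_le (hn : 0 < n) (h : ProxSetting r f g L lam η)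
    (hg : LocalGrads (effDom r) g L gi) {W : Matrix (Fin n) (Fin n) ℝ} {ρ : ℝ} (hW : Mixes W ρ)
    {x : Fin n → Vec d} (hx : ∀ i, x i ∈ effDom r) (y : Fin n → Vec d) :
    sumEnv r f lam (mix W (halfStep r η x y)) ≤ sumEnv r f lam x
      - 3 / 8 * (η / lam ^ 2) * residualSq r f lam x
      + 1 / lam * (2 * consensusSq x + 2 * η ^ 2 * consensusSq y
        + 1 / 2 * n * η ^ 2 * ‖avg y - avgGrad gi x‖ ^ 2)
      - η / lam * inner ℝ (sumDrift r f g lam η gi x) (avg y - avgGrad gi x) := by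
  set z := halfStep r η x y with hz
  set c := prox r η (avg x - η • avg y) with hc
  have hl := h.lam_pos
  have hL := h.smooth.nonneg
  have h1 : sumEnv r f lam (mix W z) ≤
      ∑ j, moreauEnv (comp f r) lam (z j) + 16 / 9 * L * ∑ j, ‖z j - c‖ ^ 2 := by
    calc sumEnv r f lam (mix W z)
        ≤ ∑ i, (∑ j, W j i * moreauEnv (comp f r) lam (z j)
          + 16 / 9 * L * ∑ j, W j i * ‖z j - c‖ ^ 2) := Finset.sum_le_sum fun i _ =>
          h.moreauEnv_weighted_le (fun j => hW.entry_nonneg j i) (hW.col_sum i) z c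
      _ = _ := by
          rw [Finset.sum_add_distrib, ← Finset.mul_sum, Finset.sum_comm]
          congr 1
          · simp only [← Finset.sum_mul, hW.row_sum, one_mul]
          · rw [Finset.sum_comm]; simp only [← Finset.sum_mul, hW.row_sum, one_mul]
  have h2 : ∑ j, ‖z j - c‖ ^ 2 ≤ 2 * consensusSq x + 2 * η ^ 2 * consensusSq y := by
    rw [consensusSq_eq, consensusSq_eq, Finset.mul_sum, Finset.mul_sum, ← Finset.sum_add_distrib]
    refine Finset.sum_le_sum fun i _ => (norm_halfStep_sub_sq_le h x y i).trans ?_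
    refine (pow_le_pow_left₀ (norm_nonneg _) (norm_add_le _ _) 2).trans ?_
    rw [norm_smul, norm_neg, Real.norm_of_nonneg h.eta_pos.le]
    nlinarith [sq_nonneg (‖x i - avg x‖ - η * ‖y i - avg y‖)]
  have h3 : ∑ j, moreauEnv (comp f r) lam (z j) ≤ sumEnv r f lam x
      + 1 / (2 * lam) * (∑ i, ‖z i - prox (comp f r) lam (x i)‖ ^ 2 - residualSq r f lam x) := by
    rw [sumEnv, residualSq, sumSq, ← Finset.sum_sub_distrib, Finset.mul_sum,
      ← Finset.sum_add_distrib]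
    refine Finset.sum_le_sum fun i _ => ?_
    have := h.moreauEnv_le (z i) (h.proxPt (x i)).1
    rw [h.moreauEnv_eq (x i)]
    unfold realObj at this ⊢
    rw [norm_sub_rev (z i), norm_sub_rev (x i)]
    linarith
  have h4 := sum_halfStep_sub_le hn h hg hx y
  rw [← hz] at h4
  have hLl : L ≤ 1 / (4 * lam) := by
    rw [le_div_iff₀ (by positivity)]; have := h.lam_mul_le; linarith
  have hX := consensusSq_nonneg x
  have hY := consensusSq_nonneg y
  have h5 : 16 / 9 * L * ∑ j, ‖z j - c‖ ^ 2 ≤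
      16 / 9 * (1 / (4 * lam)) * (2 * consensusSq x + 2 * η ^ 2 * consensusSq y) := by
    gcongr
  have h6 := mul_le_mul_of_nonneg_left h4 (by positivity : 0 ≤ 1 / (2 * lam))
  have h7 : 1 / (4 * lam) = 1 / lam / 4 := by field_simp
  have h8 : 1 / (2 * lam) = 1 / lam / 2 := by field_simp
  have h9 : η / lam = η * (1 / lam) := by ring
  have h10 : η / lam ^ 2 = η * (1 / lam) ^ 2 := by ring
  have hk : 0 < 1 / lam := by positivity
  rw [h7] at h5
  rw [h8] at h3 h6
  rw [h9] at h6 ⊢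
  rw [h10]
  generalize 1 / lam = k at *
  have h11 : 0 ≤ k * consensusSq x := by positivity
  have h12 : 0 ≤ k * (η ^ 2 * consensusSq y) := by positivity
  linarith

/-- With `Z` the half steps, the displacement is `(Z - X)W + X(W - I)`; `Z - X` is then compared
through the proximal points. -/
lemma sumSq_step_sub_le (hn : 0 < n) (h : ProxSetting r f g L lam η)
    (hg : LocalGrads (effDom r) g L gi) {W : Matrix (Fin n) (Fin n) ℝ} {ρ : ℝ} (hW : Mixes W ρ)
    {x : Fin n → Vec d} (hx : ∀ i, x i ∈ effDom r) (y : Fin n → Vec d) :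
    ∑ i, ‖mix W (halfStep r η x y) i - x i‖ ^ 2 ≤ 8 * residualSq r f lam x
      + 14 * consensusSq x + 8 * η ^ 2 * consensusSq y
      + 4 * n * η ^ 2 * ‖avg y - avgGrad gi x‖ ^ 2
      - 8 * η * inner ℝ (sumDrift r f g lam η gi x) (avg y - avgGrad gi x) := by
  set z := halfStep r η x y with hz
  have h4 := sum_halfStep_sub_le hn h hg hx y
  rw [← hz] at h4
  have h1 : ∀ i, ‖mix W z i - x i‖ ^ 2 ≤
      2 * ‖mix W (fun j => z j - x j) i‖ ^ 2 + 2 * ‖mix W x i - x i‖ ^ 2 := by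
    intro i
    have e : mix W z i - x i = mix W (fun j => z j - x j) i + (mix W x i - x i) := by
      simp only [mix, smul_sub, Finset.sum_sub_distrib]; abel
    rw [e]
    refine (pow_le_pow_left₀ (norm_nonneg _) (norm_add_le _ _) 2).trans ?_
    nlinarith [sq_nonneg (‖mix W (fun j => z j - x j) i‖ - ‖mix W x i - x i‖)]
  have h2 := hW.sumSq_mix_le fun j => z j - x j
  have h3 := hW.sumSq_sub_mix_le x
  have h5 : sumSq (fun j => z j - x j) ≤
      2 * ∑ i, ‖z i - prox (comp f r) lam (x i)‖ ^ 2 + 2 * residualSq r f lam x := by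
    rw [residualSq, sumSq, sumSq, Finset.mul_sum, Finset.mul_sum, ← Finset.sum_add_distrib]
    refine Finset.sum_le_sum fun i _ => ?_
    have e : z i - x i = (z i - prox (comp f r) lam (x i)) - (x i - prox (comp f r) lam (x i)) := by
      abel
    rw [e]
    refine (pow_le_pow_left₀ (norm_nonneg _) (norm_sub_le _ _) 2).trans ?_
    nlinarith [sq_nonneg (‖z i - prox (comp f r) lam (x i)‖ - ‖x i - prox (comp f r) lam (x i)‖)]
  refine (Finset.sum_le_sum fun i _ => h1 i).trans ?_
  rw [Finset.sum_add_distrib, ← Finset.mul_sum, ← Finset.mul_sum]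
  change 2 * sumSq (mix W fun j => z j - x j) + _ ≤ _
  have h6 : 0 ≤ η / lam * residualSq r f lam x :=
    mul_nonneg (div_nonneg h.eta_pos.le h.lam_pos.le) (residualSq_nonneg x)
  have := consensusSq_nonneg x
  linarith

end

section

/-! ### Zero-mean noise that is independent of the past -/

lemma integrable_inner_of_memLp {Ω E : Type*} [MeasurableSpace Ω] [NormedAddCommGroup E]
    [InnerProductSpace ℝ E] {P : Measure Ω} {u v : Ω → E} (hu : MemLp u 2 P) (hv : MemLp v 2 P) :
    Integrable (fun ω => inner ℝ (u ω) (v ω)) P := by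
  refine Integrable.mono' ((hu.integrable_norm_pow (by norm_num)).add
    (hv.integrable_norm_pow (by norm_num))) (hu.1.inner hv.1) (ae_of_all _ fun ω => ?_)
  refine (norm_inner_le_norm _ _).trans ?_
  simp only [Pi.add_apply]
  have := two_mul_le_add_sq ‖u ω‖ ‖v ω‖
  nlinarith [mul_nonneg (norm_nonneg (u ω)) (norm_nonneg (v ω))]

section Noise

variable {Ω α β E : Type*} [MeasurableSpace Ω] [MeasurableSpace α] [MeasurableSpace β]
  [NormedAddCommGroup E] [MeasurableSpace E] [BorelSpace E] [SecondCountableTopology E]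
  {P : Measure Ω} [IsProbabilityMeasure P] {D : Measure β}
  {H : Ω → α} {ζ : Ω → β} {K : α × β → E} {A : Set α} {σ : ℝ}

lemma map_prodMk_eq (hH : Measurable H) (hζ : Measurable ζ) (hD : P.map ζ = D)
    (hind : IndepFun H ζ P) : P.map (fun ω => (H ω, ζ ω)) = (P.map H).prod D := by
  rw [(indepFun_iff_map_prod_eq_prod_map_map hH.aemeasurable hζ.aemeasurable).1 hind, hD]

/-- Independence makes the joint law a product, so Fubini freezes the past `H` and applies the
variance bound for each fixed value in `A`. -/
lemma noise_sq_integral_le [SFinite D] (hH : Measurable H) (hζ : Measurable ζ) (hD : P.map ζ = D)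
    (hind : IndepFun H ζ P) (hK : Measurable K) (hA : MeasurableSet A) (hHA : ∀ ω, H ω ∈ A)
    (hint : ∀ a ∈ A, Integrable (fun z => ‖K (a, z)‖ ^ 2) D)
    (hvar : ∀ a ∈ A, ∫ z, ‖K (a, z)‖ ^ 2 ∂D ≤ σ ^ 2) :
    MemLp (fun ω => K (H ω, ζ ω)) 2 P ∧ ∫ ω, ‖K (H ω, ζ ω)‖ ^ 2 ∂P ≤ σ ^ 2 := by
  have hpair : Measurable fun ω => (H ω, ζ ω) := hH.prodMk hζ
  have hmap := map_prodMk_eq hH hζ hD hind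
  have : IsProbabilityMeasure (P.map H) := Measure.isProbabilityMeasure_map hH.aemeasurable
  have hae : ∀ᵐ a ∂(P.map H), a ∈ A := (ae_map_iff hH.aemeasurable hA).2 (ae_of_all _ hHA)
  have hKsq : Measurable fun q => ‖K q‖ ^ 2 := hK.norm.pow_const 2
  have hmeas : AEStronglyMeasurable (fun q => ‖K q‖ ^ 2) ((P.map H).prod D) :=
    hKsq.aestronglyMeasurable
  have hbint : Integrable (fun a => ∫ z, ‖K (a, z)‖ ^ 2 ∂D) (P.map H) := by
    refine Integrable.mono' (integrable_const (σ ^ 2)) ?_ ?_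
    · exact (StronglyMeasurable.integral_prod_right (f := fun a z => ‖K (a, z)‖ ^ 2)
        hKsq.stronglyMeasurable).aestronglyMeasurable
    · filter_upwards [hae] with a ha
      rw [Real.norm_of_nonneg (integral_nonneg fun _ => by positivity)]
      exact hvar a ha
  have hprod : Integrable (fun q => ‖K q‖ ^ 2) ((P.map H).prod D) := by
    rw [integrable_prod_iff hmeas]
    refine ⟨by filter_upwards [hae] with a ha using hint a ha, ?_⟩
    simpa only [Real.norm_eq_abs, abs_pow, abs_norm] using hbint
  rw [← hmap] at hprod
  refine ⟨(memLp_two_iff_integrable_sq_norm (hK.comp hpair).aestronglyMeasurable).2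
    ((integrable_map_measure hKsq.aestronglyMeasurable hpair.aemeasurable).1 hprod), ?_⟩
  rw [← integral_map hpair.aemeasurable (f := fun q => ‖K q‖ ^ 2) hKsq.aestronglyMeasurable]
  rw [hmap] at hprod ⊢
  rw [integral_prod _ hprod]
  calc _ ≤ ∫ _a, σ ^ 2 ∂(P.map H) := by
        refine integral_mono_ae hbint (integrable_const _) ?_
        filter_upwards [hae] with a ha using hvar a ha
    _ = σ ^ 2 := by simp

/-- The inner integral over the sample, with the past frozen, is the pairing with a zero mean. It
plays the role of a conditional expectation; square integrability justifies Fubini. -/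
lemma noise_inner_integral_eq_zero [SFinite D] [InnerProductSpace ℝ E] [CompleteSpace E]
    (hH : Measurable H) (hζ : Measurable ζ) (hD : P.map ζ = D)
    (hind : IndepFun H ζ P) (hK : Measurable K) (hA : MeasurableSet A) (hHA : ∀ ω, H ω ∈ A)
    (hKint : ∀ a ∈ A, Integrable (fun z => K (a, z)) D)
    (hmean : ∀ a ∈ A, ∫ z, K (a, z) ∂D = 0)
    (hKL2 : MemLp (fun ω => K (H ω, ζ ω)) 2 P) {U : α → E} (hU : Measurable U)
    (hUL2 : MemLp (fun ω => U (H ω)) 2 P) :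
    ∫ ω, inner ℝ (U (H ω)) (K (H ω, ζ ω)) ∂P = 0 := by
  have hpair : Measurable fun ω => (H ω, ζ ω) := hH.prodMk hζ
  have hmap := map_prodMk_eq hH hζ hD hind
  have : IsProbabilityMeasure (P.map H) := Measure.isProbabilityMeasure_map hH.aemeasurable
  have hae : ∀ᵐ a ∂(P.map H), a ∈ A := (ae_map_iff hH.aemeasurable hA).2 (ae_of_all _ hHA)
  have hI : Integrable (fun ω => inner ℝ (U (H ω)) (K (H ω, ζ ω))) P := integrable_inner_of_memLp hUL2 hKL2
  have hm : Measurable fun q : α × β => inner ℝ (U q.1) (K q) := (hU.comp measurable_fst).inner hK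
  have hprod : Integrable (fun q : α × β => inner ℝ (U q.1) (K q)) ((P.map H).prod D) := by
    rw [← hmap]
    exact (integrable_map_measure hm.aestronglyMeasurable hpair.aemeasurable).2 hI
  rw [← integral_map hpair.aemeasurable (f := fun q : α × β => inner ℝ (U q.1) (K q))
    hm.aestronglyMeasurable, hmap, integral_prod _ hprod]
  have h0 : ∀ᵐ a ∂(P.map H), ∫ z, inner ℝ (U a) (K (a, z)) ∂D = 0 := by
    filter_upwards [hae] with a ha
    rw [integral_inner (hKint a ha), hmean a ha, inner_zero_right]
  rw [integral_congr_ae h0, integral_zero]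

end Noise

/-! ### The run as a stochastic process -/

variable {n d : ℕ} {Ξ : Fin n → Type*} [∀ i, MeasurableSpace (Ξ i)]

/-- The mean of the stochastic gradient. -/
def Problem.gbar (p : Problem n d Ξ) (i : Fin n) (x : Vec d) : Vec d := ∫ z, p.gradF i x z ∂(p.D i)

/-- The smooth part of the objective. -/
def Problem.fAvg (p : Problem n d Ξ) (x : Vec d) : ℝ := 1 / (n : ℝ) * ∑ i, p.f i x

/-- The average of the mean stochastic gradients. -/
def Problem.gAvg (p : Problem n d Ξ) (x : Vec d) : Vec d := avg fun i => p.gbar i x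

lemma Problem.phi_eq_comp (p : Problem n d Ξ) : p.phi = comp p.fAvg p.r := rfl

lemma Problem.used_run (p : Problem n d Ξ) (W : Matrix (Fin n) (Fin n) ℝ) (η : ℝ) (x0 : Vec d)
    (ξ : ∀ i, ℕ → Ξ i) (t : ℕ) (i : Fin n) : (p.run W η x0 ξ t).used i = t := by
  induction t with
  | zero => rfl
  | succ t ih => simp [Problem.run, Problem.step, ih]

variable {Ω : Type*}

/-- The iterates `x^t`. -/
def xs (p : Problem n d Ξ) (W : Matrix (Fin n) (Fin n) ℝ) (η : ℝ) (x0 : Vec d)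
    (ξ : ∀ i, ℕ → Ω → Ξ i) (t : ℕ) (ω : Ω) : Fin n → Vec d :=
  (p.run W η x0 (fun i k => ξ i k ω) t).x

/-- The tracking variables `y^{t-1}`. -/
def ys (p : Problem n d Ξ) (W : Matrix (Fin n) (Fin n) ℝ) (η : ℝ) (x0 : Vec d)
    (ξ : ∀ i, ℕ → Ω → Ξ i) (t : ℕ) (ω : Ω) : Fin n → Vec d :=
  (p.run W η x0 (fun i k => ξ i k ω) t).y

/-- The stochastic gradients at time `t - 1`. -/
def gs (p : Problem n d Ξ) (W : Matrix (Fin n) (Fin n) ℝ) (η : ℝ) (x0 : Vec d)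
    (ξ : ∀ i, ℕ → Ω → Ξ i) (t : ℕ) (ω : Ω) : Fin n → Vec d :=
  (p.run W η x0 (fun i k => ξ i k ω) t).g

/-- The gradient noise at time `t`. -/
def noise (p : Problem n d Ξ) (W : Matrix (Fin n) (Fin n) ℝ) (η : ℝ) (x0 : Vec d)
    (ξ : ∀ i, ℕ → Ω → Ξ i) (t : ℕ) (ω : Ω) (i : Fin n) : Vec d :=
  p.gradF i (xs p W η x0 ξ t ω i) (ξ i t ω) - p.gbar i (xs p W η x0 ξ t ω i)

/-- The σ-algebra generated by the samples drawn before time `t`. -/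
@[reducible] def past (ξ : ∀ i, ℕ → Ω → Ξ i) (t : ℕ) : MeasurableSpace Ω :=
  ⨆ q ∈ {q : Fin n × ℕ | q.2 < t}, MeasurableSpace.comap (ξ q.1 q.2) inferInstance

section Recursion

variable (p : Problem n d Ξ) (W : Matrix (Fin n) (Fin n) ℝ) (η : ℝ) (x0 : Vec d)
  (ξ : ∀ i, ℕ → Ω → Ξ i)

lemma gs_succ (t : ℕ) (ω : Ω) (i : Fin n) :
    gs p W η x0 ξ (t + 1) ω i = p.gradF i (xs p W η x0 ξ t ω i) (ξ i t ω) := by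
  have := p.used_run W η x0 (fun i k => ξ i k ω) t i
  simp [gs, Problem.run, Problem.step, xs, this]

lemma gs_succ_eq_add_noise (t : ℕ) (ω : Ω) (i : Fin n) :
    gs p W η x0 ξ (t + 1) ω i = p.gbar i (xs p W η x0 ξ t ω i) + noise p W η x0 ξ t ω i := by
  rw [gs_succ, noise]; abel

lemma ys_succ (t : ℕ) (ω : Ω) :
    ys p W η x0 ξ (t + 1) ω =
      mix W fun i => ys p W η x0 ξ t ω i + gs p W η x0 ξ (t + 1) ω i - gs p W η x0 ξ t ω i := rfl

lemma xs_succ (t : ℕ) (ω : Ω) :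
    xs p W η x0 ξ (t + 1) ω =
      mix W (halfStep p.r η (xs p W η x0 ξ t ω) (ys p W η x0 ξ (t + 1) ω)) := rfl

-- The gradient tracking invariant: averages are preserved by mixing, and the gradient increments
-- telescope from the common zero initialization.
variable {W} in
lemma avg_ys {ρ : ℝ} (hW : Mixes W ρ) (t : ℕ) (ω : Ω) :
    avg (ys p W η x0 ξ t ω) = avg (gs p W η x0 ξ t ω) := by
  induction t with
  | zero => rfl
  | succ t ih =>
    rw [ys_succ, hW.avg_mix, avg_sub (fun i => ys p W η x0 ξ t ω i + gs p W η x0 ξ (t + 1) ω i)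
      (gs p W η x0 ξ t ω), avg_add, ih]
    abel

variable {W} in
lemma avg_ys_sub_avgGrad {ρ : ℝ} (hW : Mixes W ρ) (t : ℕ) (ω : Ω) :
    avg (ys p W η x0 ξ (t + 1) ω) - avgGrad p.gbar (xs p W η x0 ξ t ω) =
      avg (noise p W η x0 ξ t ω) := by
  rw [avg_ys p η x0 ξ hW, avgGrad, ← avg_sub]
  congr 1; funext i; rw [gs_succ]; rfl

end Recursion

lemma past_mono (ξ : ∀ i, ℕ → Ω → Ξ i) {s t : ℕ} (h : s ≤ t) : past ξ s ≤ past ξ t :=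
  biSup_mono fun _ hq => lt_of_lt_of_le hq h

lemma measurable_past (ξ : ∀ i, ℕ → Ω → Ξ i) (i : Fin n) {s t : ℕ} (h : s < t) :
    Measurable[past ξ t] (ξ i s) := by
  rw [measurable_iff_comap_le]
  exact le_iSup₂_of_le (f := fun (q : Fin n × ℕ) (_ : q ∈ {q : Fin n × ℕ | q.2 < t}) =>
    MeasurableSpace.comap (ξ q.1 q.2) inferInstance) (i, s) h le_rfl

lemma measurable_mix {m : MeasurableSpace Ω} {V : Ω → Fin n → Vec d}
    (hV : ∀ i, Measurable[m] fun ω => V ω i) (B : Matrix (Fin n) (Fin n) ℝ) (i : Fin n) :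
    Measurable[m] fun ω => mix B (V ω) i :=
  Finset.measurable_sum _ fun j _ => (hV j).const_smul (B j i)

lemma measurable_avg {m : MeasurableSpace Ω} {V : Ω → Fin n → Vec d}
    (hV : ∀ i, Measurable[m] fun ω => V ω i) : Measurable[m] fun ω => avg (V ω) :=
  (Finset.measurable_sum _ fun j _ => hV j).const_smul (1 / (n : ℝ))

variable [MeasurableSpace Ω]

lemma past_le {ξ : ∀ i, ℕ → Ω → Ξ i} (hξ : ∀ i t, Measurable (ξ i t)) (t : ℕ) :
    past ξ t ≤ (inferInstance : MeasurableSpace Ω) :=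
  iSup₂_le fun q _ => (hξ q.1 q.2).comap_le

/-- The assumptions on the problem, the samples, the mixing matrix and the parameters. -/
structure RunSetting (p : Problem n d Ξ) (W : Matrix (Fin n) (Fin n) ℝ) (L lam η ρ σ : ℝ)
    (P : Measure Ω) (ξ : ∀ i, ℕ → Ω → Ξ i) (x0 : Vec d) : Prop where
  reg : p.IsRegular L
  sg : p.IsStochGrad σ
  sampling : p.IsSampling P ξ
  setting : ProxSetting p.r p.fAvg p.gAvg L lam η
  mixes : Mixes W ρ
  x0_mem : x0 ∈ effDom p.r
  n_pos : 0 < n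

lemma IsClosedConvex.measurableSet {r : Vec d → EReal} (hr : IsClosedConvex r) :
    MeasurableSet (effDom r) :=
  hr.closed.measurable measurableSet_Iio

lemma ProxSetting.continuous_prox_r {r : Vec d → EReal} {f : Vec d → ℝ} {g : Vec d → Vec d}
    {L lam η : ℝ} (h : ProxSetting r f g L lam η) : Continuous (prox r η) :=
  (LipschitzWith.of_dist_le_mul (K := 1) fun x y => by
    simpa [dist_eq_norm] using h.prox_r_nonexpansive x y).continuous

lemma ProxSetting.continuous_prox {r : Vec d → EReal} {f : Vec d → ℝ} {g : Vec d → Vec d}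
    {L lam η : ℝ} (h : ProxSetting r f g L lam η) : Continuous (prox (comp f r) lam) :=
  (LipschitzWith.of_dist_le_mul (K := 4 / 3) fun x y => by
    simpa [dist_eq_norm] using h.prox_lipschitz x y).continuous

section MemLp

variable {E F : Type*} [NormedAddCommGroup E] [NormedAddCommGroup F]
  {P : Measure Ω}

lemma memLp_of_affine_bound [IsFiniteMeasure P] {u : Ω → E} {v : Ω → F} (hu : MemLp u 2 P)
    (hv : AEStronglyMeasurable v P) {a b : ℝ} (h : ∀ ω, ‖v ω‖ ≤ a + b * ‖u ω‖) : MemLp v 2 P := by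
  refine MemLp.mono' (g := fun ω => a + b * ‖u ω‖) ?_ hv (ae_of_all _ h)
  exact (memLp_const a).add (hu.norm.const_mul b)

lemma MemLp.mix {V : Ω → Fin n → Vec d} (hV : ∀ i, MemLp (fun ω => V ω i) 2 P)
    (B : Matrix (Fin n) (Fin n) ℝ) (i : Fin n) : MemLp (fun ω => mix B (V ω) i) 2 P :=
  memLp_finsetSum _ fun j _ => (hV j).const_smul (B j i)

lemma MemLp.avg {V : Ω → Fin n → Vec d} (hV : ∀ i, MemLp (fun ω => V ω i) 2 P) :
    MemLp (fun ω => avg (V ω)) 2 P :=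
  (memLp_finsetSum _ fun j _ => hV j).const_smul (1 / (n : ℝ))

lemma integrable_sumSq {V : Ω → Fin n → Vec d} (hV : ∀ i, MemLp (fun ω => V ω i) 2 P) :
    Integrable (fun ω => sumSq (V ω)) P :=
  integrable_finsetSum _ fun i _ => (hV i).integrable_norm_pow (by norm_num)

lemma integrable_consensusSq {V : Ω → Fin n → Vec d} (hV : ∀ i, MemLp (fun ω => V ω i) 2 P) :
    Integrable (fun ω => consensusSq (V ω)) P :=
  integrable_sumSq (V := fun ω i => V ω i - DProx.avg (V ω)) fun i => (hV i).sub (MemLp.avg hV)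

end MemLp

/-! ### The iterates as an adapted, square integrable process. -/

namespace RunSetting

variable {p : Problem n d Ξ} {W : Matrix (Fin n) (Fin n) ℝ} {L lam η ρ σ : ℝ}
  {P : Measure Ω} {ξ : ∀ i, ℕ → Ω → Ξ i} {x0 : Vec d} (h : RunSetting p W L lam η ρ σ P ξ x0)
include h

lemma gbar_eq (i : Fin n) {x : Vec d} (hx : x ∈ effDom p.r) : p.gbar i x = gradient (p.f i) x :=
  h.sg.unbiased i x hx

lemma localGrads : LocalGrads (effDom p.r) p.gAvg L p.gbar :=
  ⟨fun _ _ => rfl, fun i x hx y hy => by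
    rw [h.gbar_eq i hx, h.gbar_eq i hy]; exact h.reg.smooth i x hx y hy⟩

/-- The reason for working with `gbar`: as a parameter integral it is measurable on the whole space,
and on `dom r` it agrees with the gradient of `f_i`. -/
lemma measurable_gbar (i : Fin n) : Measurable (p.gbar i) := by
  have := h.reg.isProb i
  exact (StronglyMeasurable.integral_prod_right (f := fun x z => p.gradF i x z)
    (h.sg.measurable i).stronglyMeasurable).measurable

lemma measurable_past_state (t : ℕ) :
    (∀ i, Measurable[past ξ t] fun ω => xs p W η x0 ξ t ω i) ∧
    (∀ i, Measurable[past ξ t] fun ω => ys p W η x0 ξ t ω i) ∧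
    (∀ i, Measurable[past ξ t] fun ω => gs p W η x0 ξ t ω i) := by
  induction t with
  | zero => exact ⟨fun i => measurable_const, fun i => measurable_const, fun i => measurable_const⟩
  | succ t ih =>
    obtain ⟨ihx, ihy, ihg⟩ := ih
    have hle : past ξ t ≤ past ξ (t + 1) := past_mono ξ (Nat.le_succ t)
    have hx : ∀ i, Measurable[past ξ (t + 1)] fun ω => xs p W η x0 ξ t ω i :=
      fun i => (ihx i).mono hle le_rfl
    have hg : ∀ i, Measurable[past ξ (t + 1)] fun ω => gs p W η x0 ξ (t + 1) ω i := by
      intro i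
      simp only [gs_succ]
      exact (h.sg.measurable i).comp ((hx i).prodMk (measurable_past ξ i (Nat.lt_succ_self t)))
    have hy : ∀ i, Measurable[past ξ (t + 1)] fun ω => ys p W η x0 ξ (t + 1) ω i := by
      intro i
      simp only [ys_succ]
      exact measurable_mix (fun j => (((ihy j).mono hle le_rfl).add (hg j)).sub
        ((ihg j).mono hle le_rfl)) W i
    refine ⟨fun i => ?_, hy, hg⟩
    simp only [xs_succ]
    exact measurable_mix (fun j => h.setting.continuous_prox_r.measurable.comp
      ((hx j).sub ((hy j).const_smul η))) W i

lemma xs_mem (t : ℕ) (ω : Ω) (i : Fin n) : xs p W η x0 ξ t ω i ∈ effDom p.r := by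
  cases t with
  | zero => exact h.x0_mem
  | succ t =>
    rw [xs_succ]
    exact h.mixes.mix_mem h.reg.closedConvex.convexOn.1 (fun j => (h.setting.proxPt_r _).1) i

lemma indep_past (i : Fin n) (t : ℕ) :
    Indep (past ξ t) (MeasurableSpace.comap (ξ i t) inferInstance) P := by
  have h1 := indep_iSup_of_disjoint (μ := P)
    (m := fun q : Fin n × ℕ => MeasurableSpace.comap (ξ q.1 q.2) inferInstance)
    (fun q => (h.sampling.measurable q.1 q.2).comap_le) h.sampling.indep
    (S := {q : Fin n × ℕ | q.2 < t}) (T := {(i, t)}) (by simp)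
  simpa [past] using h1

lemma past_le' (t : ℕ) : past ξ t ≤ (inferInstance : MeasurableSpace Ω) :=
  past_le h.sampling.measurable t

lemma indepFun_of_past {α : Type*} [MeasurableSpace α] {H : Ω → α} {t : ℕ}
    (hH : Measurable[past ξ t] H) (i : Fin n) : IndepFun H (ξ i t) P :=
  (IndepFun_iff_Indep H (ξ i t) P).2 (indep_of_indep_of_le_left (h.indep_past i t) hH.comap_le)

lemma noise_memLp [IsProbabilityMeasure P] (t : ℕ) (i : Fin n) :
    MemLp (fun ω => noise p W η x0 ξ t ω i) 2 P ∧
      ∫ ω, ‖noise p W η x0 ξ t ω i‖ ^ 2 ∂P ≤ σ ^ 2 := by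
  have := h.reg.isProb i
  have hx := (h.measurable_past_state t).1 i
  refine noise_sq_integral_le (H := fun ω => xs p W η x0 ξ t ω i) (ζ := ξ i t)
    (K := fun q => p.gradF i q.1 q.2 - p.gbar i q.1) (A := effDom p.r)
    (hx.mono (h.past_le' t) le_rfl) (h.sampling.measurable i t) (h.sampling.law i t)
    (h.indepFun_of_past hx i) ((h.sg.measurable i).sub ((h.measurable_gbar i).comp measurable_fst))
    h.reg.closedConvex.measurableSet (fun ω => h.xs_mem t ω i) ?_ ?_
  · intro x hx; simp only [h.gbar_eq i hx]; exact h.sg.integrable_sq i x hx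
  · intro x hx; simp only [h.gbar_eq i hx]; exact h.sg.variance i x hx

lemma integral_inner_noise [IsProbabilityMeasure P] {t : ℕ} {U : Ω → Vec d}
    (hU : Measurable[past ξ t] U) (hU2 : MemLp U 2 P) (i : Fin n) :
    ∫ ω, inner ℝ (U ω) (noise p W η x0 ξ t ω i) ∂P = 0 := by
  have := h.reg.isProb i
  have hx := (h.measurable_past_state t).1 i
  -- The frozen variable must carry both the test vector and the iterate at which the stochastic
  -- gradient is taken.
  have hH : Measurable[past ξ t] fun ω => (U ω, xs p W η x0 ξ t ω i) := hU.prodMk hx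
  refine noise_inner_integral_eq_zero (H := fun ω => (U ω, xs p W η x0 ξ t ω i)) (ζ := ξ i t)
    (K := fun q => p.gradF i q.1.2 q.2 - p.gbar i q.1.2) (A := {a | a.2 ∈ effDom p.r})
    (U := Prod.fst)
    (hH.mono (h.past_le' t) le_rfl) (h.sampling.measurable i t) (h.sampling.law i t)
    (h.indepFun_of_past hH i) ?_ (measurable_snd h.reg.closedConvex.measurableSet)
    (fun ω => h.xs_mem t ω i) ?_ ?_ (h.noise_memLp t i).1 measurable_fst hU2
  · exact ((h.sg.measurable i).comp ((measurable_snd.comp measurable_fst).prodMk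
      measurable_snd)).sub ((h.measurable_gbar i).comp (measurable_snd.comp measurable_fst))
  · intro a ha; exact (h.sg.integrable i a.2 ha).sub (integrable_const (p.gbar i a.2))
  · intro a ha
    change ∫ z, p.gradF i a.2 z - p.gbar i a.2 ∂(p.D i) = 0
    rw [integral_sub (h.sg.integrable i a.2 ha) (integrable_const _)]
    simp [Problem.gbar]

lemma measurable_xs (t : ℕ) (i : Fin n) : Measurable fun ω => xs p W η x0 ξ t ω i :=
  ((h.measurable_past_state t).1 i).mono (h.past_le' t) le_rfl

variable [IsProbabilityMeasure P]

lemma gbar_memLp {u : Ω → Vec d} (hu : MemLp u 2 P) (hm : Measurable u)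
    (hD : ∀ ω, u ω ∈ effDom p.r) (i : Fin n) : MemLp (fun ω => p.gbar i (u ω)) 2 P := by
  refine memLp_of_affine_bound hu ((h.measurable_gbar i).comp hm).aestronglyMeasurable
    (a := ‖p.gbar i x0‖ + L * ‖x0‖) (b := L) fun ω => ?_
  have h1 := h.localGrads.lip i _ (hD ω) _ h.x0_mem
  have h2 := norm_sub_norm_le (p.gbar i (u ω)) (p.gbar i x0)
  have h3 := mul_le_mul_of_nonneg_left (norm_sub_le (u ω) x0) h.setting.smooth.nonneg
  linarith

lemma state_memLp (t : ℕ) :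
    (∀ i, MemLp (fun ω => xs p W η x0 ξ t ω i) 2 P) ∧
    (∀ i, MemLp (fun ω => ys p W η x0 ξ t ω i) 2 P) ∧
    (∀ i, MemLp (fun ω => gs p W η x0 ξ t ω i) 2 P) := by
  induction t with
  | zero => exact ⟨fun i => memLp_const _, fun i => memLp_const _, fun i => memLp_const _⟩
  | succ t ih =>
    obtain ⟨ihx, ihy, ihg⟩ := ih
    have hg : ∀ i, MemLp (fun ω => gs p W η x0 ξ (t + 1) ω i) 2 P := by
      intro i
      simp only [gs_succ_eq_add_noise]
      exact (h.gbar_memLp (ihx i) (h.measurable_xs t i) (fun ω => h.xs_mem t ω i) i).add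
        (h.noise_memLp t i).1
    have hy : ∀ i, MemLp (fun ω => ys p W η x0 ξ (t + 1) ω i) 2 P := by
      intro i
      simp only [ys_succ]
      exact MemLp.mix (fun j => ((ihy j).add (hg j)).sub (ihg j)) W i
    refine ⟨fun i => ?_, hy, hg⟩
    simp only [xs_succ]
    refine MemLp.mix (fun j => ?_) W i
    have hu : MemLp (fun ω => xs p W η x0 ξ t ω j - η • ys p W η x0 ξ (t + 1) ω j) 2 P :=
      (ihx j).sub ((hy j).const_smul η)
    refine memLp_of_affine_bound hu
      (h.setting.continuous_prox_r.comp_aestronglyMeasurable hu.1)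
      (a := ‖prox p.r η 0‖) (b := 1) fun ω => ?_
    have h1 := h.setting.prox_r_nonexpansive
      (xs p W η x0 ξ t ω j - η • ys p W η x0 ξ (t + 1) ω j) 0
    rw [sub_zero] at h1
    have h2 := norm_sub_norm_le
      (prox p.r η (xs p W η x0 ξ t ω j - η • ys p W η x0 ξ (t + 1) ω j)) (prox p.r η 0)
    simp only [halfStep]
    linarith

end RunSetting

end

/-! ### Expected one-step recursions for tracking error, consensus, displacement and envelope. -/

section

variable {n d : ℕ} {Ξ : Fin n → Type*} [∀ i, MeasurableSpace (Ξ i)] {Ω : Type*}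

/-- The part of `y^t_⊥` that is determined before time `t`. -/
def pre (p : Problem n d Ξ) (W : Matrix (Fin n) (Fin n) ℝ) (η : ℝ) (x0 : Vec d)
    (ξ : ∀ i, ℕ → Ω → Ξ i) (t : ℕ) (ω : Ω) : Fin n → Vec d :=
  mix (W - avgMatrix n) fun j =>
    ys p W η x0 ξ t ω j + p.gbar j (xs p W η x0 ξ t ω j) - gs p W η x0 ξ t ω j

lemma mix_add (B : Matrix (Fin n) (Fin n) ℝ) (v w : Fin n → Vec d) (i : Fin n) :
    mix B (fun j => v j + w j) i = mix B v i + mix B w i := by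
  simp [mix, smul_add, Finset.sum_add_distrib]

lemma mix_sub_one (B : Matrix (Fin n) (Fin n) ℝ) (v : Fin n → Vec d) (i : Fin n) :
    mix (B - 1) v i = mix B v i - v i := by
  simp [mix, sub_smul, Finset.sum_sub_distrib, Matrix.one_apply]

lemma mix_one_sub_avgMatrix (v : Fin n → Vec d) (i : Fin n) :
    mix (1 - avgMatrix n) v i = v i - avg v := by
  simp [mix, sub_smul, Finset.sum_sub_distrib, Matrix.one_apply, avgMatrix, avg_eq_weighted]

lemma Mixes.ys_succ_sub_avg {W : Matrix (Fin n) (Fin n) ℝ} {ρ : ℝ} (hW : Mixes W ρ)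
    (p : Problem n d Ξ) (η : ℝ) (x0 : Vec d) (ξ : ∀ i, ℕ → Ω → Ξ i) (t : ℕ) (ω : Ω) (i : Fin n) :
    ys p W η x0 ξ (t + 1) ω i - avg (ys p W η x0 ξ (t + 1) ω) =
      pre p W η x0 ξ t ω i + mix (W - avgMatrix n) (noise p W η x0 ξ t ω) i := by
  rw [ys_succ, hW.avg_mix, hW.mix_sub_avg _ 0, pre, ← mix_add]
  congr 1; funext j
  rw [gs_succ_eq_add_noise]; abel

/-- Subtracting the old stochastic gradient removes the old noise once, hence the factor `W - J -
I`. The first two summands are past data and fresh noise, orthogonal in expectation; the gradient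
increment involves `x^{t+1}`, which depends on that noise, so it must be separated by Young's
inequality. -/
lemma Mixes.pre_succ {W : Matrix (Fin n) (Fin n) ℝ} {ρ : ℝ} (hW : Mixes W ρ)
    (p : Problem n d Ξ) (η : ℝ) (x0 : Vec d) (ξ : ∀ i, ℕ → Ω → Ξ i) (t : ℕ) (ω : Ω) :
    pre p W η x0 ξ (t + 1) ω = mix (W - avgMatrix n) fun j =>
      (pre p W η x0 ξ t ω j + mix (W - avgMatrix n - 1) (noise p W η x0 ξ t ω) j)
        + (p.gbar j (xs p W η x0 ξ (t + 1) ω j) - p.gbar j (xs p W η x0 ξ t ω j)) := by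
  funext i
  have e : ∀ (v : Fin n → Vec d) (c : Vec d), mix (W - avgMatrix n) v i =
      mix (W - avgMatrix n) (fun j => v j - c) i := by
    intro v c
    rw [← hW.mix_sub_avg v c, hW.mix_sub_avg v 0]; simp
  rw [pre, e _ (avg (ys p W η x0 ξ (t + 1) ω))]
  congr 1; funext j
  have := hW.ys_succ_sub_avg p η x0 ξ t ω j
  rw [mix_sub_one, gs_succ_eq_add_noise, ← add_sub_assoc (pre p W η x0 ξ t ω j), ← this]
  abel

lemma sumSq_add (U V : Fin n → Vec d) :
    sumSq (fun i => U i + V i) = sumSq U + 2 * ∑ i, inner ℝ (U i) (V i) + sumSq V := by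
  simp only [sumSq, norm_add_sq_real, Finset.sum_add_distrib, Finset.mul_sum]

lemma sumSq_sub_le (U V : Fin n → Vec d) :
    sumSq (fun i => U i - V i) ≤ 2 * sumSq U + 2 * sumSq V := by
  rw [sumSq, sumSq, sumSq, Finset.mul_sum, Finset.mul_sum, ← Finset.sum_add_distrib]
  refine Finset.sum_le_sum fun i _ => ?_
  refine (pow_le_pow_left₀ (norm_nonneg _) (norm_sub_le _ _) 2).trans ?_
  nlinarith [sq_nonneg (‖U i‖ - ‖V i‖)]

variable [MeasurableSpace Ω]

namespace RunSetting

variable {p : Problem n d Ξ} {W : Matrix (Fin n) (Fin n) ℝ} {L lam η ρ σ : ℝ}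
  {P : Measure Ω} {ξ : ∀ i, ℕ → Ω → Ξ i} {x0 : Vec d}
  (h : RunSetting p W L lam η ρ σ P ξ x0)
include h

lemma rho_sq_lt_one : ρ ^ 2 < 1 := by
  nlinarith [h.mixes.rho_nonneg, h.mixes.rho_lt_one]

lemma pre_input_measurable (t : ℕ) (i : Fin n) : Measurable[past ξ t] fun ω =>
    ys p W η x0 ξ t ω i + p.gbar i (xs p W η x0 ξ t ω i) - gs p W η x0 ξ t ω i := by
  obtain ⟨hx, hy, hg⟩ := h.measurable_past_state t
  exact ((hy i).add ((h.measurable_gbar i).comp (hx i))).sub (hg i)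

lemma pre_measurable (t : ℕ) (i : Fin n) :
    Measurable[past ξ t] fun ω => pre p W η x0 ξ t ω i :=
  measurable_mix (h.pre_input_measurable t) _ i

lemma sumSq_mix_le (v : Fin n → Vec d) : sumSq (mix (W - avgMatrix n) v) ≤ sumSq v := by
  have h1 := h.mixes.contract v
  have := h.rho_sq_lt_one
  nlinarith [sumSq_nonneg v]

lemma sumDrift_measurable (t : ℕ) : Measurable[past ξ t] fun ω =>
    sumDrift p.r p.fAvg p.gAvg lam η p.gbar (xs p W η x0 ξ t ω) := by
  have hx := (h.measurable_past_state t).1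
  have hp : ∀ i, Measurable[past ξ t] fun ω =>
      prox (comp p.fAvg p.r) lam (xs p W η x0 ξ t ω i) :=
    fun i => h.setting.continuous_prox.measurable.comp (hx i)
  refine Finset.measurable_sum _ fun i _ => ?_
  exact (((hx i).sub (hp i)).const_smul (1 - η / lam)).sub
    (((measurable_avg fun j => (h.measurable_gbar j).comp (hx j)).sub
      (measurable_avg fun j => (h.measurable_gbar j).comp (hp i))).const_smul η)

variable [IsProbabilityMeasure P]

lemma integral_sumSq_noise_le (t : ℕ) :
    ∫ ω, sumSq (noise p W η x0 ξ t ω) ∂P ≤ n * σ ^ 2 := by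
  simp only [sumSq]
  rw [integral_finsetSum _ fun i _ => (h.noise_memLp t i).1.integrable_norm_pow (by norm_num)]
  calc _ ≤ ∑ _i : Fin n, σ ^ 2 := Finset.sum_le_sum fun i _ => (h.noise_memLp t i).2
    _ = n * σ ^ 2 := by simp

/-- The cross terms are pairings of past-measurable vectors with noise, so they integrate to zero,
whatever the mixing matrix. -/
lemma integral_sumSq_add_mix_noise {t : ℕ} {U : Ω → Fin n → Vec d}
    (hU : ∀ i, Measurable[past ξ t] fun ω => U ω i) (hU2 : ∀ i, MemLp (fun ω => U ω i) 2 P)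
    (B : Matrix (Fin n) (Fin n) ℝ) :
    ∫ ω, sumSq (fun i => U ω i + mix B (noise p W η x0 ξ t ω) i) ∂P =
      ∫ ω, sumSq (U ω) ∂P + ∫ ω, sumSq (mix B (noise p W η x0 ξ t ω)) ∂P := by
  have hN := fun i => (h.noise_memLp t i).1
  have hB := MemLp.mix hN B
  have hI : ∀ i j, Integrable (fun ω => B j i * inner ℝ (U ω i) (noise p W η x0 ξ t ω j)) P :=
    fun i j => (integrable_inner_of_memLp (hU2 i) (hN j)).const_mul _
  have hc : ∫ ω, ∑ i, inner ℝ (U ω i) (mix B (noise p W η x0 ξ t ω) i) ∂P = 0 := by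
    simp only [mix, inner_sum, inner_smul_right]
    rw [integral_finsetSum _ fun i _ => integrable_finsetSum _ fun j _ => hI i j]
    refine Finset.sum_eq_zero fun i _ => ?_
    rw [integral_finsetSum _ fun j _ => hI i j]
    refine Finset.sum_eq_zero fun j _ => ?_
    rw [integral_const_mul, h.integral_inner_noise (hU i) (hU2 i), mul_zero]
  simp only [sumSq_add]
  have hci : Integrable (fun ω => ∑ i, inner ℝ (U ω i) (mix B (noise p W η x0 ξ t ω) i)) P :=
    integrable_finsetSum _ fun i _ => integrable_inner_of_memLp (hU2 i) (hB i)
  refine (integral_add' ((integrable_sumSq hU2).add (hci.const_mul 2)) (integrable_sumSq hB)).trans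
    ?_
  rw [integral_add' (integrable_sumSq hU2) (hci.const_mul 2), integral_const_mul, hc, mul_zero,
    add_zero]

lemma gbar_xs_memLp (t : ℕ) (i : Fin n) :
    MemLp (fun ω => p.gbar i (xs p W η x0 ξ t ω i)) 2 P :=
  h.gbar_memLp ((h.state_memLp t).1 i) (h.measurable_xs t i) (fun ω => h.xs_mem t ω i) i

lemma pre_memLp (t : ℕ) (i : Fin n) : MemLp (fun ω => pre p W η x0 ξ t ω i) 2 P :=
  MemLp.mix (fun j => (((h.state_memLp t).2.1 j).add (h.gbar_xs_memLp t j)).sub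
    ((h.state_memLp t).2.2 j)) _ i

/-- The tracking error is the predictable part plus mixed noise. -/
lemma integral_consensusSq_ys_le (t : ℕ) :
    ∫ ω, consensusSq (ys p W η x0 ξ (t + 1) ω) ∂P ≤
      ∫ ω, sumSq (pre p W η x0 ξ t ω) ∂P + n * σ ^ 2 := by
  have e : ∀ ω, consensusSq (ys p W η x0 ξ (t + 1) ω) = sumSq fun i =>
      pre p W η x0 ξ t ω i + mix (W - avgMatrix n) (noise p W η x0 ξ t ω) i := by
    intro ω
    simp only [consensusSq_eq, sumSq, h.mixes.ys_succ_sub_avg]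
  simp only [e]
  rw [h.integral_sumSq_add_mix_noise (h.pre_measurable t) (h.pre_memLp t)]
  have hN := fun i => (h.noise_memLp t i).1
  have := integral_mono (integrable_sumSq (MemLp.mix hN (W - avgMatrix n))) (integrable_sumSq hN)
    fun ω => h.sumSq_mix_le (noise p W η x0 ξ t ω)
  have := h.integral_sumSq_noise_le t
  linarith

lemma integral_sumSq_pre_succ_le (t : ℕ) :
    ∫ ω, sumSq (pre p W η x0 ξ (t + 1) ω) ∂P ≤
      (1 + ρ ^ 2) / 2 * (∫ ω, sumSq (pre p W η x0 ξ t ω) ∂P + 4 * (n * σ ^ 2))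
      + 2 * ρ ^ 2 / (1 - ρ ^ 2) * (L ^ 2 *
        ∫ ω, ∑ i, ‖xs p W η x0 ξ (t + 1) ω i - xs p W η x0 ξ t ω i‖ ^ 2 ∂P) := by
  have hN := fun i => (h.noise_memLp t i).1
  have hB := MemLp.mix hN (W - avgMatrix n - 1)
  have hq : 0 < 1 - ρ ^ 2 := sub_pos.2 h.rho_sq_lt_one
  have hdx : ∀ i, MemLp (fun ω => xs p W η x0 ξ (t + 1) ω i - xs p W η x0 ξ t ω i) 2 P :=
    fun i => ((h.state_memLp (t + 1)).1 i).sub ((h.state_memLp t).1 i)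
  have hI1 : Integrable (fun ω => sumSq fun i => pre p W η x0 ξ t ω i
      + mix (W - avgMatrix n - 1) (noise p W η x0 ξ t ω) i) P :=
    integrable_sumSq fun i => (h.pre_memLp t i).add (hB i)
  have hI2 : Integrable (fun ω => ∑ i,
      ‖xs p W η x0 ξ (t + 1) ω i - xs p W η x0 ξ t ω i‖ ^ 2) P := integrable_sumSq hdx
  have hpt : ∀ ω, sumSq (pre p W η x0 ξ (t + 1) ω) ≤
      (1 + ρ ^ 2) / 2 * sumSq (fun i => pre p W η x0 ξ t ω i
        + mix (W - avgMatrix n - 1) (noise p W η x0 ξ t ω) i)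
      + 2 * ρ ^ 2 / (1 - ρ ^ 2) * (L ^ 2 *
        ∑ i, ‖xs p W η x0 ξ (t + 1) ω i - xs p W η x0 ξ t ω i‖ ^ 2) := by
    intro ω
    rw [h.mixes.pre_succ]
    refine (h.mixes.contract _).trans ?_
    rw [sumSq, sumSq, Finset.mul_sum, Finset.mul_sum, Finset.mul_sum, Finset.mul_sum,
      ← Finset.sum_add_distrib]
    refine Finset.sum_le_sum fun i _ => ?_
    refine (young_contract h.mixes.rho_nonneg h.mixes.rho_lt_one _ _).trans ?_
    have h1 := h.localGrads.lip i _ (h.xs_mem (t + 1) ω i) _ (h.xs_mem t ω i)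
    have h2 := pow_le_pow_left₀ (norm_nonneg _) h1 2
    rw [mul_pow] at h2
    gcongr
  -- The factor `4` comes from `‖a - b‖² ≤ 2‖a‖² + 2‖b‖²` and `‖W - J‖ ≤ 1`.
  have hQ : ∫ ω, sumSq (mix (W - avgMatrix n - 1) (noise p W η x0 ξ t ω)) ∂P ≤ 4 * (n * σ ^ 2) := by
    have hpt : ∀ ω, sumSq (mix (W - avgMatrix n - 1) (noise p W η x0 ξ t ω)) ≤
        4 * sumSq (noise p W η x0 ξ t ω) := by
      intro ω
      have e : mix (W - avgMatrix n - 1) (noise p W η x0 ξ t ω) = fun i =>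
          mix (W - avgMatrix n) (noise p W η x0 ξ t ω) i - noise p W η x0 ξ t ω i := by
        funext i; exact mix_sub_one _ _ i
      rw [e]
      refine (sumSq_sub_le _ _).trans ?_
      have := h.sumSq_mix_le (noise p W η x0 ξ t ω)
      linarith
    have := integral_mono (integrable_sumSq hB) ((integrable_sumSq hN).const_mul 4) hpt
    rw [integral_const_mul] at this
    have := h.integral_sumSq_noise_le t
    linarith
  have := integral_mono (integrable_sumSq (h.pre_memLp (t + 1)))
    ((hI1.const_mul ((1 + ρ ^ 2) / 2)).add
      ((hI2.const_mul (L ^ 2)).const_mul (2 * ρ ^ 2 / (1 - ρ ^ 2)))) hpt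
  simp only [Pi.add_apply] at this
  rw [integral_add (hI1.const_mul _) ((hI2.const_mul _).const_mul _), integral_const_mul,
    integral_const_mul, integral_const_mul,
    h.integral_sumSq_add_mix_noise (h.pre_measurable t) (h.pre_memLp t)] at this
  refine this.trans ?_
  gcongr

/-- The predictable tracking error at time `0` is at most the initial dispersion. -/
lemma integral_sumSq_pre_zero_le :
    ∫ ω, sumSq (pre p W η x0 ξ 0 ω) ∂P ≤ p.initDispersion P ξ x0 := by
  -- Initially `pre` is mixed deterministic gradients. The dispersion of the first stochastic
  -- gradients is that of their means plus a nonnegative variance, so it dominates.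
  set U : Ω → Fin n → Vec d := fun _ i => p.gbar i x0 - avg fun j => p.gbar j x0 with hU
  have hN := fun i => (h.noise_memLp 0 i).1
  have e1 : p.initDispersion P ξ x0 = ∫ ω, sumSq (fun i => U ω i
      + mix (1 - avgMatrix n) (noise p W η x0 ξ 0 ω) i) ∂P := by
    refine integral_congr_ae (ae_of_all _ fun ω => ?_)
    have e : ∀ i, p.gradF i x0 (ξ i 0 ω) = p.gbar i x0 + noise p W η x0 ξ 0 ω i := by
      intro i
      have : noise p W η x0 ξ 0 ω i = p.gradF i x0 (ξ i 0 ω) - p.gbar i x0 := rfl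
      rw [this]; abel
    simp only [e, consensusSq_eq, sumSq, mix_one_sub_avgMatrix, hU, avg_add]
    refine Finset.sum_congr rfl fun i _ => ?_
    congr 2; abel
  rw [e1, h.integral_sumSq_add_mix_noise (U := U) (fun i => measurable_const)
    fun i => memLp_const _]
  have e2 : ∀ ω, sumSq (pre p W η x0 ξ 0 ω) ≤ sumSq (U ω) := by
    intro ω
    have : pre p W η x0 ξ 0 ω = mix (W - avgMatrix n) (U ω) := by
      funext i
      have e3 : pre p W η x0 ξ 0 ω = mix (W - avgMatrix n) fun j => p.gbar j x0 - 0 := by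
        simp only [pre]
        congr 1; funext j
        simp [ys, gs, xs, Problem.run, initState]
      rw [e3, ← h.mixes.mix_sub_avg, ← h.mixes.mix_sub_avg]
    rw [this]; exact h.sumSq_mix_le _
  have h1 := integral_mono (integrable_sumSq (h.pre_memLp 0))
    (integrable_sumSq (V := U) fun i => memLp_const _) e2
  have h2 : 0 ≤ ∫ ω, sumSq (mix (1 - avgMatrix n) (noise p W η x0 ξ 0 ω)) ∂P :=
    integral_nonneg fun ω => sumSq_nonneg _
  linarith

lemma prox_memLp (t : ℕ) (i : Fin n) :
    MemLp (fun ω => prox (comp p.fAvg p.r) lam (xs p W η x0 ξ t ω i)) 2 P := by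
  refine memLp_of_affine_bound ((h.state_memLp t).1 i)
    (h.setting.continuous_prox.comp_aestronglyMeasurable ((h.state_memLp t).1 i).1)
    (a := ‖prox (comp p.fAvg p.r) lam 0‖) (b := 4 / 3) fun ω => ?_
  have h1 := h.setting.prox_lipschitz (xs p W η x0 ξ t ω i) 0
  rw [sub_zero] at h1
  have h2 := norm_sub_norm_le (prox (comp p.fAvg p.r) lam (xs p W η x0 ξ t ω i))
    (prox (comp p.fAvg p.r) lam 0)
  linarith

lemma residual_memLp (t : ℕ) (i : Fin n) : MemLp (fun ω =>
    xs p W η x0 ξ t ω i - prox (comp p.fAvg p.r) lam (xs p W η x0 ξ t ω i)) 2 P :=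
  ((h.state_memLp t).1 i).sub (h.prox_memLp t i)

lemma integrable_residualSq (t : ℕ) :
    Integrable (fun ω => residualSq p.r p.fAvg lam (xs p W η x0 ξ t ω)) P :=
  integrable_sumSq (h.residual_memLp t)

lemma sumDrift_memLp (t : ℕ) : MemLp (fun ω =>
    sumDrift p.r p.fAvg p.gAvg lam η p.gbar (xs p W η x0 ξ t ω)) 2 P := by
  refine memLp_finsetSum _ fun i _ => ?_
  refine ((h.residual_memLp t i).const_smul (1 - η / lam)).sub
    (((MemLp.avg fun j => h.gbar_xs_memLp t j).sub (MemLp.avg fun j => ?_)).const_smul η)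
  exact h.gbar_memLp (h.prox_memLp t i)
    (h.setting.continuous_prox.measurable.comp (h.measurable_xs t i))
    (fun ω => (h.setting.proxPt _).1) j

/-- The drift uses mean gradients at `x^t` and at its proximal points, so it is determined before
the samples of time `t` are drawn. -/
lemma integral_inner_sumDrift (t : ℕ) :
    ∫ ω, inner ℝ (sumDrift p.r p.fAvg p.gAvg lam η p.gbar (xs p W η x0 ξ t ω))
      (avg (noise p W η x0 ξ t ω)) ∂P = 0 := by
  simp only [avg, inner_smul_right, inner_sum]
  rw [integral_const_mul, integral_finsetSum _ fun i _ =>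
    integrable_inner_of_memLp (h.sumDrift_memLp t) (h.noise_memLp t i).1]
  rw [Finset.sum_eq_zero fun i _ =>
    h.integral_inner_noise (h.sumDrift_measurable t) (h.sumDrift_memLp t) i, mul_zero]

lemma integral_norm_avg_noise_le (t : ℕ) :
    n * ∫ ω, ‖avg (noise p W η x0 ξ t ω)‖ ^ 2 ∂P ≤ n * σ ^ 2 := by
  have hN := fun i => (h.noise_memLp t i).1
  refine le_trans ?_ (h.integral_sumSq_noise_le t)
  rw [← integral_const_mul]
  exact integral_mono (((MemLp.avg hN).integrable_norm_pow (by norm_num)).const_mul _)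
    (integrable_sumSq hN) fun ω => norm_avg_sq_le h.n_pos _

/-- The envelope lies between `m` and the proximal objective at the fixed competitor `x0`, which is
quadratic in the iterate. -/
lemma integrable_sumEnv {m : ℝ} (hm : ∀ x, m ≤ moreauEnv (comp p.fAvg p.r) lam x) (t : ℕ) :
    Integrable (fun ω => sumEnv p.r p.fAvg lam (xs p W η x0 ξ t ω)) P := by
  refine integrable_finsetSum _ fun i _ => ?_
  have hx := (h.state_memLp t).1 i
  have hk : 0 ≤ 1 / (2 * lam) := by have := h.setting.lam_pos; positivity
  have hsub : MemLp (fun ω => x0 - xs p W η x0 ξ t ω i) 2 P := (memLp_const x0).sub hx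
  refine Integrable.mono' (g := fun ω => |m| + (|p.fAvg x0 + (p.r x0).toReal|
      + 1 / (2 * lam) * ‖x0 - xs p W η x0 ξ t ω i‖ ^ 2)) ?_ ?_ (ae_of_all _ fun ω => ?_)
  · exact (integrable_const _).add ((integrable_const _).add
      ((hsub.integrable_norm_pow (by norm_num)).const_mul _))
  · exact h.setting.differentiable_moreauEnv.continuous.comp_aestronglyMeasurable hx.1
  · have h1 := h.setting.moreauEnv_le (xs p W η x0 ξ t ω i) h.x0_mem
    have h2 := hm (xs p W η x0 ξ t ω i)
    unfold realObj at h1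
    have h3 := le_abs_self (p.fAvg x0 + (p.r x0).toReal)
    have h4 := neg_abs_le m
    have h5 : 0 ≤ 1 / (2 * lam) * ‖x0 - xs p W η x0 ξ t ω i‖ ^ 2 := by positivity
    have h6 := abs_nonneg (p.fAvg x0 + (p.r x0).toReal)
    have h7 := abs_nonneg m
    rw [Real.norm_eq_abs, abs_le]
    constructor <;> linarith

lemma integral_consensusSq_xs_succ_le (t : ℕ) :
    ∫ ω, consensusSq (xs p W η x0 ξ (t + 1) ω) ∂P ≤
      (1 + ρ ^ 2) / 2 * ∫ ω, consensusSq (xs p W η x0 ξ t ω) ∂P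
      + 2 * ρ ^ 2 * η ^ 2 / (1 - ρ ^ 2) * ∫ ω, consensusSq (ys p W η x0 ξ (t + 1) ω) ∂P := by
  have hX := integrable_consensusSq (h.state_memLp t).1
  have hY := integrable_consensusSq (h.state_memLp (t + 1)).2.1
  rw [← integral_const_mul, ← integral_const_mul,
    ← integral_add (hX.const_mul _) (hY.const_mul _)]
  refine integral_mono (integrable_consensusSq (h.state_memLp (t + 1)).1)
    ((hX.const_mul _).add (hY.const_mul _)) fun ω => ?_
  exact consensusSq_step_le h.setting h.mixes _ _

lemma integral_sumSq_xs_succ_sub_le (t : ℕ) :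
    ∫ ω, ∑ i, ‖xs p W η x0 ξ (t + 1) ω i - xs p W η x0 ξ t ω i‖ ^ 2 ∂P ≤
      8 * ∫ ω, residualSq p.r p.fAvg lam (xs p W η x0 ξ t ω) ∂P
      + 14 * ∫ ω, consensusSq (xs p W η x0 ξ t ω) ∂P
      + 8 * η ^ 2 * ∫ ω, consensusSq (ys p W η x0 ξ (t + 1) ω) ∂P
      + 4 * η ^ 2 * (n * σ ^ 2) := by
  have hN := fun i => (h.noise_memLp t i).1
  have hA := (h.integrable_residualSq t).const_mul 8
  have hX := (integrable_consensusSq (h.state_memLp t).1).const_mul 14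
  have hY := (integrable_consensusSq (h.state_memLp (t + 1)).2.1).const_mul (8 * η ^ 2)
  have hν : Integrable (fun ω => 4 * η ^ 2 * (n * ‖avg (noise p W η x0 ξ t ω)‖ ^ 2)) P :=
    (((MemLp.avg hN).integrable_norm_pow (by norm_num)).const_mul _).const_mul _
  have hc := (integrable_inner_of_memLp (h.sumDrift_memLp t) (MemLp.avg hN)).const_mul (8 * η)
  have hdx : ∀ i, MemLp (fun ω => xs p W η x0 ξ (t + 1) ω i - xs p W η x0 ξ t ω i) 2 P :=
    fun i => ((h.state_memLp (t + 1)).1 i).sub ((h.state_memLp t).1 i)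
  have key := integral_mono (integrable_sumSq hdx) ((((hA.add hX).add hY).add hν).sub hc)
    fun ω => by
      have := sumSq_step_sub_le h.n_pos h.setting h.localGrads h.mixes (h.xs_mem t ω)
        (ys p W η x0 ξ (t + 1) ω)
      rw [avg_ys_sub_avgGrad p η x0 ξ h.mixes] at this
      refine this.trans (le_of_eq ?_)
      simp only [Pi.add_apply, Pi.sub_apply]; ring
  rw [integral_sub' (((hA.add hX).add hY).add hν) hc, integral_add' ((hA.add hX).add hY) hν,
    integral_add' (hA.add hX) hY, integral_add' hA hX, integral_const_mul, integral_const_mul,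
    integral_const_mul, integral_const_mul, integral_const_mul, integral_const_mul,
    h.integral_inner_sumDrift] at key
  have := mul_le_mul_of_nonneg_left (h.integral_norm_avg_noise_le t)
    (by positivity : 0 ≤ 4 * η ^ 2)
  unfold sumSq at key
  linarith

lemma integral_sumEnv_succ_le {m : ℝ} (hm : ∀ x, m ≤ moreauEnv (comp p.fAvg p.r) lam x) (t : ℕ) :
    ∫ ω, sumEnv p.r p.fAvg lam (xs p W η x0 ξ (t + 1) ω) ∂P ≤
      ∫ ω, sumEnv p.r p.fAvg lam (xs p W η x0 ξ t ω) ∂P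
      - 3 / 8 * (η / lam ^ 2) * ∫ ω, residualSq p.r p.fAvg lam (xs p W η x0 ξ t ω) ∂P
      + 1 / lam * (2 * ∫ ω, consensusSq (xs p W η x0 ξ t ω) ∂P
        + 2 * η ^ 2 * ∫ ω, consensusSq (ys p W η x0 ξ (t + 1) ω) ∂P
        + 1 / 2 * η ^ 2 * (n * σ ^ 2)) := by
  have hN := fun i => (h.noise_memLp t i).1
  have hE := h.integrable_sumEnv hm t
  have hA := (h.integrable_residualSq t).const_mul (3 / 8 * (η / lam ^ 2))
  have hX := (integrable_consensusSq (h.state_memLp t).1).const_mul (1 / lam * 2)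
  have hY := (integrable_consensusSq (h.state_memLp (t + 1)).2.1).const_mul (1 / lam * (2 * η ^ 2))
  have hν : Integrable (fun ω => 1 / lam * (1 / 2 * η ^ 2) *
      (n * ‖avg (noise p W η x0 ξ t ω)‖ ^ 2)) P :=
    (((MemLp.avg hN).integrable_norm_pow (by norm_num)).const_mul _).const_mul _
  have hc := (integrable_inner_of_memLp (h.sumDrift_memLp t) (MemLp.avg hN)).const_mul (η / lam)
  have key := integral_mono (h.integrable_sumEnv hm (t + 1))
    (((((hE.sub hA).add hX).add hY).add hν).sub hc) fun ω => by
      have := sumEnv_step_le h.n_pos h.setting h.localGrads h.mixes (h.xs_mem t ω)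
        (ys p W η x0 ξ (t + 1) ω)
      rw [avg_ys_sub_avgGrad p η x0 ξ h.mixes] at this
      refine this.trans (le_of_eq ?_)
      simp only [Pi.add_apply, Pi.sub_apply]; ring
  rw [integral_sub' ((((hE.sub hA).add hX).add hY).add hν) hc,
    integral_add' (((hE.sub hA).add hX).add hY) hν,
    integral_add' ((hE.sub hA).add hX) hY, integral_add' (hE.sub hA) hX, integral_sub' hE hA,
    integral_const_mul, integral_const_mul,
    integral_const_mul, integral_const_mul, integral_const_mul, integral_const_mul,
    h.integral_inner_sumDrift] at key
  have h0 : 0 ≤ 1 / lam * (1 / 2 * η ^ 2) := by have := h.setting.lam_pos; positivity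
  have := mul_le_mul_of_nonneg_left (h.integral_norm_avg_noise_le t) h0
  linarith

end RunSetting

end

section

/-! ### Summing the recursions -/

/-- The terminal term is carried through the induction and dropped at the end. -/
lemma sum_le_of_contraction {u b : ℕ → ℝ} {s : ℝ} (hu : ∀ t, 0 ≤ u t)
    (h : ∀ t, u (t + 1) ≤ (1 + s) / 2 * u t + b t) (T : ℕ) :
    (1 - s) / 2 * ∑ t ∈ Finset.range T, u t ≤ u 0 + ∑ t ∈ Finset.range T, b t := by
  have key : (1 - s) / 2 * ∑ t ∈ Finset.range T, u t + u T ≤ u 0 + ∑ t ∈ Finset.range T, b t := by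
    induction T with
    | zero => simp
    | succ T ih =>
      rw [Finset.sum_range_succ, Finset.sum_range_succ]
      have := h T
      linarith
  have := hu T
  linarith

/-- The tracking error in the linear system, with `a = ρ L` and `i = 1/(1-ρ²)`. -/
lemma tracking_bound {ρ a η i S U A X Y Z M : ℝ} (hρ : ρ ^ 2 ≤ 1) (hi1 : 1 ≤ i) (hU : 0 ≤ U)
    (hY : 0 ≤ Y) (hβ : (a * η) ^ 2 * i ^ 4 ≤ 1 / 9216)
    (hX : X ≤ 4 * ρ ^ 2 * η ^ 2 * i ^ 2 * Y)
    (hZ : Z ≤ 2 * i * S + 8 * i * U + 4 * a ^ 2 * i ^ 2 * M) (hYZ : Y ≤ Z + U)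
    (hM : M ≤ 8 * A + 14 * X + 8 * η ^ 2 * Y + 4 * η ^ 2 * U) :
    Y ≤ 4 * i * S + 20 * i * U + 64 * a ^ 2 * i ^ 2 * A := by
  have hβ' : (a * η) ^ 2 * i ^ 2 ≤ 1 / 9216 :=
    (mul_le_mul_of_nonneg_left (pow_le_pow_right₀ hi1 (by norm_num)) (sq_nonneg (a * η))).trans hβ
  -- The chain `Y → Z → M → Y` closes on itself. Smallness of `aη` gives the two feedback terms
  -- coefficient `1/4` each, so half of `Y` is absorbed on the left and the other constants double.
  have h2 : 4 * a ^ 2 * i ^ 2 * M ≤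
      4 * a ^ 2 * i ^ 2 * (8 * A + 14 * X + 8 * η ^ 2 * Y + 4 * η ^ 2 * U) := by gcongr
  have h3 : 4 * a ^ 2 * i ^ 2 * (14 * X) ≤ 1 / 4 * Y := by
    calc 4 * a ^ 2 * i ^ 2 * (14 * X)
        ≤ 4 * a ^ 2 * i ^ 2 * (14 * (4 * ρ ^ 2 * η ^ 2 * i ^ 2 * Y)) := by gcongr
      _ = 224 * (ρ ^ 2 * ((a * η) ^ 2 * i ^ 4 * Y)) := by ring
      _ ≤ 224 * (1 * (1 / 9216 * Y)) := by gcongr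
      _ ≤ 1 / 4 * Y := by linarith
  have h5 : 4 * a ^ 2 * i ^ 2 * (8 * η ^ 2 * Y) ≤ 1 / 4 * Y := by
    calc 4 * a ^ 2 * i ^ 2 * (8 * η ^ 2 * Y) = 32 * ((a * η) ^ 2 * i ^ 2 * Y) := by ring
      _ ≤ 32 * (1 / 9216 * Y) := by gcongr
      _ ≤ 1 / 4 * Y := by linarith
  have h7 : U ≤ i * U := le_mul_of_one_le_left hU hi1
  have h6 : 4 * a ^ 2 * i ^ 2 * (4 * η ^ 2 * U) ≤ i * U := by
    calc 4 * a ^ 2 * i ^ 2 * (4 * η ^ 2 * U) = 16 * ((a * η) ^ 2 * i ^ 2 * U) := by ring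
      _ ≤ 16 * (1 / 9216 * U) := by gcongr
      _ ≤ i * U := by linarith
  simp only [mul_add] at h2
  have e : 4 * a ^ 2 * i ^ 2 * (8 * A) = 1 / 2 * (64 * a ^ 2 * i ^ 2 * A) := by ring
  rw [e] at h2
  generalize 4 * a ^ 2 * i ^ 2 * M = q1 at *
  generalize 4 * a ^ 2 * i ^ 2 * (14 * X) = q2 at *
  generalize 4 * a ^ 2 * i ^ 2 * (8 * η ^ 2 * Y) = q3 at *
  generalize 4 * a ^ 2 * i ^ 2 * (4 * η ^ 2 * U) = q4 at *
  generalize 64 * a ^ 2 * i ^ 2 * A = q5 at *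
  clear hβ hβ' e hX hM
  linarith

/-- The linear system satisfied by the sums: `i = 1/(1-ρ²)`, `k = 1/λ`, `U = T n σ²`. -/
lemma bound_of_linear_system {ρ L η i k G S U A X Y Z M : ℝ} (hρ0 : 0 ≤ ρ) (hρ1 : ρ < 1)
    (hL : 0 ≤ L) (hη : 0 < η) (hi1 : 1 ≤ i) (hiρ : (1 - ρ ^ 2) * i = 1) (hk : 0 < k)
    (hG : 0 ≤ G) (hS : 0 ≤ S) (hU : 0 ≤ U) (hA : 0 ≤ A) (hY : 0 ≤ Y)
    (hβ : ρ * L * η * i ^ 4 ≤ 1 / 96) (hα : ρ * L ≤ k / 96)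
    (hX : X ≤ 4 * ρ ^ 2 * η ^ 2 * i ^ 2 * Y)
    (hZ : Z ≤ 2 * i * (S + 4 * U + 2 * ρ ^ 2 * i * (L ^ 2 * M)))
    (hYZ : Y ≤ Z + U)
    (hM : M ≤ 8 * A + 14 * X + 8 * η ^ 2 * Y + 4 * η ^ 2 * U)
    (hD : 3 / 8 * (η * k ^ 2) * A ≤ G + k * (2 * X + 2 * η ^ 2 * Y + 1 / 2 * η ^ 2 * U)) :
    k ^ 2 * A + L ^ 2 * X ≤ 8 * G / η + η * k * (768 * S + 4616 * U) * i ^ 3 := by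
  set α := ρ * L with hαdef
  have hα0 : 0 ≤ α := mul_nonneg hρ0 hL
  have hi0 : 0 < i := by linarith
  have hρ2 : ρ ^ 2 ≤ 1 := by nlinarith
  have hi8 : i ^ 4 ≤ i ^ 8 := pow_le_pow_right₀ hi1 (by norm_num)
  have hβ2 : (α * η) ^ 2 * i ^ 8 ≤ 1 / 9216 := by
    have h1 : 0 ≤ α * η * i ^ 4 := by positivity
    have := pow_le_pow_left₀ h1 hβ 2
    nlinarith
  have hβ4 : (α * η) ^ 2 * i ^ 4 ≤ 1 / 9216 :=
    (mul_le_mul_of_nonneg_left hi8 (sq_nonneg (α * η))).trans hβ2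
  have hαη : α * η ≤ 1 / 96 := by
    have : α * η * 1 ≤ α * η * i ^ 4 :=
      mul_le_mul_of_nonneg_left (one_le_pow₀ hi1) (by positivity)
    linarith
  have hY1 : Y ≤ 4 * i * S + 20 * i * U + 64 * α ^ 2 * i ^ 2 * A :=
    tracking_bound hρ2 hi1 hU hY hβ4 hX
      (hZ.trans (le_of_eq (by rw [hαdef]; ring))) hYZ hM
  -- consensus and tracking errors together
  have hXY : 2 * X + 2 * η ^ 2 * Y ≤ 8 * η ^ 2 * i ^ 2 * Y := by
    -- Since `(1-ρ²)i = 1`, the left side equals `(1+ρ²)²i²`.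
    have h1 : 1 + 4 * ρ ^ 2 * i ^ 2 ≤ 4 * i ^ 2 := by
      have : (1 + 4 * ρ ^ 2 * i ^ 2) = (1 + ρ ^ 2) ^ 2 * i ^ 2 := by
        have : ((1 - ρ ^ 2) * i) ^ 2 = 1 := by rw [hiρ]; norm_num
        linear_combination - this
      rw [this]
      gcongr
      nlinarith [sq_nonneg ρ]
    have h2 : 2 * η ^ 2 * Y * (1 + 4 * ρ ^ 2 * i ^ 2) ≤ 2 * η ^ 2 * Y * (4 * i ^ 2) := by gcongr
    linarith
  -- Feeding the tracking bound into the descent inequality returns a multiple of `A` of at most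
  -- `1/16`, by the two smallness conditions together; `5/16 = 3/8 - 1/16` is left.
  have hA1 : 5 / 16 * (η * k ^ 2) * A ≤ G + η ^ 2 * k * (32 * S + 161 * U) * i ^ 3 := by
    have h1 : 8 * η ^ 2 * i ^ 2 * Y ≤
        8 * η ^ 2 * i ^ 2 * (4 * i * S + 20 * i * U + 64 * α ^ 2 * i ^ 2 * A) := by gcongr
    have h2 : k * (8 * η ^ 2 * i ^ 2 * (64 * α ^ 2 * i ^ 2 * A)) ≤ 1 / 16 * (η * k ^ 2) * A := by
      have e : k * (8 * η ^ 2 * i ^ 2 * (64 * α ^ 2 * i ^ 2 * A)) =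
          512 * (k * η * A * (α * (α * η * i ^ 4))) := by ring
      rw [e]
      have h3 : α * (α * η * i ^ 4) ≤ k / 96 * (1 / 96) := by gcongr
      have h4 : k * η * A * (α * (α * η * i ^ 4)) ≤ k * η * A * (k / 96 * (1 / 96)) := by gcongr
      have : 0 ≤ η * k ^ 2 * A := by positivity
      linarith
    have h5 : k * (2 * X + 2 * η ^ 2 * Y + 1 / 2 * η ^ 2 * U) ≤
        k * (8 * η ^ 2 * i ^ 2 * (4 * i * S + 20 * i * U + 64 * α ^ 2 * i ^ 2 * A)
          + 1 / 2 * η ^ 2 * U) := by gcongr; linarith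
    have h6 : k * (1 / 2 * η ^ 2 * U) ≤ η ^ 2 * k * U * i ^ 3 := by
      have : η ^ 2 * k * U * 1 ≤ η ^ 2 * k * U * i ^ 3 :=
        mul_le_mul_of_nonneg_left (one_le_pow₀ hi1) (by positivity)
      have : 0 ≤ k * η ^ 2 * U := by positivity
      linarith
    linarith
  have hA2 : k ^ 2 * A ≤ 16 / 5 * (G / η) + 16 / 5 * (η * k * (32 * S + 161 * U) * i ^ 3) := by
    refine le_of_mul_le_mul_left ?_ hη
    have e : η * (16 / 5 * (G / η) + 16 / 5 * (η * k * (32 * S + 161 * U) * i ^ 3)) =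
        16 / 5 * (G + η ^ 2 * k * (32 * S + 161 * U) * i ^ 3) := by field_simp
    rw [e]; linarith
  have hLX : L ^ 2 * X ≤ 1 / 2 * (k ^ 2 * A) + η * k * (S + U) * i ^ 3 := by
    have h1 : L ^ 2 * X ≤ L ^ 2 * (4 * ρ ^ 2 * η ^ 2 * i ^ 2 *
        (4 * i * S + 20 * i * U + 64 * α ^ 2 * i ^ 2 * A)) := by
      gcongr; exact hX.trans (by gcongr)
    have e : L ^ 2 * (4 * ρ ^ 2 * η ^ 2 * i ^ 2 *
        (4 * i * S + 20 * i * U + 64 * α ^ 2 * i ^ 2 * A)) =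
        η * (α * (α * η)) * (16 * S + 80 * U) * i ^ 3
          + 256 * (α ^ 2 * ((α * η) ^ 2 * i ^ 4) * A) := by rw [hαdef]; ring
    have h2 : η * (α * (α * η)) * (16 * S + 80 * U) * i ^ 3 ≤
        η * (k / 96 * (1 / 96)) * (16 * S + 80 * U) * i ^ 3 := by gcongr
    have h3 : α ^ 2 * ((α * η) ^ 2 * i ^ 4) * A ≤ (k / 96) ^ 2 * (1 / 9216) * A := by gcongr
    have h4 : 0 ≤ k ^ 2 * A := by positivity
    have h5 : 0 ≤ η * k * S * i ^ 3 := by positivity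
    have h6 : 0 ≤ η * k * U * i ^ 3 := by positivity
    linarith
  -- The constants `8`, `768`, `4616` are half of those in `T_ε` and `η`; the estimates above give
  -- smaller ones, so nonnegativity of the terms closes the gap.
  have h1 : 0 ≤ G / η := by positivity
  have h5 : 0 ≤ η * k * S * i ^ 3 := by positivity
  have h6 : 0 ≤ η * k * U * i ^ 3 := by positivity
  have e : 8 * G / η = 8 * (G / η) := by ring
  rw [e]
  linarith

variable {n d : ℕ} {Ξ : Fin n → Type*} [∀ i, MeasurableSpace (Ξ i)] {Ω : Type*}
  [MeasurableSpace Ω] {p : Problem n d Ξ} {W : Matrix (Fin n) (Fin n) ℝ} {L lam η ρ σ : ℝ}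
  {P : Measure Ω} [IsProbabilityMeasure P] {ξ : ∀ i, ℕ → Ω → Ξ i} {x0 : Vec d}

omit [IsProbabilityMeasure P] in
lemma initDispersion_nonneg : 0 ≤ p.initDispersion P ξ x0 :=
  integral_nonneg fun _ => consensusSq_nonneg _

/-- Sum of the expected stationarity measures along the run. -/
lemma RunSetting.sum_stationarity_le (h : RunSetting p W L lam η ρ σ P ξ x0)
    (hβ : ρ * L * η ≤ (1 - ρ ^ 2) ^ 4 / 96) (hα : ρ * L * lam ≤ 1 / 96)
    {m : ℝ} (hm : ∀ x, m ≤ moreauEnv (comp p.fAvg p.r) lam x) (T : ℕ) :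
    ∑ t ∈ Finset.range T,
      (1 / lam ^ 2 * ∫ ω, residualSq p.r p.fAvg lam (xs p W η x0 ξ t ω) ∂P
        + L ^ 2 * ∫ ω, consensusSq (xs p W η x0 ξ t ω) ∂P) ≤
      8 * (n * (moreauEnv (comp p.fAvg p.r) lam x0 - m)) / η
        + η * (768 * p.initDispersion P ξ x0 + 4616 * (T * (n * σ ^ 2)))
          / (lam * (1 - ρ ^ 2) ^ 3) := by
  have hq : 0 < 1 - ρ ^ 2 := sub_pos.2 h.rho_sq_lt_one
  have hl := h.setting.lam_pos
  set i := 1 / (1 - ρ ^ 2) with hi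
  have hiq : (1 - ρ ^ 2) * i = 1 := mul_one_div_cancel hq.ne'
  have hi1 : 1 ≤ i := by rw [hi, le_div_iff₀ hq]; nlinarith [sq_nonneg ρ]
  have hi0 : 0 < i := by linarith
  set A := fun t => ∫ ω, residualSq p.r p.fAvg lam (xs p W η x0 ξ t ω) ∂P with hAdef
  set X := fun t => ∫ ω, consensusSq (xs p W η x0 ξ t ω) ∂P with hXdef
  set Y := fun t => ∫ ω, consensusSq (ys p W η x0 ξ (t + 1) ω) ∂P with hYdef
  set Z := fun t => ∫ ω, sumSq (pre p W η x0 ξ t ω) ∂P with hZdef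
  set M := fun t => ∫ ω, ∑ i, ‖xs p W η x0 ξ (t + 1) ω i - xs p W η x0 ξ t ω i‖ ^ 2 ∂P with hMdef
  set Φ := fun t => ∫ ω, sumEnv p.r p.fAvg lam (xs p W η x0 ξ t ω) ∂P with hΦdef
  set V := n * σ ^ 2 with hV
  have hV0 : 0 ≤ V := by positivity
  -- All workers start at the same point, so no initial consensus error enters.
  have hX0 : X 0 = 0 := by
    have : ∀ ω, consensusSq (xs p W η x0 ξ 0 ω) = 0 := by
      intro ω
      have hn : (n : ℝ) ≠ 0 := by exact_mod_cast h.n_pos.ne'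
      simp only [consensusSq, xs, Problem.run, initState, Finset.sum_const, Finset.card_univ,
        Fintype.card_fin, ← Nat.cast_smul_eq_nsmul ℝ, smul_smul, one_div_mul_cancel hn, one_smul,
        sub_self, norm_zero]
      simp
    simp [hXdef, this]
  have hΦ0 : Φ 0 = n * moreauEnv (comp p.fAvg p.r) lam x0 := by
    simp [hΦdef, sumEnv, xs, Problem.run, initState]
  have hΦT : n * m ≤ Φ T := by
    have : ∀ ω, n * m ≤ sumEnv p.r p.fAvg lam (xs p W η x0 ξ T ω) := fun ω => by
      calc n * m = ∑ _i : Fin n, m := by simp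
        _ ≤ _ := Finset.sum_le_sum fun i _ => hm _
    calc n * m = ∫ _ω, n * m ∂P := by simp
      _ ≤ Φ T := integral_mono (integrable_const _) (h.integrable_sumEnv hm T) this
  have hsX := sum_le_of_contraction (u := X) (s := ρ ^ 2)
    (b := fun t => 2 * ρ ^ 2 * η ^ 2 / (1 - ρ ^ 2) * Y t)
    (fun t => integral_nonneg fun _ => consensusSq_nonneg _)
    (fun t => h.integral_consensusSq_xs_succ_le t) T
  have hsZ := sum_le_of_contraction (u := Z) (s := ρ ^ 2)
    (b := fun t => 4 * V + 2 * ρ ^ 2 / (1 - ρ ^ 2) * (L ^ 2 * M t))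
    (fun t => integral_nonneg fun _ => sumSq_nonneg _)
    (fun t => by
      have := h.integral_sumSq_pre_succ_le t
      have h1 : (1 + ρ ^ 2) / 2 * (4 * V) ≤ 4 * V := by nlinarith [h.rho_sq_lt_one]
      change Z (t + 1) ≤ (1 + ρ ^ 2) / 2 * (Z t + 4 * V)
        + 2 * ρ ^ 2 / (1 - ρ ^ 2) * (L ^ 2 * M t) at this
      linarith) T
  have hsY := Finset.sum_le_sum fun t (_ : t ∈ Finset.range T) => h.integral_consensusSq_ys_le t
  have hsM := Finset.sum_le_sum fun t (_ : t ∈ Finset.range T) =>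
    h.integral_sumSq_xs_succ_sub_le t
  have hsΦ : 3 / 8 * (η / lam ^ 2) * ∑ t ∈ Finset.range T, A t ≤ Φ 0 - Φ T
      + 1 / lam * (2 * ∑ t ∈ Finset.range T, X t + 2 * η ^ 2 * ∑ t ∈ Finset.range T, Y t
        + 1 / 2 * η ^ 2 * (T * V)) := by
    have := Finset.sum_le_sum fun t (_ : t ∈ Finset.range T) => h.integral_sumEnv_succ_le hm t
    have htel := Finset.sum_range_sub Φ T
    rw [Finset.sum_sub_distrib] at htel
    simp only [Finset.sum_add_distrib, Finset.sum_sub_distrib, ← Finset.mul_sum, Finset.sum_const,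
      Finset.card_range, nsmul_eq_mul] at this
    change ∑ t ∈ Finset.range T, Φ (t + 1) ≤ ∑ t ∈ Finset.range T, Φ t - _ + _ at this
    linarith
  simp only [Finset.sum_add_distrib, ← Finset.mul_sum, Finset.sum_const, Finset.card_range,
    nsmul_eq_mul] at hsX hsZ hsY hsM ⊢
  have hZ0 : Z 0 ≤ p.initDispersion P ξ x0 := h.integral_sumSq_pre_zero_le
  have hinv : ∀ a, a / (1 - ρ ^ 2) = a * i := fun a => by rw [hi]; ring
  rw [hinv] at hsX hsZ
  have hm0 : m ≤ moreauEnv (comp p.fAvg p.r) lam x0 := hm x0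
  have key := bound_of_linear_system (ρ := ρ) (L := L) (η := η) (i := i) (k := 1 / lam)
    (G := n * (moreauEnv (comp p.fAvg p.r) lam x0 - m)) (S := p.initDispersion P ξ x0)
    (U := T * V) (A := ∑ t ∈ Finset.range T, A t) (X := ∑ t ∈ Finset.range T, X t)
    (Y := ∑ t ∈ Finset.range T, Y t) (Z := ∑ t ∈ Finset.range T, Z t)
    (M := ∑ t ∈ Finset.range T, M t) h.mixes.rho_nonneg h.mixes.rho_lt_one h.setting.smooth.nonneg
    h.setting.eta_pos hi1 hiq (by positivity)
    (mul_nonneg (Nat.cast_nonneg n) (sub_nonneg.2 hm0)) initDispersion_nonneg (by positivity)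
    (Finset.sum_nonneg fun t _ => integral_nonneg fun _ => residualSq_nonneg _)
    (Finset.sum_nonneg fun t _ => integral_nonneg fun _ => consensusSq_nonneg _)
    (by
      have h1 : (1 - ρ ^ 2) ^ 4 / 96 * i ^ 4 = 1 / 96 := by
        have : ((1 - ρ ^ 2) * i) ^ 4 = 1 := by rw [hiq]; norm_num
        linear_combination this / 96
      rw [← h1]; gcongr)
    (by rw [div_div, le_div_iff₀ (by positivity)]; linarith)
    (by
      have h1 := mul_le_mul_of_nonneg_left hsX (by positivity : 0 ≤ 2 * i)
      rw [hX0] at h1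
      have h2 : 2 * i * ((1 - ρ ^ 2) / 2 * ∑ t ∈ Finset.range T, X t) =
          ∑ t ∈ Finset.range T, X t := by
        linear_combination (∑ t ∈ Finset.range T, X t) * hiq
      linarith)
    (by
      have h1 := mul_le_mul_of_nonneg_left
        (hsZ.trans (add_le_add_left hZ0 _)) (by positivity : 0 ≤ 2 * i)
      have h2 : 2 * i * ((1 - ρ ^ 2) / 2 * ∑ t ∈ Finset.range T, Z t) =
          ∑ t ∈ Finset.range T, Z t := by
        linear_combination (∑ t ∈ Finset.range T, Z t) * hiq
      linarith)
    (hsY.trans (le_of_eq (by rw [hV, mul_left_comm]))) (by linarith)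
    (by
      rw [hΦ0] at hsΦ
      have e : 3 / 8 * (η * (1 / lam) ^ 2) = 3 / 8 * (η / lam ^ 2) := by field_simp
      rw [e]; linarith)
  have e1 : (1 / lam) ^ 2 = 1 / lam ^ 2 := by field_simp
  rw [e1] at key
  refine key.trans (le_of_eq ?_)
  rw [hi]; field_simp

end

section

/-! ### The parameters -/

section Parameters

variable {L ρ σ ε : ℝ}

lemma lamOf_pos (hL : 0 < L) (h0 : 0 ≤ ρ) : 0 < lamOf L ρ := by
  unfold lamOf
  split_ifs with h
  · positivity
  · have : 0 < ρ := lt_of_le_of_ne h0 (Ne.symm h)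
    positivity

lemma lamOf_mul_le (hL : 0 < L) : lamOf L ρ * L ≤ 1 / 4 := by
  have h : lamOf L ρ ≤ 1 / (4 * L) := by
    unfold lamOf; split_ifs
    · exact le_rfl
    · exact min_le_left _ _
  calc lamOf L ρ * L ≤ 1 / (4 * L) * L := by gcongr
    _ = 1 / 4 := by field_simp

lemma rho_mul_lamOf_le (hL : 0 < L) (h0 : 0 ≤ ρ) : ρ * L * lamOf L ρ ≤ 1 / 96 := by
  unfold lamOf
  split_ifs with h
  · rw [h]; norm_num
  · have hρ : 0 < ρ := lt_of_le_of_ne h0 (Ne.symm h)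
    calc _ ≤ ρ * L * (1 / (96 * ρ * L)) := by gcongr; exact min_le_right _ _
      _ = 1 / 96 := by field_simp

lemma etaMax_pos (hL : 0 < L) (h0 : 0 ≤ ρ) (h1 : ρ < 1) : 0 < etaMax L ρ := by
  have hq : 0 < 1 - ρ ^ 2 := by nlinarith
  unfold etaMax
  split_ifs with h
  · positivity
  · have : 0 < ρ := lt_of_le_of_ne h0 (Ne.symm h)
    positivity

lemma etaMax_le_lamOf (hL : 0 < L) (h0 : 0 ≤ ρ) (h1 : ρ < 1) : etaMax L ρ ≤ lamOf L ρ := by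
  have hq : 0 ≤ 1 - ρ ^ 2 := by nlinarith
  unfold etaMax lamOf
  split_ifs with h
  · exact le_rfl
  · have : (1 - ρ ^ 2) ^ 4 ≤ 1 := pow_le_one₀ hq (by nlinarith [sq_nonneg ρ])
    gcongr

lemma rho_mul_etaMax_le (hL : 0 < L) (h0 : 0 ≤ ρ) :
    ρ * L * etaMax L ρ ≤ (1 - ρ ^ 2) ^ 4 / 96 := by
  unfold etaMax
  split_ifs with h
  · rw [h]; norm_num
  · have hρ : 0 < ρ := lt_of_le_of_ne h0 (Ne.symm h)
    calc _ ≤ ρ * L * ((1 - ρ ^ 2) ^ 4 / (96 * ρ * L)) := by gcongr; exact min_le_right _ _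
      _ = (1 - ρ ^ 2) ^ 4 / 96 := by field_simp

lemma etaOf_le_etaMax : etaOf L ρ σ ε ≤ etaMax L ρ := by
  unfold etaOf; split_ifs
  · exact le_rfl
  · exact min_le_left _ _

lemma etaOf_pos (hL : 0 < L) (h0 : 0 ≤ ρ) (h1 : ρ < 1) (hε : 0 < ε) : 0 < etaOf L ρ σ ε := by
  have hq : 0 < 1 - ρ ^ 2 := by nlinarith
  have hm := etaMax_pos hL h0 h1
  have hl := lamOf_pos hL h0
  unfold etaOf; split_ifs
  · exact hm
  · positivity

lemma etaOf_mul_le (hL : 0 < L) (h0 : 0 ≤ ρ) (h1 : ρ < 1) :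
    etaOf L ρ σ ε * (9232 * σ ^ 2) ≤ lamOf L ρ * (1 - ρ ^ 2) ^ 3 * ε ^ 2 := by
  have hq : 0 < 1 - ρ ^ 2 := by nlinarith
  have hl := lamOf_pos hL h0
  by_cases h : σ = 0
  · rw [h]; norm_num; positivity
  · have : 0 < σ ^ 2 := by positivity
    rw [← le_div_iff₀ (by positivity), etaOf, if_neg h]
    exact min_le_right _ _

end Parameters

/-! ### The assumptions of the theorem give a run setting -/

section Setting

variable {n d : ℕ} {Ξ : Fin n → Type*} [∀ i, MeasurableSpace (Ξ i)] {p : Problem n d Ξ}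
  {L lam η σ : ℝ}

lemma Problem.IsRegular.smoothOn (hreg : p.IsRegular L) (hsg : p.IsStochGrad σ) (hn : 0 < n) :
    SmoothOn (effDom p.r) p.fAvg p.gAvg L := by
  have hn' : (0 : ℝ) < n := by positivity
  refine ⟨hreg.L_pos.le, fun x hx => ?_, fun x hx y hy => ?_⟩
  · have h1 : ∀ i ∈ (Finset.univ : Finset (Fin n)), HasFDerivAt (p.f i)
        (InnerProductSpace.toDual ℝ (Vec d) (p.gbar i x)) x := by
      intro i _
      have := (hreg.differentiable_f i x hx).hasGradientAt.hasFDerivAt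
      rwa [← hsg.unbiased i x hx] at this
    have h2 := (HasFDerivAt.fun_sum h1).const_mul (1 / (n : ℝ))
    rw [hasGradientAt_iff_hasFDerivAt]
    have e : InnerProductSpace.toDual ℝ (Vec d) (p.gAvg x) =
        (1 / (n : ℝ)) • ∑ i, InnerProductSpace.toDual ℝ (Vec d) (p.gbar i x) := by
      rw [Problem.gAvg, avg, map_smulₛₗ, map_sum, conj_trivial]
    rw [e]
    exact h2
  · have h1 : ∀ i, ‖p.gbar i x - p.gbar i y‖ ≤ L * ‖x - y‖ := by
      intro i
      have := hreg.smooth i x hx y hy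
      rwa [← hsg.unbiased i x hx, ← hsg.unbiased i y hy] at this
    rw [Problem.gAvg, Problem.gAvg, ← avg_sub, avg_eq_weighted]
    calc _ ≤ ∑ j : Fin n, 1 / (n : ℝ) * (L * ‖x - y‖) := by
          refine (norm_sum_le _ _).trans (Finset.sum_le_sum fun j _ => ?_)
          rw [norm_smul, Real.norm_of_nonneg (by positivity)]
          exact mul_le_mul_of_nonneg_left (h1 j) (by positivity)
      _ = L * ‖x - y‖ := by rw [← Finset.sum_mul, sum_avg_weights hn, one_mul]

lemma Problem.IsRegular.exists_lower_bound (hreg : p.IsRegular L) :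
    ∃ m : ℝ, ∀ y ∈ effDom p.r, m ≤ p.fAvg y + (p.r y).toReal := by
  obtain ⟨m, hm⟩ := hreg.bddBelow
  refine ⟨m, fun y hy => ?_⟩
  have := hm y
  rw [p.phi_eq_comp, comp, ← hreg.closedConvex.coe_toReal hy] at this
  exact_mod_cast this

lemma Problem.IsRegular.proxSetting (hreg : p.IsRegular L) (hsg : p.IsStochGrad σ) (hn : 0 < n)
    (hlam : 0 < lam) (hL : lam * L ≤ 1 / 4) (hη : 0 < η) (hle : η ≤ lam) :
    ProxSetting p.r p.fAvg p.gAvg L lam η := by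
  have hr := hreg.closedConvex
  have hf := hreg.smoothOn hsg hn
  have hLp := hreg.L_pos
  obtain ⟨m, hm⟩ := hreg.exists_lower_bound
  obtain ⟨y₀, hy₀⟩ := hr.nonempty_dom
  refine ⟨hr, hf, hlam, hL, hη, hle, fun x => ?_, fun x => ?_⟩
  · exact isProxPt_prox hr (exists_isProxPt hr hf hlam hy₀ (m := m) (κ := 0) (by positivity)
      (fun y hy => by simpa using hm y hy) x)
  · have hηL : η * L ≤ 1 / 4 := (mul_le_mul_of_nonneg_right hle hLp.le).trans hL
    -- From `φ ≥ m` and the quadratic upper bound on `f`, `r` has a concave quadratic minorant: `L`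
    -- comes from the first-order bound and `L/2` from splitting the linear term. `ηL ≤ 1/4` leaves
    -- room.
    have hκ : 3 / 2 * L < 1 / (2 * η) := by
      rw [lt_div_iff₀ (by positivity)]; linarith
    have hex := exists_isProxPt hr (smoothOn_zero _) hη hy₀
      (m := m - p.fAvg y₀ - ‖p.gAvg y₀‖ ^ 2 / (2 * L)) hκ (fun y hy => by
        have h1 := (abs_le.1 (hf.first_order hr.convexOn.1 hy₀ hy)).2
        have h2 := (abs_le.1 (abs_real_inner_le_norm (p.gAvg y₀) (y - y₀))).2
        have h3 : ‖p.gAvg y₀‖ * ‖y - y₀‖ ≤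
            ‖p.gAvg y₀‖ ^ 2 / (2 * L) + L / 2 * ‖y - y₀‖ ^ 2 := by
          rw [← sub_nonneg]
          have e : ‖p.gAvg y₀‖ ^ 2 / (2 * L) + L / 2 * ‖y - y₀‖ ^ 2 - ‖p.gAvg y₀‖ * ‖y - y₀‖ =
              (‖p.gAvg y₀‖ - L * ‖y - y₀‖) ^ 2 / (2 * L) := by field_simp; ring
          rw [e]; positivity
        have h4 := hm y hy
        linarith) x
    have := isProxPt_prox hr hex
    rwa [comp_zero] at this

lemma ProxSetting.exists_moreauEnv_lower_bound (h : ProxSetting p.r p.fAvg p.gAvg L lam η)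
    (hreg : p.IsRegular L) : BddBelow (Set.range (moreauEnv (comp p.fAvg p.r) lam)) := by
  obtain ⟨m, hm⟩ := hreg.exists_lower_bound
  refine ⟨m, ?_⟩
  rintro _ ⟨x, rfl⟩
  rw [h.moreauEnv_eq]
  have h1 := hm _ (h.proxPt x).1
  have := h.lam_pos
  have h2 : 0 ≤ 1 / (2 * lam) * ‖prox (comp p.fAvg p.r) lam x - x‖ ^ 2 := by positivity
  unfold realObj
  linarith

end Setting

/-! ### Averaging over a uniform random index -/

/-- The integrand is split over the events `τ = t`, and independence factors each piece. -/
lemma integral_uniformIndex {Ω : Type*} [MeasurableSpace Ω] {P : Measure Ω}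
    [IsProbabilityMeasure P] {α : Type*} [MeasurableSpace α] {ζ : Ω → α} {T : ℕ} {τ : Ω → ℕ}
    (hτ : IsUniformIndex P T τ) (hind : IndepFun τ ζ P) {u : ℕ → Ω → ℝ}
    (hu : ∀ t, Measurable[MeasurableSpace.comap ζ inferInstance] (u t))
    (hui : ∀ t, Integrable (u t) P) :
    Integrable (fun ω => u (τ ω) ω) P ∧
      ∫ ω, u (τ ω) ω ∂P = 1 / T * ∑ t ∈ Finset.range T, ∫ ω, u t ω ∂P := by
  obtain ⟨hT, hτm, hτu⟩ := hτ
  have hT' : (T : ENNReal) ≠ 0 := by exact_mod_cast hT.ne'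
  -- Only the masses below `T` are prescribed; they add up to one, so other values of `τ` are null.
  have hlt : ∀ᵐ ω ∂P, τ ω < T := by
    have hpre : MeasurableSet {ω | τ ω < T} := hτm (measurableSet_Iio (a := T))
    rw [ae_iff]
    change P {ω | τ ω < T}ᶜ = 0
    rw [prob_compl_eq_zero_iff hpre]
    have e : {ω | τ ω < T} = ⋃ t ∈ Finset.range T, τ ⁻¹' {t} := by
      ext ω; simp
    rw [e, measure_biUnion_finset]
    · rw [Finset.sum_congr rfl fun t ht => hτu t (Finset.mem_range.1 ht)]
      simp [ENNReal.mul_inv_cancel hT' (ENNReal.natCast_ne_top T)]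
    · intro a _ b _ hab
      exact Disjoint.preimage τ (by simpa using hab)
    · exact fun t _ => hτm (measurableSet_singleton t)
  have hset : ∀ t, MeasurableSet (τ ⁻¹' {t}) := fun t => hτm (measurableSet_singleton t)
  have heq : (fun ω => u (τ ω) ω) =ᵐ[P]
      fun ω => ∑ t ∈ Finset.range T, (τ ⁻¹' {t}).indicator (u t) ω := by
    filter_upwards [hlt] with ω hω
    rw [Finset.sum_eq_single (τ ω)]
    · simp
    · intro b _ hb; simp [hb.symm]
    · intro hb; exact absurd (Finset.mem_range.2 hω) hb
  have hint : ∀ t ∈ Finset.range T, Integrable ((τ ⁻¹' {t}).indicator (u t)) P :=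
    fun t _ => (hui t).indicator (hset t)
  refine ⟨(integrable_finsetSum _ hint).congr heq.symm, ?_⟩
  rw [integral_congr_ae heq, integral_finsetSum _ hint, Finset.mul_sum]
  refine Finset.sum_congr rfl fun t ht => ?_
  have hprod : (τ ⁻¹' {t}).indicator (u t) =
      fun ω => (τ ⁻¹' {t}).indicator (fun _ => (1 : ℝ)) ω * u t ω := by
    funext ω; by_cases h : ω ∈ τ ⁻¹' {t} <;> simp [h]
  have hI : IndepFun ((τ ⁻¹' {t}).indicator fun _ => (1 : ℝ)) (u t) P := by
    rw [IndepFun_iff_Indep] at hind ⊢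
    refine indep_of_indep_of_le_left (indep_of_indep_of_le_right hind (hu t).comap_le) ?_
    have : Measurable[MeasurableSpace.comap τ inferInstance]
        ((τ ⁻¹' {t}).indicator fun _ => (1 : ℝ)) :=
      measurable_const.indicator ⟨{t}, measurableSet_singleton t, rfl⟩
    exact this.comap_le
  rw [hprod, hI.integral_fun_mul_eq_mul_integral
    (measurable_const.indicator (hset t)).aestronglyMeasurable (hui t).1]
  congr 1
  rw [integral_indicator_const _ (hset t), measureReal_def, hτu t (Finset.mem_range.1 ht)]
  simp

/-! ### Stationarity at the random index, and the iteration count for small accuracy. -/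

section Main

variable {n d : ℕ} {Ξ : Fin n → Type*} [∀ i, MeasurableSpace (Ξ i)] {Ω : Type*}
  {p : Problem n d Ξ} {W : Matrix (Fin n) (Fin n) ℝ} {L lam η ρ σ : ℝ}
  {ξ : ∀ i, ℕ → Ω → Ξ i} {x0 : Vec d}

/-- Independence of `τ` is assumed from the whole sample family; this transfers it to quantities
determined by the past. -/
lemma past_le_comap (ξ : ∀ i, ℕ → Ω → Ξ i) (t : ℕ) : past ξ t ≤
    MeasurableSpace.comap (fun (ω : Ω) (q : Fin n × ℕ) => ξ q.1 q.2 ω) inferInstance := by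
  refine iSup₂_le fun q _ => ?_
  have : Measurable[MeasurableSpace.comap (fun (ω : Ω) (q : Fin n × ℕ) => ξ q.1 q.2 ω)
      inferInstance] (ξ q.1 q.2) :=
    (measurable_pi_apply (X := fun q : Fin n × ℕ => Ξ q.1) q).comp
      (comap_measurable fun (ω : Ω) (q : Fin n × ℕ) => ξ q.1 q.2 ω)
  exact this.comap_le

variable [MeasurableSpace Ω] {P : Measure Ω} [IsProbabilityMeasure P]

lemma sum_gradient_sq_eq (h : ProxSetting p.r p.fAvg p.gAvg L lam η) (X : Fin n → Vec d) :
    ∑ i, ‖gradient (moreauEnv p.phi lam) (X i)‖ ^ 2 =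
      1 / lam ^ 2 * residualSq p.r p.fAvg lam X := by
  rw [p.phi_eq_comp, residualSq, sumSq, Finset.mul_sum]
  refine Finset.sum_congr rfl fun i _ => ?_
  rw [h.gradient_moreauEnv, norm_smul, mul_pow, Real.norm_eq_abs, sq_abs, div_pow, one_pow]

lemma RunSetting.isExpectedStationary (h : RunSetting p W L lam η ρ σ P ξ x0)
    (hL : 0 < L) (hβ : ρ * L * η ≤ (1 - ρ ^ 2) ^ 4 / 96) (hα : ρ * L * lam ≤ 1 / 96)
    {ε : ℝ} (hε : 0 < ε) (hησ : η * (9232 * σ ^ 2) ≤ lam * (1 - ρ ^ 2) ^ 3 * ε ^ 2) {T : ℕ}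
    (hT : iterBound n (p.gap lam x0) (p.initDispersion P ξ x0) η lam ρ ε ≤ T) {τ : Ω → ℕ}
    (hτ : IsUniformIndex P T τ)
    (hind : IndepFun τ (fun (ω : Ω) (q : Fin n × ℕ) => ξ q.1 q.2 ω) P) :
    p.IsExpectedStationary L lam ε P fun ω => xs p W η x0 ξ (τ ω) ω := by
  have hl := h.setting.lam_pos
  have hη := h.setting.eta_pos
  have hq : 0 < 1 - ρ ^ 2 := sub_pos.2 h.rho_sq_lt_one
  have hn : (0 : ℝ) < n := by exact_mod_cast h.n_pos
  have hT0 : (0 : ℝ) < T := by exact_mod_cast hτ.1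
  have hbdd := h.setting.exists_moreauEnv_lower_bound h.reg
  set m := ⨅ x, moreauEnv p.phi lam x with hm
  have hmle : ∀ x, m ≤ moreauEnv (comp p.fAvg p.r) lam x := fun x => ciInf_le hbdd x
  set u : ℕ → Ω → ℝ := fun t ω =>
    1 / lam ^ 2 * residualSq p.r p.fAvg lam (xs p W η x0 ξ t ω)
      + L ^ 2 * consensusSq (xs p W η x0 ξ t ω) with hu
  have hui : ∀ t, Integrable (u t) P := fun t => ((h.integrable_residualSq t).const_mul _).add
    ((integrable_consensusSq (h.state_memLp t).1).const_mul _)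
  have hum : ∀ t, Measurable[past ξ t] (u t) := by
    intro t
    have hx := (h.measurable_past_state t).1
    have hp : ∀ i, Measurable[past ξ t] fun ω =>
        prox (comp p.fAvg p.r) lam (xs p W η x0 ξ t ω i) :=
      fun i => h.setting.continuous_prox.measurable.comp (hx i)
    have hsq : Measurable fun v : Vec d => ‖v‖ ^ 2 := by fun_prop
    exact ((Finset.measurable_sum Finset.univ fun i _ => hsq.comp ((hx i).sub (hp i))).const_mul
      (1 / lam ^ 2)).add ((Finset.measurable_sum Finset.univ fun i _ =>
        hsq.comp ((hx i).sub (measurable_avg hx))).const_mul (L ^ 2))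
  obtain ⟨hI, hE⟩ := integral_uniformIndex hτ hind
    (fun t => (hum t).mono (past_le_comap ξ t) le_rfl) hui
  have he : (fun ω => (∑ i, ‖gradient (moreauEnv p.phi lam) (xs p W η x0 ξ (τ ω) ω i)‖ ^ 2)
      + L ^ 2 * consensusSq (xs p W η x0 ξ (τ ω) ω)) = fun ω => u (τ ω) ω := by
    funext ω; rw [sum_gradient_sq_eq h.setting]
  refine ⟨hl, ?_, h.setting.differentiable_moreauEnv, ?_, ?_⟩
  · rw [lt_div_iff₀ hL]; have := h.setting.lam_mul_le; linarith
  · rw [he]; exact hI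
  · rw [he, hE]
    have hsum := h.sum_stationarity_le hβ hα hmle T
    have hsum' : ∑ t ∈ Finset.range T, ∫ ω, u t ω ∂P =
        ∑ t ∈ Finset.range T,
          (1 / lam ^ 2 * ∫ ω, residualSq p.r p.fAvg lam (xs p W η x0 ξ t ω) ∂P
            + L ^ 2 * ∫ ω, consensusSq (xs p W η x0 ξ t ω) ∂P) := by
      refine Finset.sum_congr rfl fun t _ => ?_
      refine (integral_add' ((h.integrable_residualSq t).const_mul _)
        ((integrable_consensusSq (h.state_memLp t).1).const_mul _)).trans ?_
      rw [integral_const_mul, integral_const_mul]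
    rw [hsum', ← mul_assoc]
    set S := p.initDispersion P ξ x0
    have hgap : p.gap lam x0 = moreauEnv (comp p.fAvg p.r) lam x0 - m := rfl
    rw [← hgap] at hsum
    set Δ := p.gap lam x0
    have hT1 := Nat.ceil_le.1 hT
    -- The total budget is `nTε²`. Half of it pays for the initial gap and dispersion, through `T ≥
    -- T_ε`.
    have h1 : 8 * (n * Δ) / η + η * (768 * S) / (lam * (1 - ρ ^ 2) ^ 3) ≤ n * T * ε ^ 2 / 2 := by
      have e : 8 * (n * Δ) / η + η * (768 * S) / (lam * (1 - ρ ^ 2) ^ 3) =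
          n * ε ^ 2 / 2 * (16 * Δ / (η * ε ^ 2)
            + 1536 * η * S / (n * lam * (1 - ρ ^ 2) ^ 3 * ε ^ 2)) := by
        field_simp; ring
      rw [e]
      calc _ ≤ n * ε ^ 2 / 2 * (T : ℝ) := by gcongr
        _ = n * T * ε ^ 2 / 2 := by ring
    -- The other half pays for the variance, through the third bound on `η`, as `9232 = 2·4616`.
    have h2 : η * (4616 * (T * (n * σ ^ 2))) / (lam * (1 - ρ ^ 2) ^ 3) ≤ n * T * ε ^ 2 / 2 := by
      rw [div_le_iff₀ (by positivity)]
      have := mul_le_mul_of_nonneg_left hησ (by positivity : 0 ≤ n * (T : ℝ) / 2)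
      linarith
    have h3 : ∑ t ∈ Finset.range T,
        (1 / lam ^ 2 * ∫ ω, residualSq p.r p.fAvg lam (xs p W η x0 ξ t ω) ∂P
          + L ^ 2 * ∫ ω, consensusSq (xs p W η x0 ξ t ω) ∂P) ≤ n * T * ε ^ 2 := by
      refine hsum.trans ?_
      rw [mul_add, add_div]
      linarith
    calc _ ≤ 1 / (n : ℝ) * (1 / T) * (n * T * ε ^ 2) := by gcongr
      _ = ε ^ 2 := by field_simp

/-- For small `ε` the third term in the step size is active and the iteration bound is dominated by
its leading term. -/
lemma exists_small_eps {n : ℕ} {L ρ σ Δ S : ℝ} (hn : 0 < n) (hL : 0 < L) (h0 : 0 ≤ ρ)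
    (h1 : ρ < 1) (hσ : 0 < σ) (hΔ : 0 < Δ) (hS : 0 ≤ S) :
    ∃ ε₀ : ℝ, 0 < ε₀ ∧ ∀ ε : ℝ, 0 < ε → ε ≤ ε₀ →
      etaOf L ρ σ ε = lamOf L ρ * (1 - ρ ^ 2) ^ 3 * ε ^ 2 / (9232 * σ ^ 2) ∧
      1 ≤ iterBound n Δ S (etaOf L ρ σ ε) (lamOf L ρ) ρ ε ∧
      (iterBound n Δ S (etaOf L ρ σ ε) (lamOf L ρ) ρ ε : ℝ) ≤
        295424 * (σ ^ 2 * Δ / (lamOf L ρ * (1 - ρ ^ 2) ^ 3 * ε ^ 4)) := by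
  have hq : 0 < 1 - ρ ^ 2 := by nlinarith
  have hl := lamOf_pos hL h0
  have hm := etaMax_pos hL h0 h1
  have hn' : (0 : ℝ) < n := by exact_mod_cast hn
  set lam := lamOf L ρ
  set c0 := lam * (1 - ρ ^ 2) ^ 3 / (9232 * σ ^ 2) with hc0
  have hc0p : 0 < c0 := by positivity
  set c := 1536 * S / (9232 * σ ^ 2 * n) with hc
  have hcp : 0 ≤ c := by positivity
  -- `147712 = 16·9232`. With `η` proportional to `ε²`, the gap term becomes `K/ε⁴` and the
  -- dispersion term the `ε`-independent constant `c`.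
  set K := 147712 * (σ ^ 2 * Δ / (lam * (1 - ρ ^ 2) ^ 3)) with hK
  have hKp : 0 < K := by positivity
  refine ⟨min 1 (min (etaMax L ρ / c0) (K / (c + 1))), by positivity, fun ε hε hle => ?_⟩
  have hε1 : ε ≤ 1 := hle.trans (min_le_left _ _)
  have hεm : ε * c0 ≤ etaMax L ρ := by
    rw [← le_div_iff₀ hc0p]
    exact hle.trans ((min_le_right _ _).trans (min_le_left _ _))
  have hεK : ε * (c + 1) ≤ K := by
    rw [← le_div_iff₀ (by positivity)]
    exact hle.trans ((min_le_right _ _).trans (min_le_right _ _))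
  have hη : etaOf L ρ σ ε = lam * (1 - ρ ^ 2) ^ 3 * ε ^ 2 / (9232 * σ ^ 2) := by
    rw [etaOf, if_neg hσ.ne']
    apply min_eq_right
    calc lam * (1 - ρ ^ 2) ^ 3 * ε ^ 2 / (9232 * σ ^ 2) = ε ^ 2 * c0 := by rw [hc0]; ring
      _ ≤ ε * c0 := by gcongr; exact pow_le_of_le_one hε.le hε1 (by norm_num)
      _ ≤ _ := hεm
  have hval : 16 * Δ / (etaOf L ρ σ ε * ε ^ 2)
      + 1536 * etaOf L ρ σ ε * S / (n * lam * (1 - ρ ^ 2) ^ 3 * ε ^ 2) = K / ε ^ 4 + c := by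
    rw [hη, hK, hc]; field_simp; ring
  -- The leading term dominates both `c` and the rounding of the ceiling; this is where the factor
  -- `2` in `295424 = 2·147712` comes from.
  have hKε : c + 1 ≤ K / ε ^ 4 := by
    rw [le_div_iff₀ (by positivity)]
    have : ε ^ 4 ≤ ε := pow_le_of_le_one hε.le hε1 (by norm_num)
    nlinarith
  have hpos : 0 < K / ε ^ 4 + c := by positivity
  refine ⟨hη, ?_, ?_⟩
  · rw [iterBound, hval, Nat.one_le_ceil_iff]; exact hpos
  · rw [iterBound, hval]
    have := (Nat.ceil_lt_add_one hpos.le).le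
    have e : 295424 * (σ ^ 2 * Δ / (lam * (1 - ρ ^ 2) ^ 3 * ε ^ 4)) = 2 * (K / ε ^ 4) := by
      rw [hK]; field_simp; ring
    rw [e]; linarith

end Main

end

end DProx

end

theorem mainTheorem2 {n d : ℕ} {Ξ : Fin n → Type*} [∀ i, MeasurableSpace (Ξ i)]
    (p : DProx.Problem n d Ξ) (L σ : ℝ)
    (hreg : p.IsRegular L) (hsg : p.IsStochGrad σ)
    (G : SimpleGraph (Fin n)) (hG : G.Connected)
    (W : Matrix (Fin n) (Fin n) ℝ) (hW : DProx.IsMixing G W)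
    (ρ lam : ℝ) (hρ : ρ = DProx.mixRho W) (hlam : lam = DProx.lamOf L ρ)
    {Ω : Type*} [MeasurableSpace Ω] (P : Measure Ω) [IsProbabilityMeasure P]
    (ξ : ∀ i, ℕ → Ω → Ξ i) (hξ : p.IsSampling P ξ)
    (x0 : DProx.Vec d) (hx0 : x0 ∈ DProx.effDom p.r)
    (η : ℝ → ℝ) (hη : ∀ ε, η ε = DProx.etaOf L ρ σ ε)
    (Tε : ℝ → ℕ)
    (hTε : ∀ ε, Tε ε =
      DProx.iterBound n (p.gap lam x0) (p.initDispersion P ξ x0) (η ε) lam ρ ε) :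
    (∀ ε : ℝ, 0 < ε → ∀ T : ℕ, Tε ε ≤ T →
      ∀ τ : Ω → ℕ, DProx.IsUniformIndex P T τ →
        IndepFun τ (fun (ω : Ω) (q : Fin n × ℕ) => ξ q.1 q.2 ω) P →
        p.IsExpectedStationary L lam ε P
          (fun ω => (p.run W (η ε) x0 (fun i t => ξ i t ω) (τ ω)).x)) ∧
    (0 < σ → 0 < p.gap lam x0 →
      ∃ ε₀ : ℝ, 0 < ε₀ ∧ ∀ ε : ℝ, 0 < ε → ε ≤ ε₀ →
        η ε = lam * (1 - ρ ^ 2) ^ 3 * ε ^ 2 / (9232 * σ ^ 2) ∧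
        1 ≤ Tε ε ∧
        (Tε ε : ℝ) ≤ 295424 * (σ ^ 2 * p.gap lam x0 / (lam * (1 - ρ ^ 2) ^ 3 * ε ^ 4)) ∧
        ∀ (ω : Ω) (i : Fin n),
          ((p.run W (η ε) x0 (fun i t => ξ i t ω) (Tε ε)).used i : ℝ) ≤
            295424 * (σ ^ 2 * p.gap lam x0 / (lam * (1 - ρ ^ 2) ^ 3 * ε ^ 4))) := by
  have hn : 0 < n := Fin.pos_iff_nonempty.2 hG.nonempty
  have hmix := hW.mixes
  rw [← hρ] at hmix
  have hL := hreg.L_pos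
  have h0 := hmix.rho_nonneg
  have h1 := hmix.rho_lt_one
  refine ⟨fun ε hε T hT τ hτ hind => ?_, fun hσ hgap => ?_⟩
  · rw [hTε] at hT
    have hs : DProx.RunSetting p W L lam (η ε) ρ σ P ξ x0 := by
      refine ⟨hreg, hsg, hξ, hreg.proxSetting hsg hn ?_ ?_ ?_ ?_, hmix, hx0, hn⟩
      · rw [hlam]; exact DProx.lamOf_pos hL h0
      · rw [hlam]; exact DProx.lamOf_mul_le hL
      · rw [hη]; exact DProx.etaOf_pos hL h0 h1 hε
      · rw [hη, hlam]; exact DProx.etaOf_le_etaMax.trans (DProx.etaMax_le_lamOf hL h0 h1)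
    refine hs.isExpectedStationary hL ?_ ?_ hε ?_ hT hτ hind
    · refine le_trans ?_ (DProx.rho_mul_etaMax_le hL h0)
      rw [hη]
      exact mul_le_mul_of_nonneg_left DProx.etaOf_le_etaMax (mul_nonneg h0 hL.le)
    · rw [hlam]; exact DProx.rho_mul_lamOf_le hL h0
    · rw [hη, hlam]; exact DProx.etaOf_mul_le hL h0 h1
  · obtain ⟨ε₀, hε₀, h⟩ := DProx.exists_small_eps hn hL h0 h1 hσ hgap
      (DProx.initDispersion_nonneg (p := p) (P := P) (ξ := ξ) (x0 := x0))
    refine ⟨ε₀, hε₀, fun ε hε hle => ?_⟩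
    obtain ⟨ha, hb, hc⟩ := h ε hε hle
    rw [← hlam, ← hη] at ha hb hc
    rw [← hTε] at hb hc
    refine ⟨ha, hb, hc, fun ω i => ?_⟩
    rw [DProx.Problem.used_run]
    exact hc
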